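/- Let $H^1=H^1(\mathbb R)$ and $W^{1,\infty}=W^{1,\infty}(\mathbb R)$, with distributional derivatives and norms $\|f\|_{1,2}=(\|f\|_{L^2}^2+\|f'\|_{L^2}^2)^{1/2}$, $\|f\|_{1,\infty}=\|f\|_{L^\infty}+\|f'\|_{L^\infty}$. Let $X=H^1\cap W^{1,\infty}$ with $\|f\|_X=\|f\|_{1,2}+\|f\|_{1,\infty}$, and for $T>0$ let $$Z_T=C([-T,T]:H^1)\cap L^\infty([-T,T]:W^{1,\infty})\cap C^1((-T,T):L^2(\mathbb R)).$$ For $\kappa\in\mathbb R$ and $u_0\in X$ consider the initial value problem for the Camassa–Holm equation $$\partial_tu+\kappa\,\partial_xu+3u\,\partial_xu-\partial_t\partial_x^2u=2\,\partial_xu\,\partial_x^2u+u\,\partial_x^3u,\qquad u(\cdot,0)=u_0 .$$ A solution in $Z_T$ is a function $u\in Z_T$ with $u(\cdot,0)=u_0$ which satisfies the equation in $\mathcal D'(\mathbb R)$ for every $t\in(-T,T)$, where the right-hand side is read as $\partial_x\big((\partial_xu)^2\big)+\big[\partial_x^2(u\,\partial_xu)-\tfrac32\,\partial_x\big((\partial_xu)^2\big)\big]$.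 **Theorem.** There is a universal constant $c>0$ such that for every $\kappa\in\mathbb R$ there is a nonincreasing function $T:[0,\infty)\to(0,\infty)$ with the following properties. 1. For every $u_0\in X$, with $T=T(\|u_0\|_X)$, there is a unique solution $u\in Z_T$ of the initial value problem, and $$\sup_{t\in[-T,T]}\|u(\cdot,t)\|_X\le c\,\|u_0\|_X .$$ 2. For every $B>0$ the map $u_0\mapsto u$ is continuous from the ball $\{u_0\in X:\|u_0\|_X\le B\}$, with the metric of $X$, into $Z_{T(B)}$, in the following sense: for every $u_0$ in the ball and every $\varepsilon>0$ there is $\delta>0$ such that, if $v_0$ is in the ball, $\|v_0-u_0\|_X<\delta$, and $u,v\in Z_{T(B)}$ are solutions with data $u_0,v_0$, then $\|v(\cdot,t)-u(\cdot,t)\|_{1,2}<\varepsilon$ for all $t\in[-T(B),T(B)]$ and $\|\partial_tv(\cdot,t)-\partial_tu(\cdot,t)\|_{L^2}<\varepsilon$ for all $t\in(-T(B),T(B))$. Moreover the class contains the peakons: for all $a>0$ and $T>0$ the function $u(x,t)=a\,e^{-|x-at|}$ has $u(\cdot,0)\in X$ and is a solution in $Z_T$ of the equation with $\kappa=0$.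 -/

import Mathlib

open MeasureTheory Set
open scoped NNReal ENNReal

noncomputable section

namespace CamassaHolm

/-- The space `L²(ℝ)` of real functions. -/
abbrev L2 : Type := Lp ℝ 2 (volume : Measure ℝ)

/-- `φ ∈ C_c^∞(ℝ)`. -/
def IsTestFunction (φ : ℝ → ℝ) : Prop :=
  ContDiff ℝ (⊤ : ℕ∞) φ ∧ HasCompactSupport φ

/-- `g` is the derivative of `f` in the sense of distributions on `ℝ`, for `f, g ∈ L²(ℝ)`. -/
def HasWeakDeriv (f g : L2) : Prop :=
  ∀ φ : ℝ → ℝ, IsTestFunction φ → ∫ x, f x * deriv φ x = -∫ x, g x * φ x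

theorem integrable_mul_of_continuous (f : L2) {ψ : ℝ → ℝ} (hψ : Continuous ψ)
    (hc : HasCompactSupport ψ) : Integrable (fun x => f x * ψ x) :=
  MemLp.integrable_mul (p := 2) (q := 2) (Lp.memLp f) (hψ.memLp_of_hasCompactSupport hc)

theorem integral_add_mul (f g : L2) {ψ : ℝ → ℝ} (hψ : Continuous ψ)
    (hc : HasCompactSupport ψ) :
    ∫ x, (f + g : L2) x * ψ x = (∫ x, f x * ψ x) + ∫ x, g x * ψ x := by
  rw [← integral_add (integrable_mul_of_continuous f hψ hc)
    (integrable_mul_of_continuous g hψ hc)]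
  apply integral_congr_ae
  filter_upwards [Lp.coeFn_add f g] with x hx
  rw [hx, Pi.add_apply, add_mul]

theorem integral_smul_mul (a : ℝ) (f : L2) (ψ : ℝ → ℝ) :
    ∫ x, (a • f : L2) x * ψ x = a * ∫ x, f x * ψ x := by
  rw [← integral_const_mul]
  apply integral_congr_ae
  filter_upwards [Lp.coeFn_smul a f] with x hx
  rw [hx, Pi.smul_apply, smul_eq_mul, mul_assoc]

theorem HasWeakDeriv.zero : HasWeakDeriv 0 0 := by
  intro φ _
  have h (ψ : ℝ → ℝ) : ∫ x, (0 : L2) x * ψ x = 0 := by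
    simpa only [zero_smul, zero_mul] using integral_smul_mul 0 (0 : L2) ψ
  rw [h, h, neg_zero]

theorem HasWeakDeriv.add {f f' g g' : L2} (hf : HasWeakDeriv f f') (hg : HasWeakDeriv g g') :
    HasWeakDeriv (f + g) (f' + g') := by
  intro φ hφ
  rw [integral_add_mul f g (hφ.1.continuous_deriv (by simp)) hφ.2.deriv,
    integral_add_mul f' g' hφ.1.continuous hφ.2, hf φ hφ, hg φ hφ]
  ring

theorem HasWeakDeriv.smul (a : ℝ) {f f' : L2} (hf : HasWeakDeriv f f') :
    HasWeakDeriv (a • f) (a • f') := by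
  intro φ hφ
  rw [integral_smul_mul, integral_smul_mul, hf φ hφ]
  ring

/-- The Sobolev space `H¹(ℝ)`, as the space of pairs `(f, f')` of `L²` functions with `f'` the
distributional derivative of `f`; it inherits the norm `(‖f‖₂² + ‖f'‖₂²)^(1/2)`. -/
def H1space : Submodule ℝ (WithLp 2 (L2 × L2)) where
  carrier := {p | HasWeakDeriv p.fst p.snd}
  zero_mem' := HasWeakDeriv.zero
  add_mem' := fun hp hq => HasWeakDeriv.add hp hq
  smul_mem' := fun a _ hp => HasWeakDeriv.smul a hp

/-- `H¹(ℝ)` as a normed space. -/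
abbrev H1 : Type := ↥H1space

/-- The underlying `L²` function of an element of `H¹`. -/
def H1.fn (f : H1) : L2 := (f : WithLp 2 (L2 × L2)).fst

/-- The distributional derivative of an element of `H¹`. -/
def H1.dx (f : H1) : L2 := (f : WithLp 2 (L2 × L2)).snd

/-- `‖f‖_{1,∞} = ‖f‖_∞ + ‖f'‖_∞`; it is finite exactly when `f ∈ W^{1,∞}`. -/
def normW1inf (f : H1) : ℝ≥0∞ :=
  eLpNorm f.fn ⊤ volume + eLpNorm f.dx ⊤ volume

/-- `‖f‖_X = ‖f‖_{1,2} + ‖f‖_{1,∞}`; it is finite exactly when `f ∈ X = H¹ ∩ W^{1,∞}`. -/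
def normX (f : H1) : ℝ≥0∞ := ‖f‖ₑ + normW1inf f

/-- The class `Z_T = C([-T,T] : H¹) ∩ L^∞([-T,T] : W^{1,∞}) ∩ C¹((-T,T) : L²)`. The function
`u(·,t)` is written `u t`; only its values for `t ∈ [-T,T]` matter. -/
structure MemZ (T : ℝ) (u : ℝ → H1) : Prop where
  continuousOn_H1 : ContinuousOn u (Icc (-T) T)
  bounded_W1inf : ∃ C : ℝ≥0, ∀ᵐ t ∂(volume.restrict (Icc (-T) T)), normW1inf (u t) ≤ C
  contDiffOn_L2 : ContDiffOn ℝ 1 (fun t => (u t).fn) (Ioo (-T) T)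

/-- The time derivative `∂ₜu(·,t) ∈ L²(ℝ)`. -/
def dt (u : ℝ → H1) (t : ℝ) : L2 := deriv (fun τ => (u τ).fn) t

/-- The equation
`∂ₜu + κ ∂ₓu + 3 u ∂ₓu - ∂ₜ∂ₓ²u = 2 ∂ₓu ∂ₓ²u + u ∂ₓ³u`
in the sense of distributions on `ℝ`, at a time where `u(·,t) = v ∈ H¹` and `∂ₜu(·,t) = vt ∈ L²`.
The products on the right are read as the distributions
`2 ∂ₓv ∂ₓ²v = ∂ₓ((∂ₓv)²)` and `v ∂ₓ³v = ∂ₓ²(v ∂ₓv) - (3/2) ∂ₓ((∂ₓv)²)`. -/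
def CHEquation (κ : ℝ) (v : H1) (vt : L2) : Prop :=
  ∀ φ : ℝ → ℝ, IsTestFunction φ →
    (∫ x, vt x * φ x) + κ * (∫ x, v.dx x * φ x) + 3 * (∫ x, v.fn x * v.dx x * φ x)
        - (∫ x, vt x * deriv (deriv φ) x)
      = -(∫ x, (v.dx x) ^ 2 * deriv φ x)
        + ((∫ x, v.fn x * v.dx x * deriv (deriv φ) x)
          + 3 / 2 * ∫ x, (v.dx x) ^ 2 * deriv φ x)

/-- `u ∈ Z_T` solves the initial value problem of the Camassa–Holm equation with datum `u₀`. -/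
structure IsSolution (κ T : ℝ) (u₀ : H1) (u : ℝ → H1) : Prop where
  memZ : MemZ T u
  initial : u 0 = u₀
  equation : ∀ t ∈ Ioo (-T) T, CHEquation κ (u t) (dt u t)

end CamassaHolm

end

/-!
The equation says that `∂ₜu + u ∂ₓu = -∂ₓ(1 - ∂ₓ²)⁻¹(u² + (∂ₓu)²/2 + κ u)`. In Eulerian coordinates
the transport term loses a derivative. In Lagrangian coordinates there is no loss. Let `ξ_t = id +
ζ(t)` be the flow of `u` and `U(t) = u(t) ∘ ξ_t`. Then `z = (ζ, U)` is a curve in the Hilbert space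
`H¹ × H¹` with `∂ₜζ = U` and `∂ₜU` equal to the nonlocal force at `ξ_t`. The force is the function
`-Q` of the first order elliptic system `∂P = J Q`, `∂Q = J P - h`, where `J = 1 + ∂ζ` is the
density of `ξ_t` and `h = (u² + (∂ₓu)²/2 + κ u) ∘ ξ_t · J` (`IsPotential`). This system is solvable
by Lax–Milgram, and an energy estimate shows that `(P, Q)` is a Lipschitz function of `J` and of `h`
(`IsPotential.norm_sub_le`). So `z` solves an ordinary differential equation with a locally
Lipschitz right-hand side, once `J`, `U` and `∂U` are truncated pointwise to the ranges in which
they are expected (`lagrangeField`).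

*Existence.* The Picard–Lindelöf theorem gives an integral curve, and the `L^∞` bounds of the force
show that for a short time, depending only on the size of the datum, none of the truncations is
active (`exists_lagrangian`). Then `ξ_t` is bi-Lipschitz and `u = U ∘ ξ_t⁻¹` is continuous in `H¹`,
bounded in `W^{1,∞}`, and differentiable in `L²`, with the derivative prescribed by the equation
(`IsLagrangian.hasDerivAt_eulerian_fn`). The equation itself is equivalent to this evolution
equation because `1 - ∂ₓ²` is injective on `L²` (`chEquation_iff`).

*Uniqueness and continuous dependence.* Every solution in `Z_T` is Lipschitz in `x`, uniformly in
`t`, so it has a bi-Lipschitz flow. The displacement of the flow is in `H¹`, by duality with test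
functions, and the solution therefore comes from an integral curve of the same vector field
(`IsEulerian.exists_isLagrangian`). Grönwall's inequality makes the integral curves Lipschitz
functions of their data. Going back to Eulerian coordinates is only continuous: `f ∘ θ` depends
continuously on `θ`, uniformly for `f` in a compact set of `L²`, and the orbit of a fixed solution is
compact (`exists_norm_compL2_sub_le_of_isCompact`, `IsEulerian.exists_norm_sub_lt`).

*Peakons.* For the profile `v(x) = a e^{-|x - b|}` the potential is explicit: `P = a v - v²/2` and
`Q = (a - v) ∂ₓv`. The jump of `∂ₓv` at the crest does not spoil the weak differentiability of `Q`,
as `a - v` vanishes there (`isPrimitive_peak_force`). Hence `-v ∂ₓv - Q = -a ∂ₓv`, which is the time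
derivative of the wave that travels with speed `a`.
-/

noncomputable section

namespace CamassaHolm

open Filter Topology

/-! ### Primitives of locally integrable functions -/

/-- `F` is an indefinite integral of the locally integrable function `g`; equivalently, `F` is
locally absolutely continuous with `F' = g` almost everywhere. -/
structure IsPrimitive (F g : ℝ → ℝ) : Prop where
  locallyIntegrable : LocallyIntegrable g volume
  sub_eq : ∀ a b, F b - F a = ∫ x in a..b, g x

namespace IsPrimitive

variable {F G f g : ℝ → ℝ}

theorem intervalIntegrable (h : IsPrimitive F f) (a b : ℝ) : IntervalIntegrable f volume a b :=
  intervalIntegrable_iff.mpr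
    ((h.locallyIntegrable.integrableOn_isCompact isCompact_uIcc).mono_set uIoc_subset_uIcc)

theorem eq_add (h : IsPrimitive F f) (a : ℝ) : F = fun x => F a + ∫ t in a..x, f t := by
  funext x
  rw [← h.sub_eq a x]
  ring

theorem continuous (h : IsPrimitive F f) : Continuous F := by
  rw [h.eq_add 0]
  exact continuous_const.add
    (intervalIntegral.continuous_primitive (fun a b => h.intervalIntegrable a b) 0)

theorem ae_hasDerivAt (h : IsPrimitive F f) : ∀ᵐ x, HasDerivAt F (f x) x := by
  filter_upwards [LocallyIntegrable.ae_hasDerivAt_integral h.locallyIntegrable] with x hx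
  rw [h.eq_add 0]
  exact (hx 0).const_add _

theorem absolutelyContinuousOnInterval (h : IsPrimitive F f) (a b : ℝ) :
    AbsolutelyContinuousOnInterval F a b := by
  have h1 := (h.intervalIntegrable a b).absolutelyContinuousOnInterval_intervalIntegral
    (c := a) left_mem_uIcc
  have h2 : AbsolutelyContinuousOnInterval (fun _ : ℝ => F a) a b :=
    (LipschitzWith.const (F a)).lipschitzOnWith.absolutelyContinuousOnInterval
  rw [h.eq_add a]
  exact h2.add h1

theorem mul (hF : IsPrimitive F f) (hG : IsPrimitive G g) :
    IsPrimitive (fun x => F x * G x) (fun x => f x * G x + F x * g x) where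
  locallyIntegrable := by
    refine LocallyIntegrable.add ?_ ?_
    · intro x
      exact (hF.locallyIntegrable.mul_continuous hG.continuous) x
    · intro x
      exact (hG.locallyIntegrable.continuous_mul hF.continuous) x
  sub_eq a b := by
    rw [← AbsolutelyContinuousOnInterval.integral_deriv_mul_eq_sub
      (hF.absolutelyContinuousOnInterval a b) (hG.absolutelyContinuousOnInterval a b)]
    apply intervalIntegral.integral_congr_ae
    filter_upwards [hF.ae_hasDerivAt, hG.ae_hasDerivAt] with x h1 h2 _
    rw [h1.deriv, h2.deriv]

theorem of_contDiff {φ : ℝ → ℝ} (h : ContDiff ℝ 1 φ) : IsPrimitive φ (deriv φ) where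
  locallyIntegrable := (h.continuous_deriv le_rfl).locallyIntegrable
  sub_eq a b := by
    rw [intervalIntegral.integral_deriv_eq_sub]
    · intro x _
      exact (h.differentiable one_ne_zero) x
    · exact (h.continuous_deriv le_rfl).intervalIntegrable a b

theorem of_lipschitz {K : ℝ≥0} (h : LipschitzWith K F) : IsPrimitive F (deriv F) where
  locallyIntegrable := by
    intro x
    refine ⟨Icc (x - 1) (x + 1), Icc_mem_nhds (by linarith) (by linarith), ?_⟩
    refine Measure.integrableOn_of_bounded (M := K) (by simp)
      (measurable_deriv F).aestronglyMeasurable ?_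
    exact Eventually.of_forall fun y => norm_deriv_le_of_lipschitz h
  sub_eq a b :=
    (h.lipschitzOnWith.absolutelyContinuousOnInterval (a := a) (b := b)).integral_deriv_eq_sub.symm

/-- An integrable function with an integrable derivative vanishes at infinity, so the derivative
has integral zero. -/
theorem integral_eq_zero (h : IsPrimitive F f) (hF : Integrable F) (hf : Integrable f) :
    ∫ x, f x = 0 := by
  have top : Tendsto F atTop (𝓝 0) := by
    have A : Tendsto F atTop (𝓝 (F 0 + ∫ x in Ioi 0, f x)) := by
      conv in F => rw [h.eq_add 0]
      exact tendsto_const_nhds.add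
        (intervalIntegral_tendsto_integral_Ioi 0 hf.integrableOn tendsto_id)
    have B : F 0 + ∫ x in Ioi 0, f x = 0 := by
      refine IntegrableAtFilter.eq_zero_of_tendsto (hF.integrableAtFilter atTop) ?_ A
      intro s hs
      rcases mem_atTop_sets.1 hs with ⟨b, hb⟩
      rw [← top_le_iff, ← Real.volume_Ici (a := b)]
      exact measure_mono hb
    rwa [B] at A
  have bot : Tendsto F atBot (𝓝 0) := by
    have A : Tendsto F atBot (𝓝 (F 0 - ∫ x in Iic 0, f x)) := by
      conv in F => rw [h.eq_add 0]
      simp_rw [intervalIntegral.integral_symm _ (0 : ℝ), ← sub_eq_add_neg]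
      exact tendsto_const_nhds.sub
        (intervalIntegral_tendsto_integral_Iic 0 hf.integrableOn tendsto_id)
    have B : F 0 - ∫ x in Iic 0, f x = 0 := by
      refine IntegrableAtFilter.eq_zero_of_tendsto (hF.integrableAtFilter atBot) ?_ A
      intro s hs
      rcases mem_atBot_sets.1 hs with ⟨b, hb⟩
      rw [← top_le_iff, ← Real.volume_Iic (a := b)]
      exact measure_mono hb
    rwa [B] at A
  have h1 := intervalIntegral_tendsto_integral hf tendsto_neg_atTop_atBot tendsto_id
  have h2 : Tendsto (fun x : ℝ => ∫ t in (-x)..x, f t) atTop (𝓝 (0 - 0)) := by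
    simp_rw [← h.sub_eq]
    exact top.sub (bot.comp tendsto_neg_atTop_atBot)
  simpa using tendsto_nhds_unique h1 h2

end IsPrimitive

/-! ### Test functions and weak derivatives -/

theorem IsTestFunction.deriv {φ : ℝ → ℝ} (h : IsTestFunction φ) : IsTestFunction (deriv φ) :=
  ⟨(contDiff_infty_iff_deriv.mp h.1).2, h.2.deriv⟩

theorem IsTestFunction.continuous {φ : ℝ → ℝ} (h : IsTestFunction φ) : Continuous φ :=
  h.1.continuous

theorem IsTestFunction.memLp {φ : ℝ → ℝ} (h : IsTestFunction φ) : MemLp φ 2 volume :=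
  h.continuous.memLp_of_hasCompactSupport h.2

theorem IsTestFunction.integrable {φ : ℝ → ℝ} (h : IsTestFunction φ) : Integrable φ :=
  h.continuous.integrable_of_hasCompactSupport h.2

theorem IsTestFunction.isPrimitive {φ : ℝ → ℝ} (h : IsTestFunction φ) :
    IsPrimitive φ (_root_.deriv φ) :=
  IsPrimitive.of_contDiff (h.1.of_le (by exact_mod_cast le_top))

theorem L2.locallyIntegrable (f : L2) : LocallyIntegrable f volume :=
  (Lp.memLp f).locallyIntegrable (by norm_num)

theorem ae_eq_of_test {f g : ℝ → ℝ} (hf : LocallyIntegrable f volume)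
    (hg : LocallyIntegrable g volume)
    (h : ∀ φ, IsTestFunction φ → ∫ x, f x * φ x = ∫ x, g x * φ x) : f =ᵐ[volume] g := by
  refine ae_eq_of_integral_contDiff_smul_eq hf hg fun φ h1 h2 => ?_
  simpa [mul_comm] using h φ ⟨h1, h2⟩

theorem IsTestFunction.integrable_mul {φ g : ℝ → ℝ} (h : IsTestFunction φ)
    (hg : LocallyIntegrable g volume) : Integrable fun x => g x * φ x := by
  simpa [mul_comm] using hg.integrable_smul_left_of_hasCompactSupport h.continuous h.2

theorem IsPrimitive.integral_mul_deriv {F f φ : ℝ → ℝ} (h : IsPrimitive F f)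
    (hφ : IsTestFunction φ) : ∫ x, F x * deriv φ x = -∫ x, f x * φ x := by
  have h1 := hφ.integrable_mul h.locallyIntegrable
  have h2 := hφ.deriv.integrable_mul h.continuous.locallyIntegrable
  have h3 := (h.mul hφ.isPrimitive).integral_eq_zero
    (hφ.integrable_mul h.continuous.locallyIntegrable) (h1.add h2)
  rw [integral_add h1 h2] at h3
  linarith

theorem IsPrimitive.hasWeakDeriv {F f : ℝ → ℝ} (h : IsPrimitive F f) {u v : L2}
    (hu : u =ᵐ[volume] F) (hv : v =ᵐ[volume] f) : HasWeakDeriv u v := by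
  intro φ hφ
  have h1 : ∫ x, u x * deriv φ x = ∫ x, F x * deriv φ x :=
    integral_congr_ae (by filter_upwards [hu] with x hx; rw [hx])
  have h2 : ∫ x, v x * φ x = ∫ x, f x * φ x :=
    integral_congr_ae (by filter_upwards [hv] with x hx; rw [hx])
  rw [h1, h2, h.integral_mul_deriv hφ]

theorem exists_test_integral_eq_one : ∃ ρ : ℝ → ℝ, IsTestFunction ρ ∧ ∫ x, ρ x = 1 := by
  let b : ContDiffBump (0 : ℝ) := ⟨1, 2, by norm_num, by norm_num⟩
  exact ⟨b.normed volume, ⟨b.contDiff_normed, b.hasCompactSupport_normed⟩, b.integral_normed⟩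

/-- A test function of integral zero is the derivative of a test function. -/
theorem IsTestFunction.exists_primitive {ψ : ℝ → ℝ} (h : IsTestFunction ψ) (h0 : ∫ x, ψ x = 0) :
    ∃ φ, IsTestFunction φ ∧ _root_.deriv φ = ψ := by
  obtain ⟨R, hR⟩ : ∃ R : ℝ, tsupport ψ ⊆ Icc (-R) R := by
    obtain ⟨R, hR⟩ := h.2.isCompact.isBounded.subset_closedBall 0
    exact ⟨R, by simpa [Real.closedBall_eq_Icc] using hR⟩
  have hz : ∀ x, x ∉ Icc (-R) R → ψ x = 0 := fun x hx =>
    image_eq_zero_of_notMem_tsupport fun hx' => hx (hR hx')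
  let φ : ℝ → ℝ := fun x => ∫ t in Iic x, ψ t
  have hφ : φ = fun x => φ (-R - 1) + ∫ t in (-R - 1)..x, ψ t := by
    funext x
    rw [← intervalIntegral.integral_Iic_sub_Iic h.integrable.integrableOn h.integrable.integrableOn]
    simp only [φ]
    ring
  have hd : ∀ x, HasDerivAt φ (ψ x) x := by
    intro x
    rw [hφ]
    exact (intervalIntegral.integral_hasDerivAt_right (h.continuous.intervalIntegrable _ _)
      h.continuous.stronglyMeasurable.stronglyMeasurableAtFilter
      h.continuous.continuousAt).const_add _
  have hderiv : _root_.deriv φ = ψ := funext fun x => (hd x).deriv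
  refine ⟨φ, ⟨contDiff_infty_iff_deriv.mpr ⟨fun x => (hd x).differentiableAt, ?_⟩, ?_⟩, hderiv⟩
  · rw [hderiv]
    exact h.1
  · refine HasCompactSupport.intro (isCompact_Icc (a := -R) (b := R)) fun x hx => ?_
    rcases lt_or_ge x (-R) with h1 | h1
    · refine setIntegral_eq_zero_of_forall_eq_zero fun t ht => hz t fun h2 => ?_
      exact absurd h2.1 (not_le.mpr (lt_of_le_of_lt ht h1))
    · have h2 : R < x := by
        by_contra h2
        exact hx ⟨h1, not_lt.mp h2⟩
      have h3 : ∫ t in Ioi x, ψ t = 0 :=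
        setIntegral_eq_zero_of_forall_eq_zero fun t ht => hz t fun h4 =>
          absurd h4.2 (not_le.mpr (h2.trans ht))
      have h4 := intervalIntegral.integral_Iic_add_Ioi (b := x) h.integrable.integrableOn
        h.integrable.integrableOn
      rw [h3, h0, add_zero] at h4
      exact h4

/-- A locally integrable function with vanishing distributional derivative is constant. -/
theorem ae_eq_const_of_test {f : ℝ → ℝ} (hf : LocallyIntegrable f volume)
    (h : ∀ φ, IsTestFunction φ → ∫ x, f x * deriv φ x = 0) : ∃ c, ∀ᵐ x, f x = c := by
  obtain ⟨ρ, hρ, hρ1⟩ := exists_test_integral_eq_one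
  -- `ψ - (∫ ψ) ρ` has integral zero for every test function `ψ`, so it is a derivative.
  refine ⟨∫ x, f x * ρ x, ?_⟩
  refine ae_eq_of_test hf (locallyIntegrable_const _) fun ψ hψ => ?_
  have hk : IsTestFunction fun x => ψ x - (∫ t, ψ t) * ρ x :=
    ⟨hψ.1.sub (contDiff_const.mul hρ.1), hψ.2.sub (hρ.2.mul_left)⟩
  have hk0 : ∫ x, (ψ x - (∫ t, ψ t) * ρ x) = 0 := by
    rw [integral_sub hψ.integrable (hρ.integrable.const_mul _), integral_const_mul, hρ1]
    ring
  obtain ⟨φ, hφ, hφd⟩ := hk.exists_primitive hk0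
  have h1 := h φ hφ
  rw [hφd] at h1
  have h2 : (fun x => f x * (ψ x - (∫ t, ψ t) * ρ x))
      = fun x => f x * ψ x - (∫ t, ψ t) * (f x * ρ x) := by
    funext x
    ring
  rw [h2, integral_sub (hψ.integrable_mul hf) ((hρ.integrable_mul hf).const_mul _),
    integral_const_mul] at h1
  rw [integral_const_mul]
  linarith

/-- A function with a weak derivative is almost everywhere equal to a primitive of it. -/
theorem HasWeakDeriv.exists_isPrimitive {f g : L2} (h : HasWeakDeriv f g) :
    ∃ F, f =ᵐ[volume] F ∧ IsPrimitive F g := by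
  have hG : IsPrimitive (fun x => ∫ t in (0 : ℝ)..x, g t) g := by
    have hi : ∀ a b : ℝ, IntervalIntegrable g volume a b := fun a b =>
      intervalIntegrable_iff.mpr ((g.locallyIntegrable.integrableOn_isCompact
        isCompact_uIcc).mono_set uIoc_subset_uIcc)
    exact ⟨g.locallyIntegrable, fun a b =>
      intervalIntegral.integral_interval_sub_left (hi _ _) (hi _ _)⟩
  obtain ⟨c, hc⟩ := ae_eq_const_of_test (f := fun x => f x - ∫ t in (0 : ℝ)..x, g t)
    (f.locallyIntegrable.sub hG.continuous.locallyIntegrable) fun φ hφ => by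
      have h1 := h φ hφ
      have h2 := hG.integral_mul_deriv hφ
      simp_rw [sub_mul]
      rw [integral_sub (hφ.deriv.integrable_mul f.locallyIntegrable)
        (hφ.deriv.integrable_mul hG.continuous.locallyIntegrable), h1, h2]
      ring
  refine ⟨fun x => c + ∫ t in (0 : ℝ)..x, g t, ?_, hG.locallyIntegrable, fun a b => ?_⟩
  · filter_upwards [hc] with x hx
    linarith
  · rw [← hG.sub_eq a b]
    ring

theorem HasWeakDeriv.unique {f g g' : L2} (h : HasWeakDeriv f g) (h' : HasWeakDeriv f g') :
    g = g' := by
  refine Lp.ext (ae_eq_of_test g.locallyIntegrable g'.locallyIntegrable fun φ hφ => ?_)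
  linarith [h φ hφ, h' φ hφ]

theorem HasWeakDeriv.neg {f g : L2} (h : HasWeakDeriv f g) : HasWeakDeriv (-f) (-g) := by
  simpa using h.smul (-1)

theorem HasWeakDeriv.sub {f g f' g' : L2} (h : HasWeakDeriv f g) (h' : HasWeakDeriv f' g') :
    HasWeakDeriv (f - f') (g - g') := by
  simpa [sub_eq_add_neg] using h.add h'.neg

theorem L2.integrable_mul (f g : L2) : Integrable fun x => f x * g x :=
  MemLp.integrable_mul (p := 2) (q := 2) (Lp.memLp f) (Lp.memLp g)

theorem L2.inner_eq (f g : L2) : inner ℝ f g = ∫ x, f x * g x := by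
  rw [MeasureTheory.L2.inner_def]
  refine integral_congr_ae (Eventually.of_forall fun x => ?_)
  simp [mul_comm]

/-- Integration by parts in `H¹`. -/
theorem HasWeakDeriv.inner_add_inner {f f' g g' : L2} (hf : HasWeakDeriv f f')
    (hg : HasWeakDeriv g g') : inner ℝ f' g + inner ℝ f g' = 0 := by
  obtain ⟨F, hF, hF'⟩ := hf.exists_isPrimitive
  obtain ⟨G, hG, hG'⟩ := hg.exists_isPrimitive
  have h1 : Integrable fun x => F x * G x := (L2.integrable_mul f g).congr (by
    filter_upwards [hF, hG] with x h1 h2; rw [h1, h2])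
  have h2 : Integrable fun x => f' x * G x := (L2.integrable_mul f' g).congr (by
    filter_upwards [hG] with x h2; rw [h2])
  have h3 : Integrable fun x => F x * g' x := (L2.integrable_mul f g').congr (by
    filter_upwards [hF] with x h1; rw [h1])
  have h4 := (hF'.mul hG').integral_eq_zero h1 (h2.add h3)
  rw [integral_add h2 h3] at h4
  rw [L2.inner_eq, L2.inner_eq, ← h4]
  congr 1
  · exact integral_congr_ae (by filter_upwards [hG] with x h2; rw [h2])
  · exact integral_congr_ae (by filter_upwards [hF] with x h2; rw [h2])

/-! ### Elements of `L²` and of `H¹` -/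

open Classical in
/-- The class in `L²` of a function; it is `0` if the function is not square integrable. -/
def toL2 (f : ℝ → ℝ) : L2 := if h : MemLp f 2 volume then h.toLp f else 0

theorem coeFn_toL2 {f : ℝ → ℝ} (h : MemLp f 2 volume) : toL2 f =ᵐ[volume] f := by
  rw [toL2, dif_pos h]
  exact h.coeFn_toLp

theorem toL2_coeFn (f : L2) : toL2 f = f :=
  Lp.ext (coeFn_toL2 (Lp.memLp f))

theorem toL2_congr {f g : ℝ → ℝ} (h : f =ᵐ[volume] g) : toL2 f = toL2 g := by
  by_cases hf : MemLp f 2 volume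
  · exact Lp.ext ((coeFn_toL2 hf).trans (h.trans (coeFn_toL2 (hf.ae_eq h)).symm))
  · have hg : ¬MemLp g 2 volume := fun hg => hf (hg.ae_eq h.symm)
    rw [toL2, toL2, dif_neg hf, dif_neg hg]

theorem toL2_eq {f : ℝ → ℝ} {g : L2} (h : f =ᵐ[volume] g) : toL2 f = g :=
  (toL2_congr h).trans (toL2_coeFn g)

theorem L2.memLp_abs (f : L2) : MemLp (fun x => |f x|) 2 volume := (Lp.memLp f).norm

/-- If `|f| ≤ a (|g₁| + |g₂| + |g₃|)` then `f ∈ L²`. -/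
theorem memLp_of_abs_le {f : ℝ → ℝ} (hf : AEStronglyMeasurable f volume) {a : ℝ} {g₁ g₂ g₃ : L2}
    (h : ∀ᵐ x, |f x| ≤ a * (|g₁ x| + |g₂ x| + |g₃ x|)) : MemLp f 2 volume := by
  have h1 : MemLp (fun x => a * (|g₁ x| + |g₂ x| + |g₃ x|)) 2 volume :=
    ((g₁.memLp_abs.add g₂.memLp_abs).add g₃.memLp_abs).const_mul a
  refine h1.mono hf ?_
  filter_upwards [h] with x hx
  exact hx.trans (le_abs_self _)

theorem norm_le_of_abs_le {f : L2} {a : ℝ} (ha : 0 ≤ a) {g₁ g₂ g₃ : L2}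
    (h : ∀ᵐ x, |f x| ≤ a * (|g₁ x| + |g₂ x| + |g₃ x|)) :
    ‖f‖ ≤ a * (‖g₁‖ + ‖g₂‖ + ‖g₃‖) := by
  have h1 : ‖f‖ ≤ ‖a • (|g₁| + |g₂| + |g₃|)‖ := by
    refine Lp.norm_le_norm_of_ae_le ?_
    filter_upwards [h, Lp.coeFn_smul a (|g₁| + |g₂| + |g₃|), Lp.coeFn_add (|g₁| + |g₂|) |g₃|,
      Lp.coeFn_add |g₁| |g₂|, Lp.coeFn_abs g₁, Lp.coeFn_abs g₂, Lp.coeFn_abs g₃]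
      with x h0 h1 h2 h3 h4 h5 h6
    rw [h1, Pi.smul_apply, h2, Pi.add_apply, h3, Pi.add_apply, h4, h5, h6, smul_eq_mul]
    exact h0.trans (le_abs_self _)
  refine h1.trans ?_
  rw [norm_smul, Real.norm_of_nonneg ha]
  gcongr
  refine (norm_add₃_le).trans_eq ?_
  rw [norm_abs_eq_norm, norm_abs_eq_norm, norm_abs_eq_norm]

theorem norm_le_of_abs_le_mul {f : L2} {a : ℝ} {g : L2} (h : ∀ᵐ x, |f x| ≤ a * |g x|) :
    ‖f‖ ≤ a * ‖g‖ :=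
  Lp.norm_le_mul_norm_of_ae_le_mul h

/-- Multiplication of an `L²` function by a bounded function. -/
theorem memLp_mul_of_bound {b : ℝ → ℝ} (hb : AEStronglyMeasurable b volume) {C : ℝ}
    (hC : ∀ᵐ x, |b x| ≤ C) (f : L2) : MemLp (fun x => b x * f x) 2 volume := by
  refine memLp_of_abs_le (a := C) (g₁ := f) (g₂ := 0) (g₃ := 0)
    (hb.mul (Lp.aestronglyMeasurable f)) ?_
  filter_upwards [hC, Lp.coeFn_zero ℝ 2 (volume : Measure ℝ)] with x hx h0
  rw [abs_mul, h0]
  simp only [Pi.zero_apply, abs_zero, add_zero]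
  gcongr

theorem norm_toL2_mul_le {b : ℝ → ℝ} (hb : AEStronglyMeasurable b volume) {C : ℝ}
    (hC : ∀ᵐ x, |b x| ≤ C) (f : L2) : ‖toL2 fun x => b x * f x‖ ≤ C * ‖f‖ := by
  refine norm_le_of_abs_le_mul ?_
  filter_upwards [coeFn_toL2 (memLp_mul_of_bound hb hC f), hC] with x h1 h2
  rw [h1, abs_mul]
  gcongr

theorem inner_toL2_right {φ : ℝ → ℝ} (h : MemLp φ 2 volume) (g : L2) :
    inner ℝ g (toL2 φ) = ∫ x, g x * φ x := by
  rw [L2.inner_eq]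
  refine integral_congr_ae ?_
  filter_upwards [coeFn_toL2 h] with x hx
  rw [hx]

theorem abs_integral_mul_test_le (g : L2) {φ : ℝ → ℝ} (h : IsTestFunction φ) :
    |∫ x, g x * φ x| ≤ ‖g‖ * ‖toL2 φ‖ := by
  rw [← inner_toL2_right h.memLp]
  exact abs_real_inner_le_norm _ _

theorem L2.ext_test {f g : L2}
    (h : ∀ φ, IsTestFunction φ → ∫ x, f x * φ x = ∫ x, g x * φ x) : f = g :=
  Lp.ext (ae_eq_of_test f.locallyIntegrable g.locallyIntegrable h)

namespace H1

/-- The element of `H¹` with given function and derivative. -/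
def mk {f g : L2} (h : HasWeakDeriv f g) : H1 := ⟨WithLp.toLp 2 (f, g), h⟩

@[simp] theorem fn_mk {f g : L2} (h : HasWeakDeriv f g) : (mk h).fn = f := rfl
@[simp] theorem dx_mk {f g : L2} (h : HasWeakDeriv f g) : (mk h).dx = g := rfl
@[simp] theorem fn_zero : (0 : H1).fn = 0 := rfl
@[simp] theorem dx_zero : (0 : H1).dx = 0 := rfl
@[simp] theorem fn_add (f g : H1) : (f + g).fn = f.fn + g.fn := rfl
@[simp] theorem fn_sub (f g : H1) : (f - g).fn = f.fn - g.fn := rfl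
@[simp] theorem dx_sub (f g : H1) : (f - g).dx = f.dx - g.dx := rfl
@[simp] theorem fn_smul (a : ℝ) (f : H1) : (a • f).fn = a • f.fn := rfl

theorem hasWeakDeriv (f : H1) : HasWeakDeriv f.fn f.dx := f.2

theorem ext' {f g : H1} (h : f.fn = g.fn) : f = g := by
  have h' : f.dx = g.dx := by
    have h1 := f.hasWeakDeriv
    rw [h] at h1
    exact h1.unique g.hasWeakDeriv
  apply Subtype.ext
  apply WithLp.ofLp_injective
  exact Prod.ext h h'

theorem norm_sq (f : H1) : ‖f‖ ^ 2 = ‖f.fn‖ ^ 2 + ‖f.dx‖ ^ 2 :=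
  WithLp.prod_norm_sq_eq_of_L2 (f : WithLp 2 (L2 × L2))

theorem norm_fn_le (f : H1) : ‖f.fn‖ ≤ ‖f‖ := by
  refine le_of_sq_le_sq ?_ (norm_nonneg _)
  rw [norm_sq]
  nlinarith [sq_nonneg ‖f.dx‖]

theorem norm_dx_le (f : H1) : ‖f.dx‖ ≤ ‖f‖ := by
  refine le_of_sq_le_sq ?_ (norm_nonneg _)
  rw [norm_sq]
  nlinarith [sq_nonneg ‖f.fn‖]

theorem norm_le (f : H1) : ‖f‖ ≤ ‖f.fn‖ + ‖f.dx‖ := by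
  refine le_of_sq_le_sq ?_ (by positivity)
  rw [norm_sq]
  nlinarith [norm_nonneg f.fn, norm_nonneg f.dx]

/-- `f ↦ f` as a bounded operator from `H¹` to `L²`. -/
def fnL : H1 →L[ℝ] L2 :=
  LinearMap.mkContinuous ⟨⟨fn, fun _ _ => rfl⟩, fun _ _ => rfl⟩ 1 fun f => by
    rw [one_mul]
    exact f.norm_fn_le

/-- `f ↦ f'` as a bounded operator from `H¹` to `L²`. -/
def dxL : H1 →L[ℝ] L2 :=
  LinearMap.mkContinuous ⟨⟨dx, fun _ _ => rfl⟩, fun _ _ => rfl⟩ 1 fun f => by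
    rw [one_mul]
    exact f.norm_dx_le

@[simp] theorem fnL_apply (f : H1) : fnL f = f.fn := rfl
@[simp] theorem dxL_apply (f : H1) : dxL f = f.dx := rfl

/-- The continuous representative of an element of `H¹`. -/
def rep (f : H1) : ℝ → ℝ := f.hasWeakDeriv.exists_isPrimitive.choose

theorem fn_ae_eq_rep (f : H1) : f.fn =ᵐ[volume] f.rep :=
  f.hasWeakDeriv.exists_isPrimitive.choose_spec.1

theorem isPrimitive_rep (f : H1) : IsPrimitive f.rep f.dx :=
  f.hasWeakDeriv.exists_isPrimitive.choose_spec.2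

theorem continuous_rep (f : H1) : Continuous f.rep := f.isPrimitive_rep.continuous

theorem rep_eq_of_ae_eq {f : H1} {F : ℝ → ℝ} (hF : Continuous F) (h : f.fn =ᵐ[volume] F) :
    f.rep = F :=
  (f.continuous_rep.ae_eq_iff_eq volume hF).mp (f.fn_ae_eq_rep.symm.trans h)

theorem rep_add (f g : H1) (x : ℝ) : (f + g).rep x = f.rep x + g.rep x := by
  refine congrFun (rep_eq_of_ae_eq (F := fun x => f.rep x + g.rep x)
    (f.continuous_rep.add g.continuous_rep) ?_) x
  filter_upwards [f.fn_ae_eq_rep, g.fn_ae_eq_rep, Lp.coeFn_add f.fn g.fn] with x h1 h2 h3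
  rw [fn_add, h3, Pi.add_apply, h1, h2]

theorem rep_smul (a : ℝ) (f : H1) (x : ℝ) : (a • f).rep x = a * f.rep x := by
  refine congrFun (rep_eq_of_ae_eq (F := fun x => a * f.rep x)
    (continuous_const.mul f.continuous_rep) ?_) x
  filter_upwards [f.fn_ae_eq_rep, Lp.coeFn_smul a f.fn] with x h1 h3
  rw [fn_smul, h3, Pi.smul_apply, h1, smul_eq_mul]

theorem rep_sub (f g : H1) (x : ℝ) : (f - g).rep x = f.rep x - g.rep x := by
  have := rep_add (f - g) g x
  rw [sub_add_cancel] at this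
  linarith

/-- Cauchy–Schwarz on a bounded interval. -/
theorem _root_.CamassaHolm.L2.abs_integral_Ioc_le (f : L2) {a b : ℝ} (hab : a ≤ b) :
    ∫ x in a..b, |f x| ≤ √(b - a) * ‖f‖ := by
  have h1 : MemLp (indicator (Ioc a b) fun _ => (1 : ℝ)) 2 volume :=
    memLp_indicator_const 2 measurableSet_Ioc 1 (Or.inr (by simp))
  have h2 : ∫ x in a..b, |f x| = inner ℝ |f| (toL2 (indicator (Ioc a b) fun _ => (1 : ℝ))) := by
    rw [inner_toL2_right h1, intervalIntegral.integral_of_le hab,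
      ← integral_indicator measurableSet_Ioc]
    refine integral_congr_ae ?_
    filter_upwards [Lp.coeFn_abs f] with x hx
    rw [hx]
    by_cases h : x ∈ Ioc a b <;> simp [h]
  have h3 : ‖toL2 (indicator (Ioc a b) fun _ => (1 : ℝ))‖ = √(b - a) := by
    rw [toL2, dif_pos h1, Lp.norm_toLp,
      eLpNorm_indicator_const measurableSet_Ioc (by simp) (by simp)]
    simp [Real.sqrt_eq_rpow, ← ENNReal.toReal_rpow, ENNReal.toReal_ofReal (sub_nonneg.mpr hab)]
  rw [h2, ← h3, mul_comm]
  refine (real_inner_le_norm _ _).trans_eq ?_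
  rw [norm_abs_eq_norm]

/-- The Sobolev embedding of `H¹` into the bounded continuous functions. -/
theorem abs_rep_le (f : H1) (x : ℝ) : |f.rep x| ≤ ‖f.fn‖ + ‖f.dx‖ := by
  -- compare `f(x)` with the mean of `f` over `[x, x + 1]`
  have h1 : ∀ y ∈ Icc x (x + 1), |f.rep x| ≤ |f.rep y| + ∫ t in x..(x + 1), |f.dx t| := by
    intro y hy
    have h2 := f.isPrimitive_rep.sub_eq x y
    have h3 : |∫ t in x..y, f.dx t| ≤ ∫ t in x..(x + 1), |f.dx t| := by
      refine (intervalIntegral.abs_integral_le_integral_abs hy.1).trans ?_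
      refine intervalIntegral.integral_mono_interval le_rfl hy.1 hy.2
        (Eventually.of_forall fun _ => abs_nonneg _) ?_
      exact (f.isPrimitive_rep.intervalIntegrable x (x + 1)).abs
    have h4 : f.rep x = f.rep y - ∫ t in x..y, f.dx t := by linarith
    rw [h4]
    exact (abs_sub _ _).trans (by gcongr)
  have h2 : ∫ _ in x..(x + 1), |f.rep x| ≤
      ∫ y in x..(x + 1), (|f.rep y| + ∫ t in x..(x + 1), |f.dx t|) := by
    refine intervalIntegral.integral_mono_on (by linarith) (by simp) ?_ h1
    exact (f.continuous_rep.abs.add continuous_const).intervalIntegrable _ _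
  rw [intervalIntegral.integral_add (f.continuous_rep.abs.intervalIntegrable _ _) (by simp)] at h2
  simp only [intervalIntegral.integral_const, add_sub_cancel_left, smul_eq_mul, one_mul] at h2
  have h3 := f.dx.abs_integral_Ioc_le (show x ≤ x + 1 by linarith)
  have h4 := f.fn.abs_integral_Ioc_le (show x ≤ x + 1 by linarith)
  have h5 : ∫ y in x..(x + 1), |f.fn y| = ∫ y in x..(x + 1), |f.rep y| := by
    refine intervalIntegral.integral_congr_ae ?_
    filter_upwards [f.fn_ae_eq_rep] with y hy _
    rw [hy]
  rw [h5] at h4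
  simp only [add_sub_cancel_left, Real.sqrt_one, one_mul] at h3 h4
  linarith

theorem abs_rep_le_norm (f : H1) (x : ℝ) : |f.rep x| ≤ 2 * ‖f‖ := by
  linarith [f.abs_rep_le x, f.norm_fn_le, f.norm_dx_le]

theorem ae_abs_fn_le (f : H1) : ∀ᵐ x, |f.fn x| ≤ ‖f.fn‖ + ‖f.dx‖ := by
  filter_upwards [f.fn_ae_eq_rep] with x hx
  rw [hx]
  exact f.abs_rep_le x

instance : CompleteSpace H1 := by
  have h : IsClosed (H1space : Set (WithLp 2 (L2 × L2))) := by
    have : (H1space : Set (WithLp 2 (L2 × L2))) = ⋂ φ : {φ : ℝ → ℝ // IsTestFunction φ},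
        {p | inner ℝ p.fst (toL2 (deriv φ)) = - inner ℝ p.snd (toL2 (φ : ℝ → ℝ))} := by
      ext p
      simp only [mem_iInter, mem_ofPred_eq, Subtype.forall]
      refine forall₂_congr fun φ hφ => ?_
      rw [inner_toL2_right hφ.memLp, inner_toL2_right hφ.deriv.memLp]
    rw [this]
    refine isClosed_iInter fun φ => isClosed_eq ?_ ?_
    · exact (WithLp.continuous_fst _ _ _).inner continuous_const
    · exact ((WithLp.continuous_snd _ _ _).inner continuous_const).neg
  exact h.completeSpace_coe

end H1

/-- A locally integrable function which acts on test functions as an `L²`-bounded functional is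
square integrable: the functional extends to `L²`, where it is the product with an `L²` function. -/
theorem memLp_of_test_bound {g : ℝ → ℝ} (hg : LocallyIntegrable g volume) {C : ℝ} (hC : 0 ≤ C)
    (h : ∀ φ, IsTestFunction φ → |∫ x, g x * φ x| ≤ C * ‖toL2 φ‖) :
    MemLp g 2 volume ∧ ‖toL2 g‖ ≤ C := by
  let S : Submodule ℝ L2 :=
    { carrier := {f | ∃ φ, IsTestFunction φ ∧ f =ᵐ[volume] φ}
      zero_mem' := ⟨0, ⟨contDiff_const, HasCompactSupport.zero⟩, Lp.coeFn_zero _ _ _⟩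
      add_mem' := by
        rintro f f' ⟨φ, hφ, hf⟩ ⟨φ', hφ', hf'⟩
        exact ⟨φ + φ', ⟨hφ.1.add hφ'.1, hφ.2.add hφ'.2⟩, (Lp.coeFn_add f f').trans (hf.add hf')⟩
      smul_mem' := by
        rintro a f ⟨φ, hφ, hf⟩
        refine ⟨fun x => a * φ x, ⟨contDiff_const.mul hφ.1, hφ.2.mul_left⟩, ?_⟩
        filter_upwards [Lp.coeFn_smul a f, hf] with x h1 h2
        rw [h1, Pi.smul_apply, h2, smul_eq_mul] }
  have hint : ∀ f : S, Integrable fun x => g x * (f : L2) x := by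
    rintro ⟨f, φ, hφ, hf⟩
    refine (hφ.integrable_mul hg).congr ?_
    filter_upwards [hf] with x hx
    rw [hx]
  let ℓ : S →ₗ[ℝ] ℝ :=
    { toFun := fun f => ∫ x, g x * (f : L2) x
      map_add' := fun f f' => by
        rw [← integral_add (hint f) (hint f')]
        refine integral_congr_ae ?_
        filter_upwards [Lp.coeFn_add (f : L2) f'] with x hx
        rw [Submodule.coe_add, hx, Pi.add_apply, mul_add]
      map_smul' := fun a f => by
        rw [RingHom.id_apply, smul_eq_mul, ← integral_const_mul]
        refine integral_congr_ae ?_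
        filter_upwards [Lp.coeFn_smul a (f : L2)] with x hx
        rw [Submodule.coe_smul, hx, Pi.smul_apply, smul_eq_mul]
        ring }
  have hb : ∀ f : S, ‖ℓ f‖ ≤ C * ‖f‖ := by
    rintro ⟨f, φ, hφ, hf⟩
    have h1 : toL2 φ = f := toL2_eq hf.symm
    have h2 : ∫ x, g x * f x = ∫ x, g x * φ x := integral_congr_ae (by
      filter_upwards [hf] with x hx; rw [hx])
    have h3 := h φ hφ
    rw [h1, ← h2] at h3
    exact h3
  obtain ⟨G, hG, hGn⟩ := _root_.exists_extension_norm_eq S (ℓ.mkContinuous C hb)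
  let k : L2 := (InnerProductSpace.toDual ℝ L2).symm G
  have hk : g =ᵐ[volume] k := by
    refine ae_eq_of_test hg k.locallyIntegrable fun φ hφ => ?_
    have h1 := hG ⟨toL2 φ, φ, hφ, coeFn_toL2 hφ.memLp⟩
    have h2 : G (toL2 φ) = inner ℝ k (toL2 φ) :=
      (InnerProductSpace.toDual_symm_apply (𝕜 := ℝ) (x := toL2 φ) (y := G)).symm
    rw [← inner_toL2_right hφ.memLp k, ← h2]
    refine Eq.trans ?_ h1.symm
    refine integral_congr_ae ?_
    filter_upwards [coeFn_toL2 hφ.memLp] with x hx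
    simp [hx]
  refine ⟨(Lp.memLp k).ae_eq hk.symm, ?_⟩
  rw [toL2_eq hk, LinearIsometryEquiv.norm_map, hGn]
  exact LinearMap.mkContinuous_norm_le _ hC _

/-- A bounded solution of `f'' = f` on the line vanishes. -/
theorem eq_zero_of_deriv_deriv_eq {f g : ℝ → ℝ} (hf : ∀ x, HasDerivAt f (g x) x)
    (hg : ∀ x, HasDerivAt g (f x) x) {C : ℝ} (hfC : ∀ x, |f x| ≤ C) (hgC : ∀ x, |g x| ≤ C)
    (x : ℝ) : f x = 0 := by
  -- `e^{∓x} (f ± f')` is constant, and tends to `0` at `±∞`.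
  have h1 : ∀ x, HasDerivAt (fun x => Real.exp (-x) * (f x + g x)) 0 x := by
    intro x
    have := ((hasDerivAt_neg x).exp).mul ((hf x).add (hg x))
    refine this.congr_deriv ?_
    simp only [Pi.add_apply]
    ring
  have h2 : ∀ x, HasDerivAt (fun x => Real.exp x * (f x - g x)) 0 x := by
    intro x
    have := (Real.hasDerivAt_exp x).mul ((hf x).sub (hg x))
    refine this.congr_deriv ?_
    simp only [Pi.sub_apply]
    ring
  have c1 := is_const_of_deriv_eq_zero (fun x => (h1 x).differentiableAt) fun x => (h1 x).deriv
  have c2 := is_const_of_deriv_eq_zero (fun x => (h2 x).differentiableAt) fun x => (h2 x).deriv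
  have b1 : ∀ x, |f x + g x| ≤ 2 * C := fun x => (abs_add_le _ _).trans (by linarith [hfC x, hgC x])
  have b2 : ∀ x, |f x - g x| ≤ 2 * C := fun x => (abs_sub _ _).trans (by linarith [hfC x, hgC x])
  have l1 : Tendsto (fun x => Real.exp (-x) * (f x + g x)) atTop (𝓝 0) := by
    have := (Real.tendsto_exp_neg_atTop_nhds_zero).mul_const (2 * C)
    rw [zero_mul] at this
    refine squeeze_zero_norm (fun x => ?_) this
    rw [norm_mul, Real.norm_of_nonneg (Real.exp_pos _).le]
    exact mul_le_mul_of_nonneg_left (b1 x) (Real.exp_pos _).le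
  have l2 : Tendsto (fun x => Real.exp x * (f x - g x)) atBot (𝓝 0) := by
    have := Real.tendsto_exp_atBot.mul_const (2 * C)
    rw [zero_mul] at this
    refine squeeze_zero_norm (fun x => ?_) this
    rw [norm_mul, Real.norm_of_nonneg (Real.exp_pos _).le]
    exact mul_le_mul_of_nonneg_left (b2 x) (Real.exp_pos _).le
  have e1 : Real.exp (-x) * (f x + g x) = 0 :=
    tendsto_nhds_unique (tendsto_const_nhds.congr fun y => c1 x y) l1
  have e2 : Real.exp x * (f x - g x) = 0 :=
    tendsto_nhds_unique (tendsto_const_nhds.congr fun y => c2 x y) l2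
  have e1' := (mul_eq_zero.mp e1).resolve_left (Real.exp_pos _).ne'
  have e2' := (mul_eq_zero.mp e2).resolve_left (Real.exp_pos _).ne'
  linarith

theorem IsTestFunction.comp_sub {φ : ℝ → ℝ} (h : IsTestFunction φ) (a : ℝ) :
    IsTestFunction fun y => φ (a - y) :=
  ⟨h.1.comp (contDiff_const.sub contDiff_id),
    h.2.comp_homeomorph (Homeomorph.subLeft a)⟩

theorem IsTestFunction.deriv_comp_sub {φ : ℝ → ℝ} (a y : ℝ) :
    _root_.deriv (fun y => φ (a - y)) y = -_root_.deriv φ (a - y) := by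
  rw [deriv_comp_const_sub]

/-- The equation `D'' = D` has no nonzero solution in `L²`. The mollifications of `D` are bounded
classical solutions. -/
theorem L2.eq_zero_of_test {D : L2}
    (h : ∀ φ, IsTestFunction φ → ∫ x, D x * (φ x - deriv (deriv φ) x) = 0) : D = 0 := by
  have key : ∀ ρ, IsTestFunction ρ → ∀ x, HasDerivAt (fun x => ∫ y, D y * ρ (x - y))
      (∫ y, D y * deriv ρ (x - y)) x := by
    intro ρ hρ x
    have := hρ.2.hasDerivAt_convolution_right (ContinuousLinearMap.mul ℝ ℝ) D.locallyIntegrable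
      (hρ.1.of_le (by exact_mod_cast le_top)) x
    exact this
  have bd : ∀ ρ, IsTestFunction ρ → ∃ C, ∀ x, |∫ y, D y * ρ (x - y)| ≤ C := by
    intro ρ hρ
    refine ⟨‖D‖ * ‖toL2 ρ‖, fun x => ?_⟩
    refine (abs_integral_mul_test_le D (hρ.comp_sub x)).trans_eq ?_
    congr 1
    have h1 : MemLp (fun y => ρ (x - y)) 2 volume := (hρ.comp_sub x).memLp
    rw [toL2, toL2, dif_pos h1, dif_pos hρ.memLp, Lp.norm_toLp, Lp.norm_toLp]
    congr 1
    exact eLpNorm_comp_measurePreserving hρ.memLp.1 (Measure.measurePreserving_sub_left volume x)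
  have hz : ∀ ρ, IsTestFunction ρ → ∀ x, ∫ y, D y * ρ (x - y) = 0 := by
    intro ρ hρ
    obtain ⟨C₀, h0⟩ := bd ρ hρ
    obtain ⟨C₁, h1⟩ := bd _ hρ.deriv
    have heq : ∀ x, ∫ y, D y * deriv (deriv ρ) (x - y) = ∫ y, D y * ρ (x - y) := by
      intro x
      have h2 := h _ (hρ.comp_sub x)
      have h3 : deriv (deriv fun y => ρ (x - y)) = fun y => deriv (deriv ρ) (x - y) := by
        have : deriv (fun y => ρ (x - y)) = fun y => -deriv ρ (x - y) :=
          funext fun y => IsTestFunction.deriv_comp_sub x y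
        rw [this]
        funext y
        rw [deriv.fun_neg, IsTestFunction.deriv_comp_sub, neg_neg]
      rw [h3] at h2
      simp_rw [mul_sub] at h2
      rw [integral_sub ((hρ.comp_sub x).integrable_mul D.locallyIntegrable)
        ((hρ.deriv.deriv.comp_sub x).integrable_mul D.locallyIntegrable)] at h2
      linarith
    exact eq_zero_of_deriv_deriv_eq (key ρ hρ) (fun x => heq x ▸ key _ hρ.deriv x)
      (C := max C₀ C₁) (fun x => (h0 x).trans (le_max_left _ _))
      fun x => (h1 x).trans (le_max_right _ _)
  refine L2.ext_test fun ρ hρ => ?_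
  have h1 := hz _ (hρ.comp_sub 0) 0
  have h2 : ∫ x, (0 : L2) x * ρ x = 0 := by
    refine integral_eq_zero_of_ae ?_
    filter_upwards [Lp.coeFn_zero ℝ 2 (volume : Measure ℝ)] with x
    simp
  rw [h2]
  simpa using h1

/-! ### The nonlocal term as the solution of an elliptic system -/

/-- `J` is a measurable function with values in `[c, 1/c]`, where `0 < c ≤ 1`: the density of a
bi-Lipschitz change of variables. -/
structure IsPinched (c : ℝ) (J : ℝ → ℝ) : Prop where
  pos : 0 < c
  le_one : c ≤ 1
  aesm : AEStronglyMeasurable J volume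
  lower : ∀ᵐ x, c ≤ J x
  upper : ∀ᵐ x, J x ≤ c⁻¹

theorem IsPinched.abs_le {c : ℝ} {J : ℝ → ℝ} (h : IsPinched c J) : ∀ᵐ x, |J x| ≤ c⁻¹ := by
  filter_upwards [h.lower, h.upper] with x h1 h2
  rwa [abs_of_nonneg (h.pos.le.trans h1)]

theorem IsPinched.inv {c : ℝ} {J : ℝ → ℝ} (h : IsPinched c J) : IsPinched c fun x => (J x)⁻¹ where
  pos := h.pos
  le_one := h.le_one
  aesm := h.aesm.aemeasurable.inv.aestronglyMeasurable
  lower := by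
    filter_upwards [h.lower, h.upper] with x h1 h2
    exact le_inv_of_le_inv₀ (h.pos.trans_le h1) h2
  upper := by
    filter_upwards [h.lower] with x h1
    exact inv_anti₀ h.pos h1

theorem IsPinched.memLp_mul {c : ℝ} {J : ℝ → ℝ} (h : IsPinched c J) (f : L2) :
    MemLp (fun x => J x * f x) 2 volume :=
  memLp_mul_of_bound h.aesm h.abs_le f

theorem IsPinched.norm_mul_le {c : ℝ} {J : ℝ → ℝ} (h : IsPinched c J) (f : L2) :
    ‖toL2 fun x => J x * f x‖ ≤ c⁻¹ * ‖f‖ :=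
  norm_toL2_mul_le h.aesm h.abs_le f

theorem IsPinched.norm_sq_le_inner {c : ℝ} {J : ℝ → ℝ} (h : IsPinched c J) (f : L2) :
    c * ‖f‖ ^ 2 ≤ inner ℝ (toL2 fun x => J x * f x) f := by
  rw [← real_inner_self_eq_norm_sq, L2.inner_eq, L2.inner_eq, ← integral_const_mul]
  refine integral_mono_ae ((L2.integrable_mul f f).const_mul c) (L2.integrable_mul _ f) ?_
  filter_upwards [coeFn_toL2 (h.memLp_mul f), h.lower] with x h1 h2
  rw [h1]
  nlinarith [mul_self_nonneg (f x)]

/-- Multiplication by `J` as a bounded operator on `L²`. -/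
def IsPinched.mulL {c : ℝ} {J : ℝ → ℝ} (h : IsPinched c J) : L2 →L[ℝ] L2 :=
  LinearMap.mkContinuous
    { toFun := fun f => toL2 fun x => J x * f x
      map_add' := fun f g => by
        refine toL2_eq ?_
        filter_upwards [Lp.coeFn_add f g, coeFn_toL2 (h.memLp_mul f), coeFn_toL2 (h.memLp_mul g),
          Lp.coeFn_add (toL2 fun x => J x * f x) (toL2 fun x => J x * g x)] with x h1 h2 h3 h4
        rw [h1, h4, Pi.add_apply, Pi.add_apply, h2, h3, mul_add]
      map_smul' := fun a f => by
        refine toL2_eq ?_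
        filter_upwards [Lp.coeFn_smul a f, coeFn_toL2 (h.memLp_mul f),
          Lp.coeFn_smul a (toL2 fun x => J x * f x)] with x h1 h2 h4
        rw [h1, RingHom.id_apply, h4, Pi.smul_apply, Pi.smul_apply, h2, smul_eq_mul, smul_eq_mul]
        ring } c⁻¹
    fun f => h.norm_mul_le f

theorem IsPinched.mulL_apply {c : ℝ} {J : ℝ → ℝ} (h : IsPinched c J) (f : L2) :
    h.mulL f = toL2 fun x => J x * f x := rfl

/-- The first order system `P' = J Q`, `Q' = J P - h` on the line. For `J = 1` it says that
`P = (1 - ∂ₓ²)⁻¹ h` and `Q = ∂ₓ P`; in general it is this relation after a change of variables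
with density `J`. -/
structure IsPotential (J : ℝ → ℝ) (h P Q : L2) : Prop where
  left : HasWeakDeriv P (toL2 fun x => J x * Q x)
  right : HasWeakDeriv Q ((toL2 fun x => J x * P x) - h)

/-- The energy estimate for the system `P' = J Q + a`, `Q' = J P + b`: integrate
`(P Q)' = J (P² + Q²) + a Q + b P`. -/
theorem IsPinched.energy {c : ℝ} {J : ℝ → ℝ} (h : IsPinched c J) {P Q a b : L2}
    (h1 : HasWeakDeriv P ((toL2 fun x => J x * Q x) + a))
    (h2 : HasWeakDeriv Q ((toL2 fun x => J x * P x) + b)) :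
    ‖P‖ + ‖Q‖ ≤ 2 * c⁻¹ * (‖a‖ + ‖b‖) := by
  have h3 := h1.inner_add_inner h2
  rw [inner_add_left, inner_add_right, real_inner_comm _ P] at h3
  have h4 := h.norm_sq_le_inner P
  have h5 := h.norm_sq_le_inner Q
  have h6 := _root_.abs_le.mp (abs_real_inner_le_norm a Q)
  have h7 := _root_.abs_le.mp (abs_real_inner_le_norm P b)
  have h8 : c * (‖P‖ ^ 2 + ‖Q‖ ^ 2) ≤ (‖a‖ + ‖b‖) * (‖P‖ + ‖Q‖) := by
    nlinarith [mul_nonneg (norm_nonneg a) (norm_nonneg P),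
      mul_nonneg (norm_nonneg b) (norm_nonneg Q)]
  have hs : 0 ≤ ‖P‖ + ‖Q‖ := by positivity
  have h9 : c * (‖P‖ + ‖Q‖) ^ 2 ≤ 2 * (‖a‖ + ‖b‖) * (‖P‖ + ‖Q‖) := by
    nlinarith [mul_nonneg h.pos.le (sq_nonneg (‖P‖ - ‖Q‖))]
  rcases hs.eq_or_lt with h0 | h0
  · rw [← h0]
    have := h.pos
    positivity
  · have h10 : c * (‖P‖ + ‖Q‖) ≤ 2 * (‖a‖ + ‖b‖) := by
      refine le_of_mul_le_mul_right ?_ h0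
      nlinarith
    calc ‖P‖ + ‖Q‖ = c⁻¹ * (c * (‖P‖ + ‖Q‖)) := by rw [inv_mul_cancel_left₀ h.pos.ne']
      _ ≤ c⁻¹ * (2 * (‖a‖ + ‖b‖)) := by
        have := h.pos
        gcongr
      _ = _ := by ring

/-- The system is solvable by the Lax–Milgram theorem for `∫ J v w + J⁻¹ v' w'` on `H¹`: the
solution is `P = v` and `Q = v' / J`. -/
theorem IsPinched.exists_isPotential {c : ℝ} {J : ℝ → ℝ} (hJ : IsPinched c J) (h : L2) :
    ∃ P Q, IsPotential J h P Q := by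
  let A : H1 →L[ℝ] H1 := (H1.fnL.adjoint ∘L hJ.mulL) ∘L H1.fnL
    + (H1.dxL.adjoint ∘L hJ.inv.mulL) ∘L H1.dxL
  have hA : ∀ v w, inner ℝ (A v) w
      = inner ℝ (hJ.mulL v.fn) w.fn + inner ℝ (hJ.inv.mulL v.dx) w.dx := by
    intro v w
    simp only [A, _root_.add_apply, ContinuousLinearMap.comp_apply, inner_add_left,
      ContinuousLinearMap.adjoint_inner_left, H1.fnL_apply, H1.dxL_apply]
  have hcoer : IsCoercive ((innerSL ℝ).comp A) := by
    refine ⟨c, hJ.pos, fun v => ?_⟩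
    have h1 : ((innerSL ℝ).comp A) v v = inner ℝ (A v) v := rfl
    have h2 := hJ.norm_sq_le_inner v.fn
    have h3 := hJ.inv.norm_sq_le_inner v.dx
    rw [h1, hA, mul_assoc, ← sq, H1.norm_sq, mul_add]
    exact add_le_add h2 h3
  let v : H1 := hcoer.continuousLinearEquivOfBilin.symm (H1.fnL.adjoint h)
  have hv : ∀ w : H1, inner ℝ h w.fn
      = inner ℝ (hJ.mulL v.fn) w.fn + inner ℝ (hJ.inv.mulL v.dx) w.dx := by
    intro w
    have h1 := hcoer.continuousLinearEquivOfBilin_apply v w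
    rw [ContinuousLinearEquiv.apply_symm_apply, ContinuousLinearMap.adjoint_inner_left] at h1
    exact h1.trans (hA v w)
  refine ⟨v.fn, hJ.inv.mulL v.dx, ?_, ?_⟩
  · have h1 : (toL2 fun x => J x * hJ.inv.mulL v.dx x) = v.dx := by
      refine toL2_eq ?_
      filter_upwards [coeFn_toL2 (hJ.inv.memLp_mul v.dx), hJ.lower] with x h1 h2
      rw [hJ.inv.mulL_apply, h1, mul_inv_cancel_left₀ (hJ.pos.trans_le h2).ne']
    rw [h1]
    exact v.hasWeakDeriv
  · intro φ hφ
    have h1 := hv (H1.mk (hφ.isPrimitive.hasWeakDeriv (coeFn_toL2 hφ.memLp)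
      (coeFn_toL2 hφ.deriv.memLp)))
    simp only [H1.fn_mk, H1.dx_mk] at h1
    rw [← inner_toL2_right hφ.memLp, ← inner_toL2_right hφ.deriv.memLp, inner_sub_left]
    rw [hJ.mulL_apply] at h1
    linarith

theorem IsPotential.norm_add_norm_le {c : ℝ} {J : ℝ → ℝ} (hJ : IsPinched c J) {h P Q : L2}
    (hP : IsPotential J h P Q) : ‖P‖ + ‖Q‖ ≤ 2 * c⁻¹ * ‖h‖ := by
  have := hJ.energy (a := 0) (b := -h) (by simpa using hP.left)
    (by simpa [sub_eq_add_neg] using hP.right)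
  simpa using this

/-- Pointwise bounds for the potential and its derivative. -/
theorem IsPotential.ae_abs_le {c : ℝ} {J : ℝ → ℝ} (hJ : IsPinched c J) {h P Q : L2}
    (hP : IsPotential J h P Q) :
    (∀ᵐ x, |P x| ≤ 5 * c⁻¹ ^ 2 * ‖h‖) ∧ ∀ᵐ x, |Q x| ≤ 5 * c⁻¹ ^ 2 * ‖h‖ := by
  have hn := hP.norm_add_norm_le hJ
  have hc : 1 ≤ c⁻¹ := (one_le_inv₀ hJ.pos).mpr hJ.le_one
  have h1 := hJ.norm_mul_le P
  have h2 := hJ.norm_mul_le Q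
  have hPn := norm_nonneg P
  have hQn := norm_nonneg Q
  have hhn := norm_nonneg h
  have h0 : c⁻¹ * ‖h‖ ≤ c⁻¹ ^ 2 * ‖h‖ := by
    rw [sq, mul_assoc]
    exact le_mul_of_one_le_left (by positivity) hc
  have h0' : ‖h‖ ≤ c⁻¹ * ‖h‖ := le_mul_of_one_le_left hhn hc
  have h3 : c⁻¹ * (‖P‖ + ‖Q‖) ≤ c⁻¹ * (2 * c⁻¹ * ‖h‖) :=
    mul_le_mul_of_nonneg_left hn (by positivity)
  have h4 : c⁻¹ * ‖P‖ ≥ 0 := by positivity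
  have h5 : c⁻¹ * ‖Q‖ ≥ 0 := by positivity
  constructor
  · filter_upwards [(H1.mk hP.left).ae_abs_fn_le] with x hx
    simp only [H1.fn_mk, H1.dx_mk] at hx
    nlinarith
  · filter_upwards [(H1.mk hP.right).ae_abs_fn_le] with x hx
    simp only [H1.fn_mk, H1.dx_mk] at hx
    have := norm_sub_le (toL2 fun x => J x * P x) h
    nlinarith

/-- `J₁ f₁ - J₂ f₂ = J₁ (f₁ - f₂) + (J₁ - J₂) f₂`, with a bound for the last term. -/
theorem IsPinched.exists_mul_sub {c : ℝ} {J₁ J₂ : ℝ → ℝ} (h₁ : IsPinched c J₁)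
    (h₂ : IsPinched c J₂) {k : L2} (hk : ∀ᵐ x, |J₁ x - J₂ x| ≤ |k x|) (f₁ f₂ : L2) {C : ℝ}
    (hC : ∀ᵐ x, |f₂ x| ≤ C) :
    ∃ a : L2, (toL2 fun x => J₁ x * f₁ x) - (toL2 fun x => J₂ x * f₂ x)
      = (toL2 fun x => J₁ x * (f₁ - f₂ : L2) x) + a ∧ ‖a‖ ≤ C * ‖k‖ := by
  refine ⟨(toL2 fun x => J₁ x * f₁ x) - (toL2 fun x => J₂ x * f₂ x)
    - (toL2 fun x => J₁ x * (f₁ - f₂ : L2) x), by abel, norm_le_of_abs_le_mul ?_⟩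
  filter_upwards [coeFn_toL2 (h₁.memLp_mul f₁), coeFn_toL2 (h₂.memLp_mul f₂),
    coeFn_toL2 (h₁.memLp_mul (f₁ - f₂)), Lp.coeFn_sub f₁ f₂,
    Lp.coeFn_sub ((toL2 fun x => J₁ x * f₁ x) - (toL2 fun x => J₂ x * f₂ x))
      (toL2 fun x => J₁ x * (f₁ - f₂ : L2) x),
    Lp.coeFn_sub (toL2 fun x => J₁ x * f₁ x) (toL2 fun x => J₂ x * f₂ x), hk, hC]
    with x e1 e2 e3 e4 e5 e6 e7 e8
  rw [e5, Pi.sub_apply, e6, Pi.sub_apply, e1, e2, e3, e4, Pi.sub_apply]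
  have : J₁ x * f₁ x - J₂ x * f₂ x - J₁ x * (f₁ x - f₂ x) = f₂ x * (J₁ x - J₂ x) := by ring
  rw [this, abs_mul]
  exact mul_le_mul e8 e7 (abs_nonneg _) ((abs_nonneg _).trans e8)

/-- Lipschitz dependence of the potential on the density and on the source. -/
theorem IsPotential.norm_sub_le {c : ℝ} {J₁ J₂ : ℝ → ℝ} (hJ₁ : IsPinched c J₁)
    (hJ₂ : IsPinched c J₂) {k : L2} (hk : ∀ᵐ x, |J₁ x - J₂ x| ≤ |k x|) {h₁ P₁ Q₁ h₂ P₂ Q₂ : L2}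
    (hP₁ : IsPotential J₁ h₁ P₁ Q₁) (hP₂ : IsPotential J₂ h₂ P₂ Q₂) :
    ‖Q₁ - Q₂‖ + ‖((toL2 fun x => J₁ x * P₁ x) - h₁) - ((toL2 fun x => J₂ x * P₂ x) - h₂)‖
      ≤ 30 * c⁻¹ ^ 4 * (‖h₂‖ * ‖k‖ + ‖h₁ - h₂‖) := by
  obtain ⟨b1, b2⟩ := hP₂.ae_abs_le hJ₂
  obtain ⟨a, ha, han⟩ := hJ₁.exists_mul_sub hJ₂ hk Q₁ Q₂ b2
  obtain ⟨b, hb, hbn⟩ := hJ₁.exists_mul_sub hJ₂ hk P₁ P₂ b1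
  have e1 : HasWeakDeriv (P₁ - P₂) ((toL2 fun x => J₁ x * (Q₁ - Q₂ : L2) x) + a) := by
    rw [← ha]
    exact hP₁.left.sub hP₂.left
  have e3 : ((toL2 fun x => J₁ x * P₁ x) - h₁) - ((toL2 fun x => J₂ x * P₂ x) - h₂)
      = (toL2 fun x => J₁ x * (P₁ - P₂ : L2) x) + (b - (h₁ - h₂)) := by
    rw [← add_sub_assoc, ← hb]
    abel
  have e2 : HasWeakDeriv (Q₁ - Q₂)
      ((toL2 fun x => J₁ x * (P₁ - P₂ : L2) x) + (b - (h₁ - h₂))) := by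
    rw [← e3]
    exact hP₁.right.sub hP₂.right
  have e4 := hJ₁.energy e1 e2
  have e5 := _root_.norm_sub_le b (h₁ - h₂)
  have e6 := hJ₁.norm_mul_le (P₁ - P₂)
  have e7 := norm_add_le (toL2 fun x => J₁ x * (P₁ - P₂ : L2) x) (b - (h₁ - h₂))
  rw [e3]
  have hc : 1 ≤ c⁻¹ := (one_le_inv₀ hJ₁.pos).mpr hJ₁.le_one
  set r := c⁻¹
  have p1 := norm_nonneg (P₁ - P₂)
  have p2 := norm_nonneg (Q₁ - Q₂)
  have p3 := norm_nonneg (h₁ - h₂)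
  have p4 : 0 ≤ ‖h₂‖ * ‖k‖ := by positivity
  have hr2 : 1 ≤ r ^ 2 := one_le_pow₀ hc
  have hr24 : r ^ 2 ≤ r ^ 4 := pow_le_pow_right₀ hc (by norm_num)
  have s1 : ‖a‖ + ‖b - (h₁ - h₂)‖ ≤ 10 * r ^ 2 * (‖h₂‖ * ‖k‖) + ‖h₁ - h₂‖ := by nlinarith
  have s2 : r * (‖P₁ - P₂‖ + ‖Q₁ - Q₂‖) ≤
      2 * r ^ 2 * (10 * r ^ 2 * (‖h₂‖ * ‖k‖) + ‖h₁ - h₂‖) := by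
    calc r * (‖P₁ - P₂‖ + ‖Q₁ - Q₂‖) ≤ r * (2 * r * (‖a‖ + ‖b - (h₁ - h₂)‖)) := by gcongr
      _ ≤ r * (2 * r * (10 * r ^ 2 * (‖h₂‖ * ‖k‖) + ‖h₁ - h₂‖)) := by gcongr
      _ = _ := by ring
  have s3 : ‖Q₁ - Q₂‖ ≤ r * ‖Q₁ - Q₂‖ := le_mul_of_one_le_left p2 hc
  have s4 : ‖b‖ ≤ 5 * r ^ 2 * (‖h₂‖ * ‖k‖) := by nlinarith
  have s5 : r ^ 2 * (‖h₂‖ * ‖k‖) ≤ r ^ 4 * (‖h₂‖ * ‖k‖) := by gcongr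
  have s6 : r ^ 2 * ‖h₁ - h₂‖ ≤ r ^ 4 * ‖h₁ - h₂‖ := by gcongr
  have s7 : ‖h₁ - h₂‖ ≤ r ^ 2 * ‖h₁ - h₂‖ := le_mul_of_one_le_left p3 hr2
  have s8 : 0 ≤ r ^ 4 * (‖h₂‖ * ‖k‖) := by positivity
  have s9 : 0 ≤ r ^ 4 * ‖h₁ - h₂‖ := by positivity
  linear_combination e7 + e6 + e5 + s2 + s3 + s4 + 5 * s5 + 3 * s6 + s7 + 5 * s8 + 27 * s9

theorem IsPotential.unique {c : ℝ} {J : ℝ → ℝ} (hJ : IsPinched c J) {h P Q P' Q' : L2}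
    (h1 : IsPotential J h P Q) (h2 : IsPotential J h P' Q') : Q = Q' := by
  have := h1.norm_sub_le hJ hJ (k := 0) (by simp) h2
  simp only [sub_self, norm_zero, mul_zero, add_zero] at this
  have h3 : ‖Q - Q'‖ ≤ 0 := le_trans (le_add_of_nonneg_right (norm_nonneg _)) this
  exact sub_eq_zero.mp (norm_le_zero_iff.mp h3)

open Classical in
/-- The element `-Q` of `H¹`, where `P' = J Q` and `Q' = J P - h`. It is `0` if the system has no
solution. -/
def potentialForce (J : ℝ → ℝ) (h : L2) : H1 :=
  if H : ∃ P Q, IsPotential J h P Q then -H1.mk H.choose_spec.choose_spec.right else 0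

theorem exists_potentialForce {c : ℝ} {J : ℝ → ℝ} (hJ : IsPinched c J) (h : L2) :
    ∃ P Q, IsPotential J h P Q ∧ (potentialForce J h).fn = -Q ∧
      (potentialForce J h).dx = h - (toL2 fun x => J x * P x) := by
  have H := hJ.exists_isPotential h
  refine ⟨H.choose, H.choose_spec.choose, H.choose_spec.choose_spec, ?_, ?_⟩
  · rw [potentialForce, dif_pos H]
    rfl
  · rw [potentialForce, dif_pos H]
    exact neg_sub _ _

theorem potentialForce_fn {c : ℝ} {J : ℝ → ℝ} (hJ : IsPinched c J) {h P Q : L2}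
    (hP : IsPotential J h P Q) : (potentialForce J h).fn = -Q := by
  obtain ⟨P', Q', h1, h2, -⟩ := exists_potentialForce hJ h
  rw [h2, h1.unique hJ hP]

theorem norm_potentialForce_sub_le {c : ℝ} {J₁ J₂ : ℝ → ℝ} (hJ₁ : IsPinched c J₁)
    (hJ₂ : IsPinched c J₂) {k : L2} (hk : ∀ᵐ x, |J₁ x - J₂ x| ≤ |k x|) (h₁ h₂ : L2) :
    ‖potentialForce J₁ h₁ - potentialForce J₂ h₂‖
      ≤ 30 * c⁻¹ ^ 4 * (‖h₂‖ * ‖k‖ + ‖h₁ - h₂‖) := by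
  obtain ⟨P₁, Q₁, e1, e2, e3⟩ := exists_potentialForce hJ₁ h₁
  obtain ⟨P₂, Q₂, f1, f2, f3⟩ := exists_potentialForce hJ₂ h₂
  refine le_trans ?_ (e1.norm_sub_le hJ₁ hJ₂ hk f1)
  refine (H1.norm_le _).trans_eq ?_
  rw [H1.fn_sub, H1.dx_sub, e2, e3, f2, f3, ← norm_neg]
  congr 1
  · congr 1
    abel
  · rw [← norm_neg]
    congr 1
    abel

theorem ae_abs_potentialForce_le {c : ℝ} {J : ℝ → ℝ} (hJ : IsPinched c J) {h : L2} {C : ℝ}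
    (hC : ∀ᵐ x, |h x| ≤ C) :
    (∀ᵐ x, |(potentialForce J h).fn x| ≤ 5 * c⁻¹ ^ 2 * ‖h‖) ∧
      ∀ᵐ x, |(potentialForce J h).dx x| ≤ C + 5 * c⁻¹ ^ 3 * ‖h‖ := by
  obtain ⟨P, Q, e1, e2, e3⟩ := exists_potentialForce hJ h
  obtain ⟨b1, b2⟩ := e1.ae_abs_le hJ
  constructor
  · rw [e2]
    filter_upwards [b2, Lp.coeFn_neg Q] with x h1 h2
    rwa [h2, Pi.neg_apply, abs_neg]
  · rw [e3]
    filter_upwards [b1, hC, Lp.coeFn_sub h (toL2 fun x => J x * P x), hJ.abs_le,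
      coeFn_toL2 (hJ.memLp_mul P)] with x h1 h2 h3 h4 h5
    rw [h3, Pi.sub_apply, h5]
    refine (abs_sub _ _).trans (add_le_add h2 ?_)
    rw [abs_mul]
    calc |J x| * |P x| ≤ c⁻¹ * (5 * c⁻¹ ^ 2 * ‖h‖) :=
          mul_le_mul h4 h1 (abs_nonneg _) (inv_nonneg.mpr hJ.pos.le)
      _ = _ := by ring

/-! ### The Lagrangian vector field -/

/-- Truncation of a number to `[-M, M]`. -/
def truncate (M x : ℝ) : ℝ := max (-M) (min M x)

/-- Truncation of a number to `[c, 1/c]`. -/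
def pinch (c x : ℝ) : ℝ := max c (min c⁻¹ x)

theorem abs_truncate_sub_le (M x y : ℝ) : |truncate M x - truncate M y| ≤ |x - y| := by
  refine (abs_max_sub_max_le_max _ _ _ _).trans ?_
  rw [sub_self, abs_zero]
  refine max_le (abs_nonneg _) ((abs_min_sub_min_le_max _ _ _ _).trans ?_)
  simp

theorem abs_pinch_sub_le (c x y : ℝ) : |pinch c x - pinch c y| ≤ |x - y| := by
  refine (abs_max_sub_max_le_max _ _ _ _).trans ?_
  rw [sub_self, abs_zero]
  refine max_le (abs_nonneg _) ((abs_min_sub_min_le_max _ _ _ _).trans ?_)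
  simp

theorem abs_truncate_le {M : ℝ} (hM : 0 ≤ M) (x : ℝ) : |truncate M x| ≤ M :=
  abs_le.mpr ⟨le_max_left _ _, max_le (by linarith) (min_le_left _ _)⟩

theorem truncate_of_abs_le {M x : ℝ} (h : |x| ≤ M) : truncate M x = x := by
  rw [truncate, min_eq_right (abs_le.mp h).2, max_eq_right (abs_le.mp h).1]

theorem truncate_zero {M : ℝ} (hM : 0 ≤ M) : truncate M 0 = 0 :=
  truncate_of_abs_le (by simpa using hM)

theorem abs_truncate_le_abs {M : ℝ} (hM : 0 ≤ M) (x : ℝ) : |truncate M x| ≤ |x| := by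
  simpa [truncate_zero hM] using abs_truncate_sub_le M x 0

theorem pinch_of_mem {c x : ℝ} (h1 : c ≤ x) (h2 : x ≤ c⁻¹) : pinch c x = x := by
  rw [pinch, min_eq_right h2, max_eq_right h1]

theorem le_pinch (c x : ℝ) : c ≤ pinch c x := le_max_left _ _

theorem pinch_le {c : ℝ} (h0 : 0 < c) (h1 : c ≤ 1) (x : ℝ) : pinch c x ≤ c⁻¹ :=
  max_le (h1.trans ((one_le_inv₀ h0).mpr h1)) (min_le_left _ _)

@[fun_prop]
theorem continuous_truncate (M : ℝ) : Continuous (truncate M) :=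
  continuous_const.max (continuous_const.min continuous_id)

@[fun_prop]
theorem continuous_pinch (c : ℝ) : Continuous (pinch c) :=
  continuous_const.max (continuous_const.min continuous_id)

/-- The source `(u² + uₓ²/2 + κ u) J` of the nonlocal term in Lagrangian coordinates, where
`J = 1 + j` and `q = uₓ J`; the arguments are truncated so that the source is globally
Lipschitz. -/
def source (c M κ j u q : ℝ) : ℝ :=
  (truncate M u ^ 2 + κ * truncate M u) * pinch c (1 + j)
    + truncate M q ^ 2 * (pinch c (1 + j))⁻¹ / 2

/-- A Lipschitz constant for `source`. -/
def sourceConst (c M κ : ℝ) : ℝ := 2 * (1 + M + |κ|) ^ 2 * c⁻¹ ^ 2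

theorem abs_source_le {c M : ℝ} (κ : ℝ) (h0 : 0 < c) (h1 : c ≤ 1) (hM : 0 ≤ M) (j u q : ℝ) :
    |source c M κ j u q| ≤ sourceConst c M κ * (|truncate M u| + |truncate M q|) := by
  have hr : 1 ≤ c⁻¹ := (one_le_inv₀ h0).mpr h1
  have hJ1 := le_pinch c (1 + j)
  have hJ2 := pinch_le h0 h1 (1 + j)
  have hI : (pinch c (1 + j))⁻¹ ≤ c⁻¹ := inv_anti₀ h0 hJ1
  have hI0 : 0 ≤ (pinch c (1 + j))⁻¹ := inv_nonneg.mpr (h0.le.trans hJ1)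
  rw [source, sourceConst]
  have ha := abs_truncate_le hM u
  have hb := abs_truncate_le hM q
  set a := truncate M u
  set b := truncate M q
  set J := pinch c (1 + j)
  have e1 : |(a ^ 2 + κ * a) * J + b ^ 2 * J⁻¹ / 2| ≤
      (|a| * (|a| + |κ|)) * J + |b| * |b| * J⁻¹ / 2 := by
    refine (abs_add_le _ _).trans (add_le_add ?_ ?_)
    · rw [abs_mul, abs_of_nonneg (h0.le.trans hJ1)]
      refine mul_le_mul_of_nonneg_right ?_ (h0.le.trans hJ1)
      refine (abs_add_le _ _).trans_eq ?_
      rw [abs_pow, abs_mul]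
      ring
    · rw [abs_of_nonneg (by positivity), ← sq_abs b, sq]
  refine e1.trans ?_
  have hJ0 : 0 ≤ J := h0.le.trans hJ1
  have e2 : (|a| * (|a| + |κ|)) * J ≤ (|a| * (M + |κ|)) * c⁻¹ := by gcongr
  have e3 : |b| * |b| * J⁻¹ / 2 ≤ |b| * M * c⁻¹ / 2 := by gcongr
  refine (add_le_add e2 e3).trans ?_
  have e4 : c⁻¹ ≤ c⁻¹ ^ 2 := le_self_pow₀ hr (by norm_num)
  have e5 : M + |κ| ≤ 2 * (1 + M + |κ|) ^ 2 := by nlinarith [abs_nonneg κ]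
  have e6 : M / 2 ≤ 2 * (1 + M + |κ|) ^ 2 := by nlinarith [abs_nonneg κ]
  have e7 : (M + |κ|) * c⁻¹ ≤ 2 * (1 + M + |κ|) ^ 2 * c⁻¹ ^ 2 := by gcongr
  have e8 : M / 2 * c⁻¹ ≤ 2 * (1 + M + |κ|) ^ 2 * c⁻¹ ^ 2 := by gcongr
  nlinarith [abs_nonneg a, abs_nonneg b]

theorem abs_source_sub_le {c M : ℝ} (κ : ℝ) (h0 : 0 < c) (h1 : c ≤ 1) (hM : 0 ≤ M)
    (j u q j' u' q' : ℝ) : |source c M κ j u q - source c M κ j' u' q'|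
      ≤ sourceConst c M κ * (|j - j'| + |u - u'| + |q - q'|) := by
  have hr : 1 ≤ c⁻¹ := (one_le_inv₀ h0).mpr h1
  have hJ1 := le_pinch c (1 + j)
  have hJ1' := le_pinch c (1 + j')
  have hJ2 := pinch_le h0 h1 (1 + j)
  have hI : (pinch c (1 + j))⁻¹ ≤ c⁻¹ := inv_anti₀ h0 hJ1
  have hI' : (pinch c (1 + j'))⁻¹ ≤ c⁻¹ := inv_anti₀ h0 hJ1'
  have hI0 : 0 < (pinch c (1 + j))⁻¹ := inv_pos.mpr (h0.trans_le hJ1)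
  have hI0' : 0 < (pinch c (1 + j'))⁻¹ := inv_pos.mpr (h0.trans_le hJ1')
  have da := abs_truncate_sub_le M u u'
  have db := abs_truncate_sub_le M q q'
  have dJ := abs_pinch_sub_le c (1 + j) (1 + j')
  rw [add_sub_add_left_eq_sub] at dJ
  rw [source, source, sourceConst]
  have ha := abs_truncate_le hM u
  have hb := abs_truncate_le hM q
  have ha' := abs_truncate_le hM u'
  have hb' := abs_truncate_le hM q'
  set a := truncate M u
  set b := truncate M q
  set J := pinch c (1 + j)
  set a' := truncate M u'
  set b' := truncate M q'
  set J' := pinch c (1 + j')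
  have hJ : J ≠ 0 := (h0.trans_le hJ1).ne'
  have hJ' : J' ≠ 0 := (h0.trans_le hJ1').ne'
  -- change the four factors one at a time
  have e0 : (a ^ 2 + κ * a) * J + b ^ 2 * J⁻¹ / 2 - ((a' ^ 2 + κ * a') * J' + b' ^ 2 * J'⁻¹ / 2)
      = (a - a') * ((a + a' + κ) * J) + (J - J') * (a' * (a' + κ))
        + ((b - b') * ((b + b') * J⁻¹ / 2) + (J - J') * (-(b' * b' * J⁻¹ * J'⁻¹ / 2))) := by
    field_simp
    ring
  rw [e0]
  have hκ := abs_nonneg κ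
  have hr0 : 0 ≤ c⁻¹ := zero_le_one.trans hr
  have f1 : |(a + a' + κ) * J| ≤ (2 * M + |κ|) * c⁻¹ := by
    rw [abs_mul, abs_of_pos (h0.trans_le hJ1)]
    refine mul_le_mul ?_ hJ2 (h0.le.trans hJ1) (by linarith)
    linarith [abs_add_three a a' κ]
  have f2 : |a' * (a' + κ)| ≤ M * (M + |κ|) := by
    rw [abs_mul]
    refine mul_le_mul ha' ?_ (abs_nonneg _) hM
    linarith [abs_add_le a' κ]
  have f3 : |(b + b') * J⁻¹ / 2| ≤ M * c⁻¹ := by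
    rw [abs_div, abs_mul, abs_of_pos hI0, abs_two, div_le_iff₀ two_pos, mul_right_comm]
    refine mul_le_mul ?_ hI hI0.le (by linarith)
    linarith [abs_add_le b b']
  have f4 : |-(b' * b' * J⁻¹ * J'⁻¹ / 2)| ≤ M * M * c⁻¹ * c⁻¹ / 2 := by
    rw [abs_neg, abs_div, abs_mul, abs_mul, abs_mul, abs_of_pos hI0, abs_of_pos hI0', abs_two]
    gcongr
  have g1 := mul_le_mul da f1 (abs_nonneg _) (abs_nonneg _)
  have g2 := mul_le_mul dJ f2 (abs_nonneg _) (abs_nonneg _)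
  have g3 := mul_le_mul db f3 (abs_nonneg _) (abs_nonneg _)
  have g4 := mul_le_mul dJ f4 (abs_nonneg _) (abs_nonneg _)
  rw [← abs_mul] at g1 g2 g3 g4
  refine (abs_add_le _ _).trans ?_
  refine (add_le_add (abs_add_le _ _) (abs_add_le _ _)).trans ?_
  refine (add_le_add (add_le_add g1 g2) (add_le_add g3 g4)).trans ?_
  have e4 : c⁻¹ ≤ c⁻¹ ^ 2 := le_self_pow₀ hr (by norm_num)
  have e5 : 1 ≤ c⁻¹ ^ 2 := one_le_pow₀ hr
  have hN : ∃ N, N = 1 + M + |κ| := ⟨_, rfl⟩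
  obtain ⟨N, hN⟩ := hN
  rw [← hN]
  have n1 : 1 ≤ N := by linarith
  have n2 : M + |κ| ≤ N := by linarith
  have n3 : M ≤ N := by linarith
  have n4 : N ≤ N ^ 2 := le_self_pow₀ n1 (by norm_num)
  have s1 : (2 * M + |κ|) * c⁻¹ ≤ 2 * N ^ 2 * c⁻¹ ^ 2 :=
    mul_le_mul (by linarith) e4 hr0 (by positivity)
  have s3 : M * c⁻¹ ≤ 2 * N ^ 2 * c⁻¹ ^ 2 :=
    mul_le_mul (by linarith) e4 hr0 (by positivity)
  have s2 : M * (M + |κ|) + M * M * c⁻¹ * c⁻¹ / 2 ≤ 2 * N ^ 2 * c⁻¹ ^ 2 := by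
    have t0 : M * (M + |κ|) ≤ N ^ 2 := by
      rw [sq]
      exact mul_le_mul n3 n2 (by linarith) (by linarith)
    have t1 : M * (M + |κ|) ≤ N ^ 2 * c⁻¹ ^ 2 :=
      t0.trans (le_mul_of_one_le_right (by positivity) e5)
    have t2 : M * M * c⁻¹ ^ 2 ≤ N ^ 2 * c⁻¹ ^ 2 := by
      rw [sq N]
      gcongr
    have t3 : 0 ≤ N ^ 2 * c⁻¹ ^ 2 := by positivity
    linear_combination t1 + t2 / 2 + t3 / 2
  have k1 := mul_le_mul_of_nonneg_left s1 (abs_nonneg (u - u'))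
  have k2 := mul_le_mul_of_nonneg_left s2 (abs_nonneg (j - j'))
  have k3 := mul_le_mul_of_nonneg_left s3 (abs_nonneg (q - q'))
  linear_combination k1 + k2 + k3

/-- The density `J = 1 + ζ'` of the change of variables `y ↦ y + ζ(y)`, truncated to `[c, 1/c]`. -/
def density (c : ℝ) (ζ : H1) (x : ℝ) : ℝ := pinch c (1 + ζ.dx x)

theorem isPinched_density {c : ℝ} (h0 : 0 < c) (h1 : c ≤ 1) (ζ : H1) :
    IsPinched c (density c ζ) where
  pos := h0
  le_one := h1
  aesm := (continuous_pinch c).comp_aestronglyMeasurable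
    (aestronglyMeasurable_const.add (Lp.aestronglyMeasurable ζ.dx))
  lower := Eventually.of_forall fun _ => le_pinch _ _
  upper := Eventually.of_forall fun _ => pinch_le h0 h1 _

/-- The source of the nonlocal term at the position `ζ` and the velocity `U`. -/
def sourceFn (c M κ : ℝ) (z : H1 × H1) (x : ℝ) : ℝ :=
  source c M κ (z.1.dx x) (z.2.fn x) (z.2.dx x)

theorem aestronglyMeasurable_sourceFn {c : ℝ} (h0 : 0 < c) (M κ : ℝ) (z : H1 × H1) :
    AEStronglyMeasurable (sourceFn c M κ z) volume := by
  have hc : Continuous fun p : ℝ × ℝ × ℝ => source c M κ p.1 p.2.1 p.2.2 := by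
    unfold source
    have h1 : Continuous fun p : ℝ × ℝ × ℝ => (pinch c (1 + p.1))⁻¹ :=
      Continuous.inv₀ (by fun_prop) fun p => (h0.trans_le (le_pinch _ _)).ne'
    fun_prop
  have h3 : AEStronglyMeasurable (fun x => (z.1.dx x, z.2.fn x, z.2.dx x)) volume :=
    (Lp.aestronglyMeasurable z.1.dx).prodMk
      ((Lp.aestronglyMeasurable z.2.fn).prodMk (Lp.aestronglyMeasurable z.2.dx))
  exact (hc.comp_aestronglyMeasurable h3).congr (Eventually.of_forall fun x => rfl)

theorem sourceConst_nonneg (c : ℝ) {M : ℝ} (κ : ℝ) : 0 ≤ sourceConst c M κ := by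
  unfold sourceConst
  positivity

theorem abs_sourceFn_le {c M : ℝ} (κ : ℝ) (h0 : 0 < c) (h1 : c ≤ 1) (hM : 0 ≤ M) (z : H1 × H1)
    (x : ℝ) : |sourceFn c M κ z x| ≤ sourceConst c M κ * (|z.2.fn x| + |z.2.dx x| + |(0 : L2) x|) :=
  (abs_source_le κ h0 h1 hM _ _ _).trans (mul_le_mul_of_nonneg_left
    ((add_le_add (abs_truncate_le_abs hM _) (abs_truncate_le_abs hM _)).trans
      (le_add_of_nonneg_right (abs_nonneg _))) (sourceConst_nonneg c κ))

theorem memLp_sourceFn {c M : ℝ} (κ : ℝ) (h0 : 0 < c) (h1 : c ≤ 1) (hM : 0 ≤ M) (z : H1 × H1) :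
    MemLp (sourceFn c M κ z) 2 volume :=
  memLp_of_abs_le (aestronglyMeasurable_sourceFn h0 M κ z)
    (Eventually.of_forall fun x => abs_sourceFn_le κ h0 h1 hM z x)

theorem norm_sourceFn_le {c M : ℝ} (κ : ℝ) (h0 : 0 < c) (h1 : c ≤ 1) (hM : 0 ≤ M) (z : H1 × H1) :
    ‖toL2 (sourceFn c M κ z)‖ ≤ sourceConst c M κ * (2 * ‖z.2‖) := by
  have h2 : ‖toL2 (sourceFn c M κ z)‖ ≤
      sourceConst c M κ * (‖z.2.fn‖ + ‖z.2.dx‖ + ‖(0 : L2)‖) := by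
    refine norm_le_of_abs_le (sourceConst_nonneg c κ) ?_
    filter_upwards [coeFn_toL2 (memLp_sourceFn κ h0 h1 hM z)] with x hx
    rw [hx]
    exact abs_sourceFn_le κ h0 h1 hM z x
  refine h2.trans (mul_le_mul_of_nonneg_left ?_ (sourceConst_nonneg c κ))
  rw [norm_zero]
  linarith [z.2.norm_fn_le, z.2.norm_dx_le]

theorem norm_sourceFn_sub_le {c M : ℝ} (κ : ℝ) (h0 : 0 < c) (h1 : c ≤ 1) (hM : 0 ≤ M)
    (z w : H1 × H1) : ‖toL2 (sourceFn c M κ z) - toL2 (sourceFn c M κ w)‖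
      ≤ sourceConst c M κ * (3 * ‖z - w‖) := by
  have h2 : ‖toL2 (sourceFn c M κ z) - toL2 (sourceFn c M κ w)‖ ≤
      sourceConst c M κ * (‖(z.1 - w.1).dx‖ + ‖(z.2 - w.2).fn‖ + ‖(z.2 - w.2).dx‖) := by
    refine norm_le_of_abs_le (sourceConst_nonneg c κ) ?_
    filter_upwards [coeFn_toL2 (memLp_sourceFn κ h0 h1 hM z),
      coeFn_toL2 (memLp_sourceFn κ h0 h1 hM w), Lp.coeFn_sub z.1.dx w.1.dx,
      Lp.coeFn_sub z.2.fn w.2.fn, Lp.coeFn_sub z.2.dx w.2.dx,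
      Lp.coeFn_sub (toL2 (sourceFn c M κ z)) (toL2 (sourceFn c M κ w))] with x e1 e2 e3 e4 e5 e6
    rw [e6, Pi.sub_apply, e1, e2, H1.dx_sub, H1.fn_sub, H1.dx_sub, e3, e4, e5]
    exact abs_source_sub_le κ h0 h1 hM _ _ _ _ _ _
  refine h2.trans (mul_le_mul_of_nonneg_left ?_ (sourceConst_nonneg c κ))
  have h3 : ‖z.1 - w.1‖ ≤ ‖z - w‖ := norm_fst_le (z - w)
  have h4 : ‖z.2 - w.2‖ ≤ ‖z - w‖ := norm_snd_le (z - w)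
  linarith [(z.1 - w.1).norm_dx_le, (z.2 - w.2).norm_fn_le, (z.2 - w.2).norm_dx_le]

/-- The acceleration of the Lagrangian flow: the derivative in time of the velocity `U` at the
position `y ↦ y + ζ(y)`, for `z = (ζ, U)`. The density and the source in it are truncated, with
parameters `c` and `M`. -/
def accel (c M κ : ℝ) (z : H1 × H1) : H1 :=
  potentialForce (density c z.1) (toL2 (sourceFn c M κ z))

/-- A Lipschitz constant for the acceleration on the ball of radius `ρ`. -/
def accelConst (c M κ ρ : ℝ) : ℝ := 30 * c⁻¹ ^ 4 * (sourceConst c M κ * (2 * ρ + 3))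

theorem norm_accel_sub_le {c M : ℝ} (κ : ℝ) (h0 : 0 < c) (h1 : c ≤ 1) (hM : 0 ≤ M)
    (z : H1 × H1) {w : H1 × H1} {ρ : ℝ} (hw : ‖w‖ ≤ ρ) :
    ‖accel c M κ z - accel c M κ w‖ ≤ accelConst c M κ ρ * ‖z - w‖ := by
  have hk : ∀ᵐ x, |density c z.1 x - density c w.1 x| ≤ |(z.1 - w.1).dx x| := by
    filter_upwards [Lp.coeFn_sub z.1.dx w.1.dx] with x hx
    rw [H1.dx_sub, hx, Pi.sub_apply]
    refine (abs_pinch_sub_le _ _ _).trans_eq ?_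
    rw [add_sub_add_left_eq_sub]
  refine (norm_potentialForce_sub_le (isPinched_density h0 h1 _) (isPinched_density h0 h1 _) hk
    _ _).trans ?_
  have e1 := norm_sourceFn_le κ h0 h1 hM w
  have e2 := norm_sourceFn_sub_le κ h0 h1 hM z w
  have e3 : ‖w.2‖ ≤ ρ := (norm_snd_le w).trans hw
  have e4 : ‖(z.1 - w.1).dx‖ ≤ ‖z - w‖ := (H1.norm_dx_le _).trans (norm_fst_le (z - w))
  have e5 := sourceConst_nonneg c κ (M := M)
  have hρ : 0 ≤ ρ := (norm_nonneg _).trans hw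
  have e6 : ‖toL2 (sourceFn c M κ w)‖ * ‖(z.1 - w.1).dx‖
      ≤ sourceConst c M κ * (2 * ρ) * ‖z - w‖ := by
    have : ‖toL2 (sourceFn c M κ w)‖ ≤ sourceConst c M κ * (2 * ρ) := e1.trans (by gcongr)
    gcongr
  rw [accelConst, mul_assoc (30 * c⁻¹ ^ 4)]
  refine mul_le_mul_of_nonneg_left ?_ (by positivity)
  linarith

theorem accel_zero {c M : ℝ} (κ : ℝ) (h0 : 0 < c) (h1 : c ≤ 1) (hM : 0 ≤ M) :
    accel c M κ 0 = 0 := by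
  have hs : toL2 (sourceFn c M κ 0) = 0 := by
    have := norm_sourceFn_le κ h0 h1 hM 0
    simpa using this
  have hz : (toL2 fun x => density c (0 : H1) x * (0 : L2) x) = 0 := by
    refine toL2_eq ?_
    filter_upwards [Lp.coeFn_zero ℝ 2 (volume : Measure ℝ)] with x hx
    rw [hx, Pi.zero_apply, mul_zero]
  have hp : IsPotential (density c (0 : H1)) 0 0 0 :=
    ⟨by rw [hz]; exact HasWeakDeriv.zero, by rw [hz, sub_zero]; exact HasWeakDeriv.zero⟩
  refine H1.ext' ?_
  rw [accel, hs, Prod.fst_zero, potentialForce_fn (isPinched_density h0 h1 _) hp, neg_zero,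
    H1.fn_zero]

/-- The vector field whose integral curves are the solutions in Lagrangian coordinates. -/
def lagrangeField (c M κ : ℝ) (z : H1 × H1) : H1 × H1 := (z.2, accel c M κ z)

/-- A Lipschitz constant for the vector field on the ball of radius `ρ`. -/
def fieldConst (c M κ ρ : ℝ) : ℝ := 1 + accelConst c M κ ρ

theorem accelConst_nonneg (c M κ : ℝ) {ρ : ℝ} (hρ : 0 ≤ ρ) : 0 ≤ accelConst c M κ ρ := by
  have := sourceConst_nonneg c κ (M := M)
  unfold accelConst
  positivity

theorem norm_lagrangeField_sub_le {c M : ℝ} (κ : ℝ) (h0 : 0 < c) (h1 : c ≤ 1) (hM : 0 ≤ M)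
    (z : H1 × H1) {w : H1 × H1} {ρ : ℝ} (hw : ‖w‖ ≤ ρ) :
    ‖lagrangeField c M κ z - lagrangeField c M κ w‖ ≤ fieldConst c M κ ρ * ‖z - w‖ := by
  have hρ : 0 ≤ ρ := (norm_nonneg _).trans hw
  have e1 := norm_accel_sub_le κ h0 h1 hM z hw
  have e2 := accelConst_nonneg c M κ hρ
  have e3 : ‖z.2 - w.2‖ ≤ ‖z - w‖ := norm_snd_le (z - w)
  have e4 := norm_nonneg (z - w)
  have e5 : lagrangeField c M κ z - lagrangeField c M κ w
      = (z.2 - w.2, accel c M κ z - accel c M κ w) := rfl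
  rw [fieldConst, e5, Prod.norm_mk]
  refine max_le ?_ ?_ <;> nlinarith

theorem norm_lagrangeField_le {c M : ℝ} (κ : ℝ) (h0 : 0 < c) (h1 : c ≤ 1) (hM : 0 ≤ M)
    (z : H1 × H1) : ‖lagrangeField c M κ z‖ ≤ fieldConst c M κ 0 * ‖z‖ := by
  have := norm_lagrangeField_sub_le κ h0 h1 hM z (w := 0) (ρ := 0) (by simp)
  have h : lagrangeField c M κ 0 = 0 := by
    rw [lagrangeField, accel_zero κ h0 h1 hM]
    rfl
  rwa [h, sub_zero, sub_zero] at this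

theorem ae_abs_accel_le {c M : ℝ} (κ : ℝ) (h0 : 0 < c) (h1 : c ≤ 1) (hM : 0 ≤ M) (z : H1 × H1) :
    (∀ᵐ x, |(accel c M κ z).fn x| ≤ 10 * c⁻¹ ^ 2 * sourceConst c M κ * ‖z‖) ∧
      ∀ᵐ x, |(accel c M κ z).dx x| ≤ sourceConst c M κ * (2 * M + 10 * c⁻¹ ^ 3 * ‖z‖) := by
  have e1 : ∀ᵐ x, |toL2 (sourceFn c M κ z) x| ≤ sourceConst c M κ * (2 * M) := by
    filter_upwards [coeFn_toL2 (memLp_sourceFn κ h0 h1 hM z)] with x hx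
    rw [hx]
    refine (abs_source_le κ h0 h1 hM _ _ _).trans
      (mul_le_mul_of_nonneg_left ?_ (sourceConst_nonneg c κ))
    linarith [abs_truncate_le hM (z.2.fn x), abs_truncate_le hM (z.2.dx x)]
  obtain ⟨a1, a2⟩ := ae_abs_potentialForce_le (isPinched_density h0 h1 z.1) e1
  have e2 := (norm_sourceFn_le κ h0 h1 hM z).trans (mul_le_mul_of_nonneg_left
    (mul_le_mul_of_nonneg_left (norm_snd_le z) zero_le_two) (sourceConst_nonneg c κ))
  constructor
  · filter_upwards [a1] with x hx
    refine hx.trans ?_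
    have := mul_le_mul_of_nonneg_left e2 (by positivity : 0 ≤ 5 * c⁻¹ ^ 2)
    linarith
  · filter_upwards [a2] with x hx
    refine hx.trans ?_
    have := mul_le_mul_of_nonneg_left e2 (by positivity : 0 ≤ 5 * c⁻¹ ^ 3)
    linarith

/-! ### Integral curves of the Lagrangian vector field -/

/-- Grönwall's inequality in both directions of time. -/
theorem norm_le_exp_of_norm_deriv_le {E : Type*} [NormedAddCommGroup E] [NormedSpace ℝ E]
    {f f' : ℝ → E} {a b K : ℝ} (hf : ∀ t ∈ Ioo a b, HasDerivAt f (f' t) t)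
    (hb : ∀ t ∈ Ioo a b, ‖f' t‖ ≤ K * ‖f t‖) {s t : ℝ} (hs : s ∈ Ioo a b) (ht : t ∈ Ioo a b) :
    ‖f t‖ ≤ ‖f s‖ * Real.exp (K * |t - s|) := by
  rcases le_total s t with hst | hst
  · have sub : Icc s t ⊆ Ioo a b := fun x hx => ⟨hs.1.trans_le hx.1, hx.2.trans_lt ht.2⟩
    have := norm_le_gronwallBound_of_norm_deriv_right_le (f := f) (f' := f') (δ := ‖f s‖) (K := K)
      (ε := 0) (a := s) (b := t)
      (fun x hx => (hf x (sub hx)).continuousAt.continuousWithinAt)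
      (fun x hx => (hf x (sub (Ico_subset_Icc_self hx))).hasDerivWithinAt) le_rfl
      (fun x hx => by simpa using hb x (sub (Ico_subset_Icc_self hx))) t (right_mem_Icc.mpr hst)
    rwa [gronwallBound_ε0, ← abs_of_nonneg (sub_nonneg.mpr hst)] at this
  · have sub : ∀ x ∈ Icc (-s) (-t), -x ∈ Ioo a b := fun x hx =>
      ⟨by linarith [ht.1, hx.2], by linarith [hs.2, hx.1]⟩
    have hd : ∀ x ∈ Icc (-s) (-t), HasDerivAt (fun x => f (-x)) (-f' (-x)) x := fun x hx => by
      have := (hf (-x) (sub x hx)).scomp x (hasDerivAt_neg x)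
      rwa [neg_smul, one_smul] at this
    have := norm_le_gronwallBound_of_norm_deriv_right_le (f := fun x => f (-x))
      (f' := fun x => -f' (-x)) (δ := ‖f s‖) (K := K) (ε := 0) (a := -s) (b := -t)
      (fun x hx => (hd x hx).continuousAt.continuousWithinAt)
      (fun x hx => (hd x (Ico_subset_Icc_self hx)).hasDerivWithinAt) (by simp)
      (fun x hx => by simpa using hb _ (sub x (Ico_subset_Icc_self hx))) (-t)
      (right_mem_Icc.mpr (by linarith))
    rw [gronwallBound_ε0, neg_neg] at this
    rwa [abs_of_nonpos (sub_nonpos.mpr hst), neg_sub, show s - t = -t - -s by ring]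

/-- A bound for the integrals over sets of finite measure is a pointwise bound. -/
theorem ae_abs_le_of_setIntegral_le {f : L2} {D : ℝ}
    (h : ∀ s, MeasurableSet s → volume s < ∞ → |∫ x in s, f x| ≤ D * volume.real s) :
    ∀ᵐ x, |f x| ≤ D := by
  have hi : ∀ s : Set ℝ, volume s < ∞ → IntegrableOn f s := fun s hs => by
    have : IsFiniteMeasure (volume.restrict s) := ⟨by simpa using hs⟩
    exact ((Lp.memLp f).restrict s).integrable (by norm_num)
  have hc : ∀ s : Set ℝ, volume s < ∞ → IntegrableOn (fun _ : ℝ => D) s := fun s hs =>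
    integrableOn_const hs.ne
  have h1 := ae_nonneg_of_forall_setIntegral_nonneg_of_sigmaFinite (f := fun x => D - f x)
    (μ := volume) (fun s _ h2 => (hc s h2).sub (hi s h2)) fun s h1 h2 => by
      rw [integral_sub (hc s h2) (hi s h2), setIntegral_const, smul_eq_mul, mul_comm]
      linarith [(abs_le.mp (h s h1 h2)).2]
  have h2 := ae_nonneg_of_forall_setIntegral_nonneg_of_sigmaFinite (f := fun x => D + f x)
    (μ := volume) (fun s _ h2 => (hc s h2).add (hi s h2)) fun s h1 h2 => by
      rw [integral_add (hc s h2) (hi s h2), setIntegral_const, smul_eq_mul, mul_comm]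
      linarith [(abs_le.mp (h s h1 h2)).1]
  filter_upwards [h1, h2] with x h1 h2
  simp only [Pi.zero_apply] at h1 h2
  exact abs_le.mpr ⟨by linarith, by linarith⟩

theorem abs_setIntegral_le_of_ae_abs_le {f : L2} {D : ℝ} (h : ∀ᵐ x, |f x| ≤ D) {s : Set ℝ}
    (h2 : volume s < ∞) : |∫ x in s, f x| ≤ D * volume.real s :=
  norm_setIntegral_le_of_norm_le_const_ae (f := f) h2 (ae_restrict_of_ae h)

/-- Uniform bounds propagate along a differentiable curve in `L²`, by the mean value inequality for
the integrals over sets of finite measure. -/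
theorem ae_abs_le_of_hasDerivAt {p p' : ℝ → L2} {T B C : ℝ}
    (hp : ∀ t ∈ Ioo (-T) T, HasDerivAt p (p' t) t) (hC : ∀ t ∈ Ioo (-T) T, ∀ᵐ x, |p' t x| ≤ C)
    (hB : ∀ᵐ x, |p 0 x| ≤ B) {t : ℝ} (ht : t ∈ Ioo (-T) T) : ∀ᵐ x, |p t x| ≤ B + C * T := by
  refine ae_abs_le_of_setIntegral_le fun s h1 h2 => ?_
  have hT : (0 : ℝ) ∈ Ioo (-T) T := ⟨by linarith [ht.1, ht.2], by linarith [ht.1, ht.2]⟩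
  let ℓ : L2 →L[ℝ] ℝ := innerSL ℝ (indicatorConstLp 2 h1 h2.ne (1 : ℝ))
  have hℓ : ∀ f, ℓ f = ∫ x in s, f x := fun f => L2.inner_indicatorConstLp_one h1 h2.ne f
  have e1 := (convex_Ioo (-T) T).norm_image_sub_le_of_norm_hasDerivWithin_le
    (f := fun t => ℓ (p t)) (f' := fun t => ℓ (p' t)) (C := C * volume.real s)
    (fun x hx => (ℓ.hasFDerivAt.comp_hasDerivAt x (hp x hx)).hasDerivWithinAt)
    (fun x hx => by
      rw [hℓ]
      exact abs_setIntegral_le_of_ae_abs_le (hC x hx) h2) hT ht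
  rw [hℓ, hℓ, Real.norm_eq_abs, Real.norm_eq_abs, sub_zero] at e1
  have e2 := abs_setIntegral_le_of_ae_abs_le hB h2
  have e3 : |t| ≤ T := (abs_lt.mpr ht).le
  have e4 : 0 ≤ C * volume.real s := (abs_nonneg _).trans
    (abs_setIntegral_le_of_ae_abs_le (hC t ht) h2)
  have e5 := mul_le_mul_of_nonneg_left e3 e4
  have e6 := abs_sub_abs_le_abs_sub (∫ x in s, p t x) (∫ x in s, p 0 x)
  linarith

theorem sourceConst_mono {c M M' : ℝ} (κ : ℝ) (hM : 0 ≤ M) (h : M ≤ M') :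
    sourceConst c M κ ≤ sourceConst c M' κ := by
  have : 0 ≤ |κ| := abs_nonneg κ
  unfold sourceConst
  gcongr

theorem fieldConst_mono {c M M' ρ ρ' : ℝ} (κ : ℝ) (hM : 0 ≤ M) (h : M ≤ M') (hρ : 0 ≤ ρ)
    (h' : ρ ≤ ρ') : fieldConst c M κ ρ ≤ fieldConst c M' κ ρ' := by
  have h1 := sourceConst_mono (c := c) κ hM h
  have h2 := sourceConst_nonneg c κ (M := M')
  unfold fieldConst accelConst
  gcongr

/-- Solutions in Lagrangian coordinates, on a time interval depending only on a bound `R` for the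
data, with bounds proportional to the size `r` of the datum. -/
theorem exists_lagrangian (κ : ℝ) {R : ℝ} (hR : 0 ≤ R) : ∃ T > 0, ∀ r, 0 ≤ r → r ≤ R →
    ∀ u₀ : H1, ‖u₀‖ ≤ r → (∀ᵐ x, |u₀.fn x| ≤ r) → (∀ᵐ x, |u₀.dx x| ≤ r) →
    ∃ z : ℝ → H1 × H1, z 0 = (0, u₀) ∧ ∀ t ∈ Ioo (-T) T,
      HasDerivAt z (lagrangeField (1 / 2) (2 * r) κ (z t)) t ∧ ‖z t‖ ≤ 2 * r ∧
      (∀ᵐ x, |(z t).1.dx x| ≤ 1 / 2) ∧ (∀ᵐ x, |(z t).2.fn x| ≤ 2 * r) ∧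
      ∀ᵐ x, |(z t).2.dx x| ≤ 2 * r := by
  have hh0 : (0 : ℝ) < 1 / 2 := by norm_num
  have hh1 : (1 / 2 : ℝ) ≤ 1 := by norm_num
  set K := fieldConst (1 / 2) (2 * R) κ (R + 1) with hK
  set S := sourceConst (1 / 2) (2 * R) κ with hS
  have hK1 : 1 ≤ K := by
    have := accelConst_nonneg (1 / 2) (2 * R) κ (show 0 ≤ R + 1 by linarith)
    rw [hK, fieldConst]
    linarith
  have hS0 : 0 ≤ S := sourceConst_nonneg _ _
  have hKR : 0 ≤ K * R := by positivity
  -- The time of existence is `D⁻¹`. The term `2 K (R + 1)` keeps the curve in the unit ball around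
  -- the datum and the Grönwall factor below `e^{1/2} ≤ 2`; `164 S r` bounds the acceleration
  -- and its `x`-derivative pointwise; `|∂ₓU| ≤ 2 r` integrates to
  -- `|∂ₓζ| ≤ 1/2` thanks to `4 R`.
  set D := 2 * (K * (R + 1)) + 164 * S + 4 * R + 1 with hD
  have hD0 : 0 < D := by rw [hD]; positivity
  have hT : 0 < D⁻¹ := inv_pos.mpr hD0
  have hle : ∀ x, x ≤ D → x * D⁻¹ ≤ 1 := fun x hx => by
    rw [← div_eq_mul_inv]
    exact div_le_one_of_le₀ hx hD0.le
  refine ⟨D⁻¹, hT, fun r hr0 hrR u₀ hu₀ hfn hdx => ?_⟩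
  have hM : 0 ≤ 2 * r := by positivity
  have hKr : ∀ ρ, 0 ≤ ρ → ρ ≤ R + 1 → fieldConst (1 / 2) (2 * r) κ ρ ≤ K := fun ρ h1 h2 =>
    fieldConst_mono κ hM (by linarith) h1 h2
  have hSr : sourceConst (1 / 2) (2 * r) κ ≤ S := sourceConst_mono κ hM (by linarith)
  have hSr0 : 0 ≤ sourceConst (1 / 2) (2 * r) κ := sourceConst_nonneg _ _
  have hz0 : ‖((0 : H1), u₀)‖ ≤ r := by
    rw [Prod.norm_mk, norm_zero]
    exact max_le hr0 hu₀
  have hball : ∀ w ∈ Metric.closedBall ((0 : H1), u₀) ((1 : ℝ≥0) : ℝ), ‖w‖ ≤ R + 1 := by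
    intro w hw
    rw [mem_closedBall_iff_norm] at hw
    have := norm_le_norm_add_norm_sub' w ((0 : H1), u₀)
    simp only [NNReal.coe_one] at hw
    linarith
  have h0mem : (0 : ℝ) ∈ Icc (-D⁻¹) D⁻¹ := ⟨by linarith, hT.le⟩
  have hPL : IsPicardLindelof (fun _ => lagrangeField (1 / 2) (2 * r) κ)
      (tmin := -D⁻¹) (tmax := D⁻¹)
      ⟨0, h0mem⟩ ((0 : H1), u₀) 1 0 (K * (R + 1)).toNNReal K.toNNReal := by
    refine ⟨fun t _ => ?_, fun _ _ => continuousOn_const, fun t _ w hw => ?_, ?_⟩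
    · refine LipschitzOnWith.of_dist_le_mul fun z _ w hw => ?_
      rw [dist_eq_norm, dist_eq_norm, Real.coe_toNNReal _ (by linarith)]
      refine (norm_lagrangeField_sub_le κ hh0 hh1 hM z (hball w hw)).trans ?_
      exact mul_le_mul_of_nonneg_right (hKr _ (by linarith) le_rfl) (norm_nonneg _)
    · rw [Real.coe_toNNReal _ (by positivity)]
      refine (norm_lagrangeField_le κ hh0 hh1 hM w).trans ?_
      exact mul_le_mul (hKr _ le_rfl (by linarith)) (hball w hw) (norm_nonneg _) (by linarith)
    · simp only [sub_zero, zero_sub, neg_neg, max_self, NNReal.coe_one, NNReal.coe_zero]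
      rw [Real.coe_toNNReal _ (by positivity)]
      have := mul_nonneg (zero_le_one.trans hK1) (show 0 ≤ R + 1 by linarith)
      exact hle _ (by rw [hD]; linarith)
  obtain ⟨z, hz, hzd⟩ := hPL.exists_eq_forall_mem_Icc_hasDerivWithinAt₀
  have hd : ∀ t ∈ Ioo (-D⁻¹) D⁻¹, HasDerivAt z (lagrangeField (1 / 2) (2 * r) κ (z t)) t :=
    fun t ht => (hzd t (Ioo_subset_Icc_self ht)).hasDerivAt (Icc_mem_nhds ht.1 ht.2)
  have h0 : (0 : ℝ) ∈ Ioo (-D⁻¹) D⁻¹ := ⟨by linarith, hT⟩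
  have hn : ∀ t ∈ Ioo (-D⁻¹) D⁻¹, ‖z t‖ ≤ 2 * r := by
    intro t ht
    have h1 := norm_le_exp_of_norm_deriv_le (K := K) hd (fun t _ =>
      (norm_lagrangeField_le κ hh0 hh1 hM (z t)).trans
        (mul_le_mul_of_nonneg_right (hKr _ le_rfl (by linarith)) (norm_nonneg _))) h0 ht
    have h2 : K * |t - 0| ≤ 1 / 2 := by
      rw [sub_zero]
      have h3 : |t| ≤ D⁻¹ := (abs_lt.mpr ht).le
      have h4 := hle (2 * K) (by rw [hD]; nlinarith)
      nlinarith
    have h3 : Real.exp (K * |t - 0|) ≤ 2 := by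
      refine (Real.exp_le_exp.mpr h2).trans ?_
      have h5 := Real.exp_bound_div_one_sub_of_interval' (x := 1 / 2) (by norm_num) (by norm_num)
      norm_num at h5 ⊢
      exact h5.le
    change z 0 = _ at hz
    rw [hz] at h1
    calc ‖z t‖ ≤ ‖((0 : H1), u₀)‖ * Real.exp (K * |t - 0|) := h1
      _ ≤ r * 2 := by gcongr
      _ = 2 * r := by ring
  have hacc := fun t => ae_abs_accel_le κ hh0 hh1 hM (z t)
  change z 0 = _ at hz
  have h2U : ∀ t ∈ Ioo (-D⁻¹) D⁻¹, HasDerivAt (fun t => (z t).2)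
      (accel (1 / 2) (2 * r) κ (z t)) t := fun t ht => (hd t ht).snd
  have h1ζ : ∀ t ∈ Ioo (-D⁻¹) D⁻¹, HasDerivAt (fun t => (z t).1) (z t).2 t :=
    fun t ht => (hd t ht).fst
  have hST : 164 * S * D⁻¹ ≤ 1 := hle _ (by rw [hD]; nlinarith)
  have hRT : 4 * R * D⁻¹ ≤ 1 := hle _ (by rw [hD]; nlinarith)
  have bfn : ∀ t ∈ Ioo (-D⁻¹) D⁻¹, ∀ᵐ x, |(z t).2.fn x| ≤ 2 * r := by
    intro t ht
    have h1 := ae_abs_le_of_hasDerivAt (B := r) (C := 164 * S * r)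
      (fun t ht => H1.fnL.hasFDerivAt.comp_hasDerivAt t (h2U t ht)) (fun t ht => ?_) ?_ ht
    · filter_upwards [h1] with x hx
      refine hx.trans ?_
      nlinarith [mul_le_mul_of_nonneg_right hST hr0]
    · filter_upwards [(hacc t).1] with x hx
      refine hx.trans ?_
      have e1 := hn t ht
      calc 10 * (1 / 2 : ℝ)⁻¹ ^ 2 * sourceConst (1 / 2) (2 * r) κ * ‖z t‖
          ≤ 10 * (1 / 2 : ℝ)⁻¹ ^ 2 * S * (2 * r) := by gcongr
        _ ≤ 164 * S * r := by
          have := mul_nonneg hS0 hr0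
          norm_num
          linarith
    · simp only [Function.comp_apply, hz, H1.fnL_apply]
      exact hfn
  have bdx : ∀ t ∈ Ioo (-D⁻¹) D⁻¹, ∀ᵐ x, |(z t).2.dx x| ≤ 2 * r := by
    intro t ht
    have h1 := ae_abs_le_of_hasDerivAt (B := r) (C := 164 * S * r)
      (fun t ht => H1.dxL.hasFDerivAt.comp_hasDerivAt t (h2U t ht)) (fun t ht => ?_) ?_ ht
    · filter_upwards [h1] with x hx
      refine hx.trans ?_
      nlinarith [mul_le_mul_of_nonneg_right hST hr0]
    · filter_upwards [(hacc t).2] with x hx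
      refine hx.trans ?_
      have e1 := hn t ht
      calc sourceConst (1 / 2) (2 * r) κ * (2 * (2 * r) + 10 * (1 / 2 : ℝ)⁻¹ ^ 3 * ‖z t‖)
          ≤ S * (2 * (2 * r) + 10 * (1 / 2 : ℝ)⁻¹ ^ 3 * (2 * r)) := by gcongr
        _ = 164 * S * r := by
          norm_num
          ring
    · simp only [Function.comp_apply, hz, H1.dxL_apply]
      exact hdx
  refine ⟨z, hz, fun t ht => ⟨hd t ht, hn t ht, ?_, bfn t ht, bdx t ht⟩⟩
  have h1 := ae_abs_le_of_hasDerivAt (B := 0) (C := 2 * r)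
    (fun t ht => H1.dxL.hasFDerivAt.comp_hasDerivAt t (h1ζ t ht)) (fun t ht => bdx t ht) ?_ ht
  · filter_upwards [h1] with x hx
    refine hx.trans ?_
    nlinarith
  · simp only [Function.comp_apply, hz, H1.dxL_apply, H1.dx_zero]
    filter_upwards [Lp.coeFn_zero ℝ 2 (volume : Measure ℝ)] with x
    simp

/-! ### Composition of `L²` functions with expanding maps -/

/-- A measurable map of the line with `c |a - b| ≤ |θ a - θ b|`, where `0 < c ≤ 1`. -/
structure IsExpanding (c : ℝ) (θ : ℝ → ℝ) : Prop where
  pos : 0 < c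
  le_one : c ≤ 1
  measurable : Measurable θ
  le_abs_sub : ∀ a b, c * |a - b| ≤ |θ a - θ b|

namespace IsExpanding

variable {c : ℝ} {θ θ' : ℝ → ℝ}

/-- The inverse of an expanding map is Lipschitz, and Lebesgue measure is Hausdorff measure. -/
theorem map_volume_le (h : IsExpanding c θ) :
    Measure.map θ volume ≤ ENNReal.ofReal c⁻¹ • (volume : Measure ℝ) := by
  have ha : AntilipschitzWith (Real.toNNReal c⁻¹) θ := by
    refine AntilipschitzWith.of_le_mul_dist fun a b => ?_
    rw [Real.coe_toNNReal _ (inv_nonneg.mpr h.pos.le), Real.dist_eq, Real.dist_eq,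
      ← div_eq_inv_mul, le_div_iff₀ h.pos, mul_comm]
    exact h.le_abs_sub a b
  refine Measure.le_iff.mpr fun s hs => ?_
  rw [Measure.map_apply h.measurable hs, Measure.smul_apply, smul_eq_mul]
  have := ha.hausdorffMeasure_preimage_le zero_le_one s
  rwa [hausdorffMeasure_real, ENNReal.rpow_one] at this

theorem quasiMeasurePreserving (h : IsExpanding c θ) :
    Measure.QuasiMeasurePreserving θ volume volume :=
  ⟨h.measurable, (Measure.absolutelyContinuous_of_le h.map_volume_le).trans
    Measure.smul_absolutelyContinuous⟩

theorem ae_comp (h : IsExpanding c θ) {p : ℝ → Prop} (hp : ∀ᵐ x, p x) : ∀ᵐ y, p (θ y) :=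
  h.quasiMeasurePreserving.ae hp

theorem aestronglyMeasurable_comp (h : IsExpanding c θ) {f : ℝ → ℝ}
    (hf : AEStronglyMeasurable f volume) : AEStronglyMeasurable (fun y => f (θ y)) volume :=
  hf.comp_quasiMeasurePreserving h.quasiMeasurePreserving

theorem eLpNorm_comp_le (h : IsExpanding c θ) {f : ℝ → ℝ} (hf : AEStronglyMeasurable f volume) :
    eLpNorm (fun y => f (θ y)) 2 volume ≤ ENNReal.ofReal c⁻¹ * eLpNorm f 2 volume := by
  have h1 : eLpNorm (fun y => f (θ y)) 2 volume = eLpNorm f 2 (Measure.map θ volume) :=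
    (eLpNorm_map_measure (hf.mono_ac h.quasiMeasurePreserving.2) h.measurable.aemeasurable).symm
  rw [h1]
  refine (eLpNorm_mono_measure f h.map_volume_le).trans ?_
  have h3 : 1 ≤ c⁻¹ := (one_le_inv₀ h.pos).mpr h.le_one
  rw [eLpNorm_smul_measure_of_ne_top (by norm_num), smul_eq_mul]
  gcongr
  rw [show ((1 / 2 : ℝ≥0∞)).toReal = 1 / 2 by simp, ENNReal.ofReal_rpow_of_pos (inv_pos.mpr h.pos)]
  refine ENNReal.ofReal_le_ofReal ?_
  calc (c⁻¹) ^ (1 / 2 : ℝ) ≤ c⁻¹ ^ (1 : ℝ) := Real.rpow_le_rpow_of_exponent_le h3 (by norm_num)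
    _ = c⁻¹ := Real.rpow_one _

theorem memLp_comp (h : IsExpanding c θ) (f : L2) : MemLp (fun y => f (θ y)) 2 volume :=
  ⟨h.aestronglyMeasurable_comp (Lp.aestronglyMeasurable f),
    (h.eLpNorm_comp_le (Lp.aestronglyMeasurable f)).trans_lt
      (ENNReal.mul_lt_top ENNReal.ofReal_lt_top (Lp.eLpNorm_lt_top f))⟩

end IsExpanding

/-- The composition `f ∘ θ` in `L²`, for an expanding map `θ`. (For other maps it may be the junk
value `0`.) -/
def compL2 (θ : ℝ → ℝ) (f : L2) : L2 := toL2 fun y => f (θ y)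

namespace IsExpanding

variable {c : ℝ} {θ θ' : ℝ → ℝ}

theorem coeFn_compL2 (h : IsExpanding c θ) (f : L2) : compL2 θ f =ᵐ[volume] fun y => f (θ y) :=
  coeFn_toL2 (h.memLp_comp f)

theorem norm_compL2_le (h : IsExpanding c θ) (f : L2) : ‖compL2 θ f‖ ≤ c⁻¹ * ‖f‖ := by
  rw [compL2, toL2, dif_pos (h.memLp_comp f), Lp.norm_toLp, Lp.norm_def]
  have h1 := ENNReal.toReal_mono (ENNReal.mul_lt_top ENNReal.ofReal_lt_top
    (Lp.eLpNorm_lt_top f)).ne (h.eLpNorm_comp_le (Lp.aestronglyMeasurable f))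
  rwa [ENNReal.toReal_mul, ENNReal.toReal_ofReal (inv_nonneg.mpr h.pos.le)] at h1

theorem compL2_sub (h : IsExpanding c θ) (f g : L2) :
    compL2 θ (f - g) = compL2 θ f - compL2 θ g := by
  refine toL2_eq ?_
  filter_upwards [h.ae_comp (Lp.coeFn_sub f g), Lp.coeFn_sub (compL2 θ f) (compL2 θ g),
    h.coeFn_compL2 f, h.coeFn_compL2 g] with y h1 h2 h3 h4
  rw [h1, h2, Pi.sub_apply, Pi.sub_apply, h3, h4]

theorem compL2_smul (h : IsExpanding c θ) (a : ℝ) (f : L2) :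
    compL2 θ (a • f) = a • compL2 θ f := by
  refine toL2_eq ?_
  filter_upwards [h.ae_comp (Lp.coeFn_smul a f), Lp.coeFn_smul a (compL2 θ f),
    h.coeFn_compL2 f] with y h1 h2 h3
  rw [h1, h2, Pi.smul_apply, Pi.smul_apply, h3]

end IsExpanding

/-- Composition depends continuously on the map, in the topology of uniform convergence. The
function `f` is approximated in `L²` by a continuous function of compact support. -/
theorem exists_norm_compL2_sub_le (f : L2) {c ε : ℝ} (hc : 0 < c) (hε : 0 < ε) :
    ∃ δ > 0, ∀ θ θ', IsExpanding c θ → IsExpanding c θ' → (∀ x, |θ x - θ' x| ≤ δ) →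
      ‖compL2 θ f - compL2 θ' f‖ ≤ ε := by
  have hci : 0 < c⁻¹ := inv_pos.mpr hc
  set ε' := ε / (3 * c⁻¹) with hε'
  have hε0 : 0 < ε' := by positivity
  obtain ⟨g, hgc, hgε, hg, hgL⟩ := (Lp.memLp f).exists_hasCompactSupport_eLpNorm_sub_le
    (by norm_num : (2 : ℝ≥0∞) ≠ ∞) (ε := ENNReal.ofReal ε') (by simpa using hε0)
  have hfg : ‖f - toL2 g‖ ≤ ε' := by
    rw [Lp.norm_def]
    refine ENNReal.toReal_le_of_le_ofReal hε0.le ?_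
    refine le_trans (le_of_eq (eLpNorm_congr_ae ?_)) hgε
    filter_upwards [Lp.coeFn_sub f (toL2 g), coeFn_toL2 hgL] with x h1 h2
    rw [h1, Pi.sub_apply, Pi.sub_apply, h2]
  -- `g ∘ θ - g ∘ θ'` is small and vanishes where `θ` is not in a neighbourhood `S` of the support.
  let S : Set ℝ := Metric.cthickening 1 (tsupport g)
  have hS : IsCompact S := IsCompact.cthickening hgc
  have h1S : MemLp (indicator S fun _ => (1 : ℝ)) 2 volume :=
    memLp_indicator_const 2 hS.measurableSet 1 (Or.inr hS.measure_lt_top.ne)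
  let k : L2 := toL2 (indicator S fun _ => (1 : ℝ))
  set η := ε' / (‖k‖ + 1) with hη
  have hη0 : 0 < η := by positivity
  obtain ⟨δ, hδ0, hδ⟩ := Metric.uniformContinuous_iff.mp
    (hg.uniformContinuous_of_tendsto_cocompact (hgc.is_zero_at_infty)) η hη0
  refine ⟨min (δ / 2) 1, by positivity, fun θ θ' hθ hθ' hd => ?_⟩
  have e1 : ‖compL2 θ (toL2 g) - compL2 θ' (toL2 g)‖ ≤ η * ‖compL2 θ k‖ := by
    refine norm_le_of_abs_le_mul ?_
    filter_upwards [Lp.coeFn_sub (compL2 θ (toL2 g)) (compL2 θ' (toL2 g)),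
      hθ.coeFn_compL2 (toL2 g), hθ'.coeFn_compL2 (toL2 g), hθ.coeFn_compL2 k,
      hθ.ae_comp (coeFn_toL2 hgL), hθ'.ae_comp (coeFn_toL2 hgL), hθ.ae_comp (coeFn_toL2 h1S)]
      with y e1 e2 e3 e4 e5 e6 e7
    rw [e1, Pi.sub_apply, e2, e3, e4, e5, e6, e7]
    by_cases hy : θ y ∈ S
    · rw [indicator_of_mem hy, abs_one, mul_one]
      have := hδ (a := θ y) (b := θ' y) (by
        rw [Real.dist_eq]
        exact ((hd y).trans (min_le_left _ _)).trans_lt (by linarith))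
      exact this.le
    · have h1 : θ y ∉ tsupport g := fun h => hy (Metric.self_subset_cthickening _ h)
      have h2 : θ' y ∉ tsupport g := fun h => hy (Metric.mem_cthickening_of_dist_le _ _ _ _ h (by
        rw [Real.dist_eq]
        exact (hd y).trans (min_le_right _ _)))
      rw [image_eq_zero_of_notMem_tsupport h1, image_eq_zero_of_notMem_tsupport h2,
        indicator_of_notMem hy]
      simp
  have e2 : η * ‖compL2 θ k‖ ≤ c⁻¹ * ε' := by
    calc η * ‖compL2 θ k‖ ≤ η * (c⁻¹ * ‖k‖) := by
          gcongr
          exact hθ.norm_compL2_le k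
      _ = c⁻¹ * (ε' * (‖k‖ / (‖k‖ + 1))) := by rw [hη]; ring
      _ ≤ c⁻¹ * (ε' * 1) := by
          gcongr
          exact div_le_one_of_le₀ (by linarith) (by positivity)
      _ = c⁻¹ * ε' := by ring
  have e3 : compL2 θ f - compL2 θ' f = compL2 θ (f - toL2 g)
      + (compL2 θ (toL2 g) - compL2 θ' (toL2 g)) - compL2 θ' (f - toL2 g) := by
    rw [hθ.compL2_sub, hθ'.compL2_sub]
    abel
  have e4 : ‖compL2 θ (f - toL2 g)‖ ≤ c⁻¹ * ε' := (hθ.norm_compL2_le _).trans (by gcongr)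
  have e5 : ‖compL2 θ' (f - toL2 g)‖ ≤ c⁻¹ * ε' := (hθ'.norm_compL2_le _).trans (by gcongr)
  have e6 : 3 * (c⁻¹ * ε') = ε := by
    rw [hε']
    field_simp
  rw [e3]
  refine (norm_sub_le _ _).trans ?_
  have := norm_add_le (compL2 θ (f - toL2 g)) (compL2 θ (toL2 g) - compL2 θ' (toL2 g))
  linarith

/-- A version of `exists_norm_compL2_sub_le` which is uniform on compact sets. -/
theorem exists_norm_compL2_sub_le_of_isCompact {K : Set L2} (hK : IsCompact K) {c ε : ℝ}
    (hc : 0 < c) (hε : 0 < ε) :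
    ∃ δ > 0, ∀ f ∈ K, ∀ θ θ', IsExpanding c θ → IsExpanding c θ' → (∀ x, |θ x - θ' x| ≤ δ) →
      ‖compL2 θ f - compL2 θ' f‖ ≤ ε := by
  have hci : 0 < c⁻¹ := inv_pos.mpr hc
  have h3 : 0 < ε / 3 := by positivity
  choose d hd0 hd using fun f : L2 => exists_norm_compL2_sub_le f hc h3
  obtain ⟨t, -, htf, htK⟩ := hK.finite_cover_balls (e := ε / (3 * c⁻¹)) (by positivity)
  have : ∃ δ > 0, ∀ g ∈ t, δ ≤ d g := by
    rcases t.eq_empty_or_nonempty with rfl | hne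
    · exact ⟨1, one_pos, by simp⟩
    · obtain ⟨g, _, hg⟩ := Set.exists_min_image t d htf hne
      exact ⟨d g, hd0 g, hg⟩
  obtain ⟨δ, hδ0, hδ⟩ := this
  refine ⟨δ, hδ0, fun f hf θ θ' hθ hθ' hle => ?_⟩
  obtain ⟨g, hg, hfg⟩ := mem_iUnion₂.mp (htK hf)
  rw [mem_ball_iff_norm] at hfg
  have e1 := hd g θ θ' hθ hθ' fun x => (hle x).trans (hδ g hg)
  have e3 : compL2 θ f - compL2 θ' f = compL2 θ (f - g)
      + (compL2 θ g - compL2 θ' g) - compL2 θ' (f - g) := by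
    rw [hθ.compL2_sub, hθ'.compL2_sub]
    abel
  have e6 : c⁻¹ * (ε / (3 * c⁻¹)) = ε / 3 := by
    field_simp
  have e4 : ‖compL2 θ (f - g)‖ ≤ ε / 3 := by
    rw [← e6]
    exact (hθ.norm_compL2_le _).trans (by gcongr)
  have e5 : ‖compL2 θ' (f - g)‖ ≤ ε / 3 := by
    rw [← e6]
    exact (hθ'.norm_compL2_le _).trans (by gcongr)
  rw [e3]
  refine (norm_sub_le _ _).trans ?_
  have := norm_add_le (compL2 θ (f - g)) (compL2 θ g - compL2 θ' g)
  linarith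

/-- If `a(t) → b` in `L²` and `θ_t → θ` uniformly, then `a(t) ∘ θ_t → b ∘ θ` in `L²`. -/
theorem tendsto_compL2 {ι : Type*} {l : Filter ι} {a : ι → L2} {b : L2} {θ : ι → ℝ → ℝ}
    {θ₀ : ℝ → ℝ} {c : ℝ} (hθ : ∀ᶠ i in l, IsExpanding c (θ i)) (hθ₀ : IsExpanding c θ₀)
    (ha : Tendsto a l (𝓝 b)) {d : ι → ℝ} (hd : ∀ᶠ i in l, ∀ x, |θ i x - θ₀ x| ≤ d i)
    (hd0 : Tendsto d l (𝓝 0)) : Tendsto (fun i => compL2 (θ i) (a i)) l (𝓝 (compL2 θ₀ b)) := by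
  rw [tendsto_iff_norm_sub_tendsto_zero] at ha ⊢
  rw [Metric.tendsto_nhds]
  intro ε hε
  obtain ⟨δ, hδ0, hδ⟩ := exists_norm_compL2_sub_le b hθ₀.pos (half_pos hε)
  have hci : 0 < c⁻¹ := inv_pos.mpr hθ₀.pos
  have h1 : ∀ᶠ i in l, c⁻¹ * ‖a i - b‖ < ε / 2 := by
    have := ha.const_mul c⁻¹
    rw [mul_zero] at this
    exact this.eventually (gt_mem_nhds (half_pos hε))
  filter_upwards [hθ, hd, hd0.eventually (gt_mem_nhds hδ0), h1] with i h1 h2 h3 h4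
  rw [Real.dist_eq, sub_zero, abs_of_nonneg (norm_nonneg _)]
  have e1 := hδ _ _ h1 hθ₀ fun x => (h2 x).trans h3.le
  have e2 : compL2 (θ i) (a i) - compL2 θ₀ b
      = compL2 (θ i) (a i - b) + (compL2 (θ i) b - compL2 θ₀ b) := by
    rw [h1.compL2_sub]
    abel
  rw [e2]
  have := norm_add_le (compL2 (θ i) (a i - b)) (compL2 (θ i) b - compL2 θ₀ b)
  have := h1.norm_compL2_le (a i - b)
  linarith

/-! ### Bi-Lipschitz changes of variables of the line -/

theorem locallyIntegrable_of_abs_le {f : ℝ → ℝ} (hf : AEStronglyMeasurable f volume) {C : ℝ}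
    (hC : ∀ᵐ x, |f x| ≤ C) : LocallyIntegrable f volume := by
  intro x
  refine ⟨Icc (x - 1) (x + 1), Icc_mem_nhds (by linarith) (by linarith), ?_⟩
  exact Measure.integrableOn_of_bounded (M := C) (by simp) hf (ae_restrict_of_ae hC)

/-- `ξ` is an increasing bi-Lipschitz bijection of the line, with density `J = ξ'` valued in
`[c, 1/c]`. -/
structure IsChart (c : ℝ) (ξ J : ℝ → ℝ) : Prop where
  isPinched : IsPinched c J
  isPrimitive : IsPrimitive ξ J

namespace IsChart

variable {c : ℝ} {ξ J η : ℝ → ℝ}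

theorem le_sub (h : IsChart c ξ J) {a b : ℝ} (hab : a ≤ b) : c * (b - a) ≤ ξ b - ξ a := by
  rw [h.isPrimitive.sub_eq]
  have := intervalIntegral.integral_mono_ae hab (by simp) (h.isPrimitive.intervalIntegrable a b)
    (f := fun _ => c) h.isPinched.lower
  simpa [mul_comm] using this

theorem sub_le (h : IsChart c ξ J) {a b : ℝ} (hab : a ≤ b) : ξ b - ξ a ≤ c⁻¹ * (b - a) := by
  rw [h.isPrimitive.sub_eq]
  have := intervalIntegral.integral_mono_ae hab (h.isPrimitive.intervalIntegrable a b) (by simp)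
    (g := fun _ => c⁻¹) h.isPinched.upper
  simpa [mul_comm] using this

theorem strictMono (h : IsChart c ξ J) : StrictMono ξ := fun a b hab => by
  have := h.le_sub hab.le
  have := mul_pos h.isPinched.pos (sub_pos.mpr hab)
  linarith

theorem continuous (h : IsChart c ξ J) : Continuous ξ := h.isPrimitive.continuous

theorem le_abs_sub (h : IsChart c ξ J) (a b : ℝ) : c * |a - b| ≤ |ξ a - ξ b| := by
  rcases le_total a b with hab | hab
  · rw [abs_sub_comm a, abs_sub_comm (ξ a), abs_of_nonneg (sub_nonneg.mpr hab)]
    exact (h.le_sub hab).trans (le_abs_self _)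
  · rw [abs_of_nonneg (sub_nonneg.mpr hab)]
    exact (h.le_sub hab).trans (le_abs_self _)

theorem abs_sub_le (h : IsChart c ξ J) (a b : ℝ) : |ξ a - ξ b| ≤ c⁻¹ * |a - b| := by
  rcases le_total a b with hab | hab
  · rw [abs_sub_comm a, abs_sub_comm (ξ a), abs_of_nonneg (sub_nonneg.mpr hab),
      abs_of_nonneg (sub_nonneg.mpr (h.strictMono.monotone hab))]
    exact h.sub_le hab
  · rw [abs_of_nonneg (sub_nonneg.mpr hab),
      abs_of_nonneg (sub_nonneg.mpr (h.strictMono.monotone hab))]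
    exact h.sub_le hab

theorem isExpanding (h : IsChart c ξ J) : IsExpanding c ξ :=
  ⟨h.isPinched.pos, h.isPinched.le_one, h.continuous.measurable, h.le_abs_sub⟩

theorem surjective (h : IsChart c ξ J) : Function.Surjective ξ := by
  have hc := h.isPinched.pos
  refine h.continuous.surjective ?_ ?_
  · refine tendsto_atTop_mono' atTop (f₁ := fun x => c * (x - 0) + ξ 0) ?_ ?_
    · filter_upwards [eventually_ge_atTop (0 : ℝ)] with x hx
      linarith [h.le_sub hx]
    · simp only [sub_zero]
      exact tendsto_atTop_add_const_right _ _ (tendsto_id.const_mul_atTop hc)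
  · have h1 : Tendsto (fun x => c * x + ξ 0) atBot atBot :=
      tendsto_atBot_add_const_right _ _ (tendsto_id.const_mul_atBot hc)
    refine tendsto_atBot_mono' atBot ?_ h1
    filter_upwards [eventually_le_atBot (0 : ℝ)] with x hx
    linarith [h.le_sub hx]

theorem withDensity_Ioc (h : IsChart c ξ J) {a b : ℝ} (hab : a ≤ b) :
    (volume.withDensity fun y => ENNReal.ofReal (J y)) (Ioc a b) = ENNReal.ofReal (ξ b - ξ a) := by
  rw [withDensity_apply _ measurableSet_Ioc, h.isPrimitive.sub_eq,
    intervalIntegral.integral_of_le hab, ofReal_integral_eq_lintegral_ofReal]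
  · exact (h.isPrimitive.intervalIntegrable a b).1
  · refine ae_restrict_of_ae ?_
    filter_upwards [h.isPinched.lower] with x hx
    exact h.isPinched.pos.le.trans hx

/-- Change of variables: `ξ` carries the measure `J dy` to Lebesgue measure. -/
theorem map_withDensity (h : IsChart c ξ J) :
    Measure.map ξ (volume.withDensity fun y => ENNReal.ofReal (J y)) = volume := by
  refine (Measure.ext_of_Ioc volume _ ?_).symm
  intro x x' hx
  obtain ⟨a, rfl⟩ := h.surjective x
  obtain ⟨b, rfl⟩ := h.surjective x'
  have hab := h.strictMono.lt_iff_lt.mp hx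
  have hp : ξ ⁻¹' Ioc (ξ a) (ξ b) = Ioc a b := by
    ext y
    simp [h.strictMono.lt_iff_lt, h.strictMono.le_iff_le]
  rw [Measure.map_apply h.continuous.measurable measurableSet_Ioc, hp, h.withDensity_Ioc hab.le,
    Real.volume_Ioc]

theorem integral_comp_mul (h : IsChart c ξ J) {g : ℝ → ℝ} (hg : AEStronglyMeasurable g volume)
    (a b : ℝ) : ∫ y in a..b, g (ξ y) * J y = ∫ x in (ξ a)..(ξ b), g x := by
  wlog hab : a ≤ b generalizing a b
  · rw [intervalIntegral.integral_symm, this b a (le_of_not_ge hab),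
      ← intervalIntegral.integral_symm]
  have hp : ξ ⁻¹' Ioc (ξ a) (ξ b) = Ioc a b := by
    ext y
    simp [h.strictMono.lt_iff_lt, h.strictMono.le_iff_le]
  rw [intervalIntegral.integral_of_le hab,
    intervalIntegral.integral_of_le (h.strictMono.monotone hab)]
  conv_rhs => rw [← h.map_withDensity]
  rw [setIntegral_map measurableSet_Ioc (by rwa [h.map_withDensity]) h.continuous.aemeasurable, hp,
    setIntegral_withDensity_eq_setIntegral_toReal_smul₀
      (h.isPinched.aesm.aemeasurable.ennreal_ofReal.restrict) (by simp) _ measurableSet_Ioc]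
  refine integral_congr_ae (ae_restrict_of_ae ?_)
  filter_upwards [h.isPinched.lower] with y hy
  rw [ENNReal.toReal_ofReal (h.isPinched.pos.le.trans hy), smul_eq_mul, mul_comm]

theorem isPrimitive_comp (h : IsChart c ξ J) {F g : ℝ → ℝ} (hF : IsPrimitive F g)
    (hg : LocallyIntegrable (fun y => g (ξ y) * J y) volume) :
    IsPrimitive (fun y => F (ξ y)) fun y => g (ξ y) * J y where
  locallyIntegrable := hg
  sub_eq a b := by
    rw [hF.sub_eq, h.integral_comp_mul hF.locallyIntegrable.aestronglyMeasurable]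

theorem leftInverse (h : IsChart c ξ J) (hη : ∀ x, ξ (η x) = x) (y : ℝ) : η (ξ y) = y :=
  h.strictMono.injective (hη _)

/-- The inverse of a change of variables with density `J` has density `1 / J ∘ ξ⁻¹`. -/
theorem inverse (h : IsChart c ξ J) (hη : ∀ x, ξ (η x) = x) :
    IsChart c η fun x => (J (η x))⁻¹ := by
  have hc := h.isPinched.pos
  have h1 : ∀ x x', c * |x - x'| ≤ |η x - η x'| := by
    intro x x'
    have := h.abs_sub_le (η x) (η x')
    rw [hη, hη, ← div_eq_inv_mul, le_div_iff₀ hc] at this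
    linarith
  have h2 : Measurable η := by
    have : Monotone η := fun x x' hx => by
      rw [← h.strictMono.le_iff_le, hη, hη]
      exact hx
    exact this.measurable
  have h3 : IsExpanding c η := ⟨hc, h.isPinched.le_one, h2, h1⟩
  have h4 : IsPinched c fun x => (J (η x))⁻¹ :=
    { pos := hc
      le_one := h.isPinched.le_one
      aesm := h3.aestronglyMeasurable_comp h.isPinched.inv.aesm
      lower := h3.ae_comp h.isPinched.inv.lower
      upper := h3.ae_comp h.isPinched.inv.upper }
  refine ⟨h4, locallyIntegrable_of_abs_le h4.aesm h4.abs_le, fun x x' => ?_⟩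
  have h5 := h.integral_comp_mul h4.aesm (η x) (η x')
  rw [hη, hη] at h5
  rw [← h5]
  have h6 : ∫ y in (η x)..(η x'), (J (η (ξ y)))⁻¹ * J y = ∫ _ in (η x)..(η x'), (1 : ℝ) := by
    refine intervalIntegral.integral_congr_ae ?_
    filter_upwards [h.isPinched.lower] with y hy _
    rw [h.leftInverse hη, inv_mul_cancel₀ (hc.trans_le hy).ne']
  rw [h6]
  simp

theorem memLp_mul_comp (h : IsChart c ξ J) (f : L2) :
    MemLp (fun y => f (ξ y) * J y) 2 volume := by
  have := h.isPinched.memLp_mul (compL2 ξ f)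
  refine this.ae_eq ?_
  filter_upwards [h.isExpanding.coeFn_compL2 f] with y hy
  rw [hy, mul_comm]

theorem hasWeakDeriv_comp (h : IsChart c ξ J) {f g : L2} (hf : HasWeakDeriv f g) :
    HasWeakDeriv (compL2 ξ f) (toL2 fun y => g (ξ y) * J y) := by
  obtain ⟨F, hF, hFg⟩ := hf.exists_isPrimitive
  refine (h.isPrimitive_comp hFg ((h.memLp_mul_comp g).locallyIntegrable
    (by norm_num))).hasWeakDeriv ?_ (coeFn_toL2 (h.memLp_mul_comp g))
  filter_upwards [h.isExpanding.coeFn_compL2 f, h.isExpanding.ae_comp hF] with y h1 h2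
  rw [h1, h2]

/-- The composition `f ∘ ξ` in `H¹`. -/
def pull (h : IsChart c ξ J) (f : H1) : H1 := H1.mk (h.hasWeakDeriv_comp f.hasWeakDeriv)

theorem pull_fn (h : IsChart c ξ J) (f : H1) : (h.pull f).fn = compL2 ξ f.fn := rfl

theorem pull_dx (h : IsChart c ξ J) (f : H1) :
    (h.pull f).dx = toL2 fun y => f.dx (ξ y) * J y := rfl

theorem pull_rep (h : IsChart c ξ J) (f : H1) : (h.pull f).rep = fun y => f.rep (ξ y) := by
  refine H1.rep_eq_of_ae_eq (f.continuous_rep.comp h.continuous) ?_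
  rw [h.pull_fn]
  filter_upwards [h.isExpanding.coeFn_compL2 f.fn, h.isExpanding.ae_comp f.fn_ae_eq_rep]
    with y h1 h2
  rw [h1, h2]

theorem norm_toL2_mul_comp_le (h : IsChart c ξ J) (f : L2) :
    ‖toL2 fun y => f (ξ y) * J y‖ ≤ c⁻¹ ^ 2 * ‖f‖ := by
  have h1 : (toL2 fun y => f (ξ y) * J y) = toL2 fun y => J y * compL2 ξ f y := by
    refine toL2_congr ?_
    filter_upwards [h.isExpanding.coeFn_compL2 f] with y hy
    rw [hy, mul_comm]
  rw [h1, sq, mul_assoc]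
  exact (h.isPinched.norm_mul_le _).trans (mul_le_mul_of_nonneg_left
    (h.isExpanding.norm_compL2_le f) (inv_nonneg.mpr h.isPinched.pos.le))

theorem norm_pull_le (h : IsChart c ξ J) (f : H1) : ‖h.pull f‖ ≤ 2 * c⁻¹ ^ 2 * ‖f‖ := by
  have hc : 1 ≤ c⁻¹ := (one_le_inv₀ h.isPinched.pos).mpr h.isPinched.le_one
  have h1 := (h.pull f).norm_le
  have h2 := h.isExpanding.norm_compL2_le f.fn
  have h3 := h.norm_toL2_mul_comp_le f.dx
  have h4 : c⁻¹ * ‖f.fn‖ ≤ c⁻¹ ^ 2 * ‖f‖ := by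
    have := f.norm_fn_le
    gcongr
    exact le_self_pow₀ hc (by norm_num)
  have h5 : c⁻¹ ^ 2 * ‖f.dx‖ ≤ c⁻¹ ^ 2 * ‖f‖ := by
    have := f.norm_dx_le
    gcongr
  rw [h.pull_fn, h.pull_dx] at h1
  linarith

/-- If `ξ` and `ξ'` are uniformly close, then so are their inverses. -/
theorem abs_inverse_sub_le {ξ' η' : ℝ → ℝ} (h : IsChart c ξ J) (hη : ∀ x, ξ (η x) = x)
    (hη' : ∀ x, ξ' (η' x) = x) {d : ℝ} (hd : ∀ y, |ξ y - ξ' y| ≤ d) (x : ℝ) :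
    |η x - η' x| ≤ c⁻¹ * d := by
  have h1 := h.le_abs_sub (η x) (η' x)
  rw [hη] at h1
  have h2 := hd (η' x)
  rw [hη', abs_sub_comm] at h2
  rw [← div_eq_inv_mul, le_div_iff₀ h.isPinched.pos]
  linarith

end IsChart

/-- The map `y ↦ y + ζ(y)`, for a displacement `ζ ∈ H¹`. -/
def flowMap (ζ : H1) (y : ℝ) : ℝ := y + ζ.rep y

theorem isPrimitive_flowMap (ζ : H1) : IsPrimitive (flowMap ζ) fun y => 1 + ζ.dx y where
  locallyIntegrable := (locallyIntegrable_const 1).add ζ.dx.locallyIntegrable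
  sub_eq a b := by
    rw [intervalIntegral.integral_add (by simp) (ζ.isPrimitive_rep.intervalIntegrable a b),
      ← ζ.isPrimitive_rep.sub_eq]
    simp only [flowMap, intervalIntegral.integral_const, smul_eq_mul, mul_one]
    ring

theorem isChart_flowMap {c : ℝ} (h0 : 0 < c) (h1 : c ≤ 1) {ζ : H1}
    (h2 : ∀ᵐ y, c ≤ 1 + ζ.dx y) (h3 : ∀ᵐ y, 1 + ζ.dx y ≤ c⁻¹) :
    IsChart c (flowMap ζ) fun y => 1 + ζ.dx y :=
  ⟨⟨h0, h1, aestronglyMeasurable_const.add (Lp.aestronglyMeasurable ζ.dx), h2, h3⟩,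
    isPrimitive_flowMap ζ⟩

theorem abs_flowMap_sub_le (ζ ζ' : H1) (y : ℝ) :
    |flowMap ζ y - flowMap ζ' y| ≤ 2 * ‖ζ - ζ'‖ := by
  have := (ζ - ζ').abs_rep_le_norm y
  rw [H1.rep_sub] at this
  rwa [flowMap, flowMap, add_sub_add_left_eq_sub]

/-! ### Differentiating curves in `L²` and `H¹` through their pairings with test functions -/

theorem IsTestFunction.inner_toL2 {φ : ℝ → ℝ} (h : IsTestFunction φ) (g : L2) :
    inner ℝ (toL2 φ) g = ∫ x, g x * φ x := by
  rw [real_inner_comm, inner_toL2_right h.memLp]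

/-- A curve in `L²` that is weakly differentiable, with a continuous derivative, is
differentiable. -/
theorem L2.hasDerivAt_of_test {p r : ℝ → L2} {a b : ℝ} (hr : ContinuousOn r (Ioo a b))
    (h : ∀ φ, IsTestFunction φ → ∀ t ∈ Ioo a b,
      HasDerivAt (fun t => ∫ x, p t x * φ x) (∫ x, r t x * φ x) t)
    {t : ℝ} (ht : t ∈ Ioo a b) : HasDerivAt p (r t) t := by
  have hq : ∀ s ∈ Ioo a b, HasDerivAt (fun s => ∫ τ in t..s, r τ) (r s) s := by
    intro s hs
    have hsub : uIcc t s ⊆ Ioo a b := (convex_Ioo a b).ordConnected.uIcc_subset ht hs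
    refine intervalIntegral.integral_hasDerivAt_right (hr.mono hsub).intervalIntegrable ?_
      (hr.continuousAt (isOpen_Ioo.mem_nhds hs))
    exact hr.stronglyMeasurableAtFilter isOpen_Ioo s hs
  have key : ∀ s ∈ Ioo a b, p s = p t + ∫ τ in t..s, r τ := by
    intro s hs
    refine L2.ext_test fun φ hφ => ?_
    rw [← hφ.inner_toL2, ← hφ.inner_toL2]
    have h1 : ∀ σ ∈ Ioo a b, HasDerivAt
        (fun σ => inner ℝ (toL2 φ) (p σ) - inner ℝ (toL2 φ) (p t + ∫ τ in t..σ, r τ))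
        ((fun _ : ℝ => (0 : ℝ)) σ) σ := by
      intro σ hσ
      have h2 := h φ hφ σ hσ
      simp only [← hφ.inner_toL2] at h2
      have h3 := ((innerSL ℝ (toL2 φ)).hasFDerivAt.comp_hasDerivAt σ
        ((hq σ hσ).const_add (p t)))
      have h5 := h2.sub h3
      rw [innerSL_apply_apply, sub_self] at h5
      exact h5
    have h4 := norm_le_exp_of_norm_deriv_le h1 (K := 0) (by simp) ht hs
    simp only [intervalIntegral.integral_same, add_zero, sub_self, norm_zero, zero_mul,
      norm_le_zero_iff] at h4
    exact sub_eq_zero.mp h4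
  refine ((hq t ht).const_add (p t)).congr_of_eventuallyEq ?_
  filter_upwards [isOpen_Ioo.mem_nhds ht] with s hs using key s hs

/-- A curve in `L²` with bounded weak derivative is Lipschitz. -/
theorem L2.norm_sub_le_of_test {p r : ℝ → L2} {a b C : ℝ} (hC : ∀ t ∈ Ioo a b, ‖r t‖ ≤ C)
    (h : ∀ φ, IsTestFunction φ → ∀ t ∈ Ioo a b,
      HasDerivAt (fun t => ∫ x, p t x * φ x) (∫ x, r t x * φ x) t)
    {s t : ℝ} (hs : s ∈ Ioo a b) (ht : t ∈ Ioo a b) : ‖p t - p s‖ ≤ C * |t - s| := by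
  have hC0 : 0 ≤ C := (norm_nonneg _).trans (hC s hs)
  have := (memLp_of_test_bound (p t - p s).locallyIntegrable (C := C * |t - s|)
    (by positivity) ?_).2
  · rwa [toL2_coeFn] at this
  intro φ hφ
  rw [← hφ.inner_toL2, inner_sub_right, hφ.inner_toL2, hφ.inner_toL2]
  have := (convex_Ioo a b).norm_image_sub_le_of_norm_hasDerivWithin_le
    (f := fun t => ∫ x, p t x * φ x) (C := C * ‖toL2 φ‖)
    (fun τ hτ => (h φ hφ τ hτ).hasDerivWithinAt) ?_ hs ht
  · rw [Real.norm_eq_abs, Real.norm_eq_abs] at this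
    linarith
  · intro τ hτ
    exact (abs_integral_mul_test_le _ hφ).trans
      (mul_le_mul_of_nonneg_right (hC τ hτ) (norm_nonneg _))

namespace H1

theorem integral_dx_mul (f : H1) {φ : ℝ → ℝ} (hφ : IsTestFunction φ) :
    ∫ x, f.dx x * φ x = -∫ x, f.fn x * deriv φ x := by
  rw [f.hasWeakDeriv φ hφ, neg_neg]

theorem hasDerivAt_integral_dx {z w : ℝ → H1} {a b : ℝ}
    (h : ∀ φ, IsTestFunction φ → ∀ t ∈ Ioo a b,
      HasDerivAt (fun t => ∫ x, (z t).fn x * φ x) (∫ x, (w t).fn x * φ x) t) :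
    ∀ φ, IsTestFunction φ → ∀ t ∈ Ioo a b,
      HasDerivAt (fun t => ∫ x, (z t).dx x * φ x) (∫ x, (w t).dx x * φ x) t := by
  intro φ hφ t ht
  simp only [integral_dx_mul _ hφ]
  exact (h _ hφ.deriv t ht).neg

theorem hasDerivAt_iff {z : ℝ → H1} {w : H1} {t : ℝ} : HasDerivAt z w t ↔
    HasDerivAt (fun t => (z t).fn) w.fn t ∧ HasDerivAt (fun t => (z t).dx) w.dx t := by
  refine ⟨fun h => ⟨fnL.hasFDerivAt.comp_hasDerivAt t h, dxL.hasFDerivAt.comp_hasDerivAt t h⟩,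
    fun ⟨h1, h2⟩ => ?_⟩
  rw [hasDerivAt_iff_isLittleO] at h1 h2 ⊢
  refine Asymptotics.IsBigO.trans_isLittleO ?_ (h1.norm_left.add h2.norm_left)
  refine Asymptotics.IsBigO.of_bound 1 (Eventually.of_forall fun s => ?_)
  rw [one_mul]
  refine (norm_le _).trans ?_
  rw [Real.norm_of_nonneg (by positivity)]
  rfl

theorem hasDerivAt_of_test {z w : ℝ → H1} {a b : ℝ} (hw : ContinuousOn w (Ioo a b))
    (h : ∀ φ, IsTestFunction φ → ∀ t ∈ Ioo a b,
      HasDerivAt (fun t => ∫ x, (z t).fn x * φ x) (∫ x, (w t).fn x * φ x) t)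
    {t : ℝ} (ht : t ∈ Ioo a b) : HasDerivAt z (w t) t :=
  hasDerivAt_iff.mpr ⟨L2.hasDerivAt_of_test (fnL.continuous.comp_continuousOn hw) h ht,
    L2.hasDerivAt_of_test (dxL.continuous.comp_continuousOn hw) (hasDerivAt_integral_dx h) ht⟩

theorem norm_sub_le_of_test {z w : ℝ → H1} {a b C : ℝ} (hC : ∀ t ∈ Ioo a b, ‖w t‖ ≤ C)
    (h : ∀ φ, IsTestFunction φ → ∀ t ∈ Ioo a b,
      HasDerivAt (fun t => ∫ x, (z t).fn x * φ x) (∫ x, (w t).fn x * φ x) t)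
    {s t : ℝ} (hs : s ∈ Ioo a b) (ht : t ∈ Ioo a b) : ‖z t - z s‖ ≤ 2 * C * |t - s| := by
  have h1 := L2.norm_sub_le_of_test (fun t ht => (norm_fn_le _).trans (hC t ht)) h hs ht
  have h2 := L2.norm_sub_le_of_test (fun t ht => (norm_dx_le _).trans (hC t ht))
    (hasDerivAt_integral_dx h) hs ht
  have h3 := norm_le (z t - z s)
  rw [fn_sub, dx_sub] at h3
  linarith

end H1

/-- The product rule for `a(t) ∘ θ(t)`, tested against a function `φ`. The map `t ↦ a(t₀) ∘ θ(t)` is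
differentiated pointwise, with derivative `d` at `t₀`. -/
theorem hasDerivAt_integral_compL2 {a : ℝ → L2} {a' : L2} {θ : ℝ → ℝ → ℝ} {f d : ℝ → ℝ}
    {l m t₀ c C : ℝ} {K : ℝ≥0} (ht₀ : t₀ ∈ Ioo l m) (ha : HasDerivAt a a' t₀)
    (hθ : ∀ t ∈ Ioo l m, IsExpanding c (θ t))
    (hC : ∀ s ∈ Ioo l m, ∀ t ∈ Ioo l m, ∀ y, |θ s y - θ t y| ≤ C * |s - t|)
    (hf : LipschitzWith K f) (haf : a t₀ =ᵐ[volume] f)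
    (hdm : AEStronglyMeasurable d volume) (hd : ∀ᵐ y, HasDerivAt (fun t => f (θ t y)) (d y) t₀)
    {φ : ℝ → ℝ} (hφ : IsTestFunction φ) :
    HasDerivAt (fun t => ∫ y, compL2 (θ t) (a t) y * φ y)
      (∫ y, (a' (θ t₀ y) + d y) * φ y) t₀ := by
  have hnhds := isOpen_Ioo.mem_nhds ht₀
  have hC0 : 0 ≤ C := by
    obtain ⟨s, hs, hst⟩ : ∃ s ∈ Ioo l m, s < t₀ := ⟨(l + t₀) / 2, ⟨by linarith [ht₀.1, ht₀.2],
      by linarith [ht₀.1, ht₀.2]⟩, by linarith [ht₀.1]⟩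
    have := (abs_nonneg _).trans (hC s hs t₀ ht₀ 0)
    exact nonneg_of_mul_nonneg_left this (abs_pos.mpr (sub_ne_zero.mpr hst.ne))
  have h1 : HasDerivAt (fun t => inner ℝ (toL2 φ) (compL2 (θ t) (a t - a t₀)))
      (inner ℝ (toL2 φ) (compL2 (θ t₀) a')) t₀ := by
    rw [hasDerivAt_iff_tendsto_slope]
    have h2 : Tendsto (fun t => compL2 (θ t) (slope a t₀ t)) (𝓝[≠] t₀) (𝓝 (compL2 (θ t₀) a')) := by
      refine tendsto_compL2 (c := c) (d := fun t => C * |t - t₀|) ?_ (hθ t₀ ht₀)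
        (hasDerivAt_iff_tendsto_slope.mp ha) ?_ ?_
      · filter_upwards [mem_nhdsWithin_of_mem_nhds hnhds] with t ht using hθ t ht
      · filter_upwards [mem_nhdsWithin_of_mem_nhds hnhds] with t ht using hC t ht t₀ ht₀
      · refine Tendsto.mono_left ?_ nhdsWithin_le_nhds
        have : Continuous fun t => C * |t - t₀| := by fun_prop
        simpa using this.tendsto t₀
    have h3 := ((innerSL ℝ (toL2 φ)).continuous.tendsto _).comp h2
    refine h3.congr' ?_
    filter_upwards [mem_nhdsWithin_of_mem_nhds hnhds] with t ht
    have h4 : compL2 (θ t₀) (a t₀ - a t₀) = 0 := by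
      rw [(hθ t₀ ht₀).compL2_sub, sub_self]
    simp only [Function.comp_apply, slope_def_module, innerSL_apply_apply, h4, inner_zero_right,
      sub_zero, (hθ t ht).compL2_smul, inner_smul_right, smul_eq_mul]
  have hint : ∀ t ∈ Ioo l m, Integrable fun y => f (θ t y) * φ y := by
    intro t ht
    have h5 : (compL2 (θ t) (a t₀)) =ᵐ[volume] fun y => f (θ t y) :=
      ((hθ t ht).coeFn_compL2 _).trans ((hθ t ht).ae_comp haf)
    exact hφ.integrable_mul ((compL2 (θ t) (a t₀)).locallyIntegrable.congr h5)
  obtain ⟨h6, h7⟩ : Integrable (fun y => d y * φ y) ∧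
      HasDerivAt (fun t => ∫ y, f (θ t y) * φ y) (∫ y, d y * φ y) t₀ := by
    refine hasDerivAt_integral_of_dominated_loc_of_lip (s := Ioo l m)
      (bound := fun y => K * C * |φ y|) hnhds ?_ (hint t₀ ht₀) ?_ ?_
      (hφ.integrable.abs.const_mul _) ?_
    · filter_upwards [hnhds] with t ht using (hint t ht).aestronglyMeasurable
    · exact hdm.mul hφ.continuous.aestronglyMeasurable
    · refine Eventually.of_forall fun y => LipschitzOnWith.of_dist_le_mul fun s hs t ht => ?_
      rw [Real.coe_nnabs, Real.dist_eq, Real.dist_eq, ← sub_mul, abs_mul,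
        abs_of_nonneg (by positivity : 0 ≤ K * C * |φ y|)]
      have h8 := hf.dist_le_mul (θ s y) (θ t y)
      rw [Real.dist_eq, Real.dist_eq] at h8
      calc |f (θ s y) - f (θ t y)| * |φ y| ≤ (K * (C * |s - t|)) * |φ y| := by
            gcongr
            exact h8.trans (mul_le_mul_of_nonneg_left (hC s hs t ht y) K.2)
        _ = _ := by ring
    · filter_upwards [hd] with y hy using hy.mul_const _
  have h9 : Integrable fun y => a' (θ t₀ y) * φ y :=
    hφ.integrable_mul ((compL2 (θ t₀) a').locallyIntegrable.congr ((hθ t₀ ht₀).coeFn_compL2 _))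
  have h10 := h1.add h7
  have h11 : inner ℝ (toL2 φ) (compL2 (θ t₀) a') + ∫ y, d y * φ y
      = ∫ y, (a' (θ t₀ y) + d y) * φ y := by
    rw [hφ.inner_toL2]
    simp only [add_mul]
    rw [integral_add h9 h6]
    congr 1
    refine integral_congr_ae ?_
    filter_upwards [(hθ t₀ ht₀).coeFn_compL2 a'] with y hy
    rw [hy]
  rw [h11] at h10
  refine h10.congr_of_eventuallyEq ?_
  filter_upwards [hnhds] with t ht
  rw [Pi.add_apply, (hθ t ht).compL2_sub, inner_sub_right, hφ.inner_toL2, hφ.inner_toL2, eq_comm,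
    sub_add_eq_add_sub, sub_eq_iff_eq_add]
  congr 1
  refine integral_congr_ae ?_
  filter_upwards [(hθ t ht).coeFn_compL2 (a t₀), (hθ t ht).ae_comp haf] with y h1 h2
  rw [h1, h2]

/-! ### The equation as an evolution equation in `L²` -/

namespace H1

theorem memLp_fn_mul_dx (v : H1) : MemLp (fun x => v.fn x * v.dx x) 2 volume :=
  memLp_mul_of_bound (Lp.aestronglyMeasurable _) v.ae_abs_fn_le _

theorem hasWeakDeriv_sq (v : H1) : HasWeakDeriv (toL2 fun x => v.fn x * v.fn x)
    ((2 : ℝ) • toL2 fun x => v.fn x * v.dx x) := by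
  refine (v.isPrimitive_rep.mul v.isPrimitive_rep).hasWeakDeriv ?_ ?_
  · filter_upwards [coeFn_toL2 (memLp_mul_of_bound (Lp.aestronglyMeasurable _) v.ae_abs_fn_le v.fn),
      v.fn_ae_eq_rep] with x h1 h2
    rw [h1, h2]
  · filter_upwards [coeFn_toL2 v.memLp_fn_mul_dx, v.fn_ae_eq_rep,
      Lp.coeFn_smul (2 : ℝ) (toL2 fun x => v.fn x * v.dx x)] with x h1 h2 h3
    rw [h3, Pi.smul_apply, h1, smul_eq_mul, h2]
    ring

end H1

/-- The time derivative of a solution that passes through `v`: it is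
`-v vₓ - ∂ₓ(1 - ∂ₓ²)⁻¹(v² + vₓ²/2 + κ v)` if `|v|, |vₓ| ≤ M`. -/
def eulerField (M κ : ℝ) (v : H1) : L2 :=
  (accel 1 M κ (0, v)).fn - toL2 fun x => v.fn x * v.dx x

theorem density_one_zero : density 1 0 =ᵐ[volume] fun _ => 1 := by
  filter_upwards [Lp.coeFn_zero ℝ 2 (volume : Measure ℝ)] with x hx
  rw [density, H1.dx_zero, hx, Pi.zero_apply, add_zero, pinch_of_mem le_rfl (by norm_num)]

theorem sourceFn_zero_ae {M : ℝ} (κ : ℝ) {v : H1} (h1 : ∀ᵐ x, |v.fn x| ≤ M)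
    (h2 : ∀ᵐ x, |v.dx x| ≤ M) : sourceFn 1 M κ (0, v) =ᵐ[volume]
      fun x => v.fn x ^ 2 + κ * v.fn x + v.dx x ^ 2 / 2 := by
  filter_upwards [density_one_zero, h1, h2] with x h3 h4 h5
  rw [density] at h3
  rw [sourceFn, source, h3, truncate_of_abs_le h4, truncate_of_abs_le h5]
  simp

theorem exists_eulerField (M κ : ℝ) (v : H1) : ∃ P Q : L2,
    IsPotential (density 1 0) (toL2 (sourceFn 1 M κ (0, v))) P Q ∧
    (accel 1 M κ (0, v)).fn = -Q ∧ HasWeakDeriv P Q ∧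
    HasWeakDeriv Q (P - toL2 (sourceFn 1 M κ (0, v))) := by
  obtain ⟨P, Q, h1, h2, -⟩ := exists_potentialForce
    (isPinched_density one_pos le_rfl (0 : H1)) (toL2 (sourceFn 1 M κ (0, v)))
  have h3 (f : L2) : (toL2 fun x => density 1 0 x * f x) = f := by
    refine toL2_eq ?_
    filter_upwards [density_one_zero] with x hx
    rw [hx, one_mul]
  refine ⟨P, Q, h1, h2, ?_, ?_⟩
  · simpa only [h3] using h1.left
  · simpa only [h3] using h1.right

/-- If `P = (1 - ∂ₓ²)⁻¹(v² + κ v + vₓ²/2)` and `Q = ∂ₓP`, then `-Q - v vₓ` satisfies the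
equation for the time derivative. -/
theorem chEquation_of_potential {κ : ℝ} {v : H1} {M : ℝ} (hdx : ∀ᵐ x, |v.dx x| ≤ M) {P Q h : L2}
    (hP : HasWeakDeriv P Q) (hQ : HasWeakDeriv Q (P - h))
    (hh : h =ᵐ[volume] fun x => v.fn x ^ 2 + κ * v.fn x + v.dx x ^ 2 / 2) :
    CHEquation κ v (-Q - toL2 fun x => v.fn x * v.dx x) := by
  intro φ hφ
  set a := toL2 fun x => v.fn x * v.dx x with ha
  set s := toL2 fun x => v.fn x * v.fn x with hs
  set b := toL2 fun x => v.dx x * v.dx x with hb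
  have hb' : b =ᵐ[volume] fun x => v.dx x * v.dx x :=
    coeFn_toL2 (memLp_mul_of_bound (Lp.aestronglyMeasurable _) hdx v.dx)
  have hs' : s =ᵐ[volume] fun x => v.fn x * v.fn x :=
    coeFn_toL2 (memLp_mul_of_bound (Lp.aestronglyMeasurable _) v.ae_abs_fn_le v.fn)
  have hh' : h = s + κ • v.fn + (1 / 2 : ℝ) • b := by
    refine Lp.ext ?_
    filter_upwards [hh, hs', hb', Lp.coeFn_add (s + κ • v.fn) ((1 / 2 : ℝ) • b),
      Lp.coeFn_add s (κ • v.fn), Lp.coeFn_smul κ v.fn, Lp.coeFn_smul (1 / 2 : ℝ) b]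
      with x e1 e2 e3 e4 e5 e6 e7
    rw [e1, e4, Pi.add_apply, e5, Pi.add_apply, e6, e7, Pi.smul_apply, Pi.smul_apply, e2, e3,
      smul_eq_mul, smul_eq_mul]
    ring
  have pa (ψ : ℝ → ℝ) : ∫ x, v.fn x * v.dx x * ψ x = ∫ x, a x * ψ x := integral_congr_ae (by
    filter_upwards [coeFn_toL2 v.memLp_fn_mul_dx] with x hx
    rw [hx])
  have pb (ψ : ℝ → ℝ) : ∫ x, v.dx x ^ 2 * ψ x = ∫ x, b x * ψ x := integral_congr_ae (by
    filter_upwards [hb'] with x hx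
    rw [hx, sq])
  have hφ' := hφ.deriv
  have hφ'' := hφ'.deriv
  have e1 := hQ _ hφ'
  have e2 := hP _ hφ
  have e3 := v.hasWeakDeriv_sq _ hφ
  have e4 := v.hasWeakDeriv _ hφ
  simp only [pa, pb]
  rw [hh'] at e1
  simp only [← hφ.inner_toL2, ← hφ'.inner_toL2, ← hφ''.inner_toL2, inner_sub_right,
    inner_add_right, inner_smul_right, inner_neg_right, ← ha, ← hs] at *
  rw [e1, e2, e3, e4]
  ring

theorem chEquation_eulerField {M κ : ℝ} (hM : 0 ≤ M) {v : H1} (h1 : ∀ᵐ x, |v.fn x| ≤ M)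
    (h2 : ∀ᵐ x, |v.dx x| ≤ M) : CHEquation κ v (eulerField M κ v) := by
  obtain ⟨P, Q, -, e, hP, hQ⟩ := exists_eulerField M κ v
  rw [eulerField, e]
  exact chEquation_of_potential h2 hP hQ ((coeFn_toL2
    (memLp_sourceFn κ one_pos le_rfl hM _)).trans (sourceFn_zero_ae κ h1 h2))

/-- The equation determines the time derivative, because `1 - ∂ₓ²` is injective on `L²`. -/
theorem CHEquation.unique {κ : ℝ} {v : H1} {w w' : L2} (h : CHEquation κ v w)
    (h' : CHEquation κ v w') : w = w' := by
  refine sub_eq_zero.mp (L2.eq_zero_of_test fun φ hφ => ?_)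
  have e1 := h φ hφ
  have e2 := h' φ hφ
  have hφ'' := hφ.deriv.deriv
  have e3 : ∫ x, (w - w' : L2) x * (φ x - deriv (deriv φ) x)
      = (∫ x, (w - w' : L2) x * φ x) - ∫ x, (w - w' : L2) x * deriv (deriv φ) x := by
    rw [← integral_sub (hφ.integrable_mul (L2.locallyIntegrable _))
      (hφ''.integrable_mul (L2.locallyIntegrable _))]
    simp only [mul_sub]
  rw [e3]
  simp only [← hφ.inner_toL2 w, ← hφ''.inner_toL2 w, ← hφ.inner_toL2 w', ← hφ''.inner_toL2 w',
    ← hφ.inner_toL2 (w - w'), ← hφ''.inner_toL2 (w - w'), inner_sub_right] at *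
  linarith

theorem chEquation_iff {M κ : ℝ} (hM : 0 ≤ M) {v : H1} (h1 : ∀ᵐ x, |v.fn x| ≤ M)
    (h2 : ∀ᵐ x, |v.dx x| ≤ M) {w : L2} : CHEquation κ v w ↔ w = eulerField M κ v :=
  ⟨fun h => h.unique (chEquation_eulerField hM h1 h2),
    fun h => h ▸ chEquation_eulerField hM h1 h2⟩

theorem norm_eulerField_sub_le {M : ℝ} (κ : ℝ) (hM : 0 ≤ M) {v w : H1} (h1 : ∀ᵐ x, |v.fn x| ≤ M)
    (h2 : ∀ᵐ x, |w.dx x| ≤ M) :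
    ‖eulerField M κ v - eulerField M κ w‖ ≤ (accelConst 1 M κ ‖w‖ + 2 * M) * ‖v - w‖ := by
  have e1 : ‖accel 1 M κ (0, v) - accel 1 M κ (0, w)‖ ≤ accelConst 1 M κ ‖w‖ * ‖v - w‖ := by
    refine (norm_accel_sub_le κ one_pos le_rfl hM (0, v) (w := (0, w)) (ρ := ‖w‖)
      (by simp [Prod.norm_def])).trans_eq ?_
    simp [Prod.norm_def]
  have e2 : ‖(toL2 fun x => v.fn x * v.dx x) - toL2 fun x => w.fn x * w.dx x‖
      ≤ M * (‖(v - w).fn‖ + ‖(v - w).dx‖ + ‖(0 : L2)‖) := by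
    refine norm_le_of_abs_le hM ?_
    filter_upwards [h1, h2, coeFn_toL2 v.memLp_fn_mul_dx, coeFn_toL2 w.memLp_fn_mul_dx,
      Lp.coeFn_sub (toL2 fun x => v.fn x * v.dx x) (toL2 fun x => w.fn x * w.dx x),
      Lp.coeFn_sub v.fn w.fn, Lp.coeFn_sub v.dx w.dx] with x a1 a2 a3 a4 a5 a6 a7
    rw [a5, Pi.sub_apply, a3, a4, H1.fn_sub, H1.dx_sub, a6, a7, Pi.sub_apply, Pi.sub_apply,
      show v.fn x * v.dx x - w.fn x * w.dx x
        = w.dx x * (v.fn x - w.fn x) + v.fn x * (v.dx x - w.dx x) by ring]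
    refine (abs_add_le _ _).trans ?_
    rw [abs_mul, abs_mul, mul_add, mul_add]
    have := mul_nonneg hM (abs_nonneg ((0 : L2) x))
    have := mul_le_mul_of_nonneg_right a2 (abs_nonneg (v.fn x - w.fn x))
    have := mul_le_mul_of_nonneg_right a1 (abs_nonneg (v.dx x - w.dx x))
    linarith
  have e3 := (v - w).norm_fn_le
  have e4 := (v - w).norm_dx_le
  have e5 := (accel 1 M κ (0, v) - accel 1 M κ (0, w)).norm_fn_le
  rw [norm_zero, add_zero] at e2
  have e6 := mul_le_mul_of_nonneg_left (add_le_add e3 e4) hM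
  rw [eulerField, eulerField, sub_sub_sub_comm]
  refine (norm_sub_le _ _).trans ?_
  rw [← H1.fn_sub]
  linarith

theorem continuousOn_eulerField {M : ℝ} (κ : ℝ) (hM : 0 ≤ M) {u : ℝ → H1} {s : Set ℝ}
    (hu : ContinuousOn u s) (h1 : ∀ t ∈ s, ∀ᵐ x, |(u t).fn x| ≤ M)
    (h2 : ∀ t ∈ s, ∀ᵐ x, |(u t).dx x| ≤ M) : ContinuousOn (fun t => eulerField M κ (u t)) s := by
  intro t ht
  refine tendsto_iff_norm_sub_tendsto_zero.mpr ?_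
  have h3 := (tendsto_iff_norm_sub_tendsto_zero.mp (hu t ht)).const_mul
    (accelConst 1 M κ ‖u t‖ + 2 * M)
  rw [mul_zero] at h3
  refine squeeze_zero' (Eventually.of_forall fun _ => norm_nonneg _) ?_ h3
  filter_upwards [self_mem_nhdsWithin] with τ hτ
  exact norm_eulerField_sub_le κ hM (h1 τ hτ) (h2 t ht)

/-- The nonlocal term in Lagrangian coordinates is the transport of the Eulerian one: the system of
`IsPotential` is invariant under changes of variables. -/
theorem accel_pull {c M M' κ : ℝ} {ξ : ℝ → ℝ} {ζ : H1} (h : IsChart c ξ fun y => 1 + ζ.dx y)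
    (hM : 0 ≤ M) (hM' : 0 ≤ M') {u : H1} (h1 : ∀ᵐ x, |u.fn x| ≤ M') (h2 : ∀ᵐ x, |u.dx x| ≤ M')
    (h3 : ∀ᵐ x, |(h.pull u).fn x| ≤ M) (h4 : ∀ᵐ x, |(h.pull u).dx x| ≤ M) :
    (accel c M κ (ζ, h.pull u)).fn = compL2 ξ (accel 1 M' κ (0, u)).fn := by
  obtain ⟨P, Q, -, e, hP, hQ⟩ := exists_eulerField M' κ u
  have c0 := h.isPinched.pos
  have c1 := h.isPinched.le_one
  have hd : density c ζ =ᵐ[volume] fun y => 1 + ζ.dx y := by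
    filter_upwards [h.isPinched.lower, h.isPinched.upper] with y a1 a2 using pinch_of_mem a1 a2
  have hx := h.isExpanding
  have hpot : IsPotential (density c ζ) (toL2 (sourceFn c M κ (ζ, h.pull u)))
      (compL2 ξ P) (compL2 ξ Q) := by
    refine ⟨?_, ?_⟩
    · convert h.hasWeakDeriv_comp hP using 1
      refine toL2_congr ?_
      filter_upwards [hd, hx.coeFn_compL2 Q] with y a1 a2
      rw [a1, a2, mul_comm]
    · convert h.hasWeakDeriv_comp hQ using 1
      refine Lp.ext ?_
      have hS := (coeFn_toL2 (memLp_sourceFn κ one_pos le_rfl hM' (0, u))).trans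
        (sourceFn_zero_ae κ h1 h2)
      filter_upwards [hd, hx.coeFn_compL2 P,
        Lp.coeFn_sub (toL2 fun y => density c ζ y * compL2 ξ P y)
        (toL2 (sourceFn c M κ (ζ, h.pull u))), coeFn_toL2 (h.memLp_mul_comp
        (P - toL2 (sourceFn 1 M' κ (0, u)))), coeFn_toL2 (memLp_sourceFn κ c0 c1 hM (ζ, h.pull u)),
        hx.ae_comp hS, hx.ae_comp (Lp.coeFn_sub P (toL2 (sourceFn 1 M' κ (0, u)))), h3, h4,
        coeFn_toL2 ((isPinched_density c0 c1 ζ).memLp_mul (compL2 ξ P)),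
        coeFn_toL2 (h.memLp_mul_comp u.dx), hx.coeFn_compL2 u.fn, h.isPinched.lower]
        with y a1 a2 a3 a4 a5 a6 a7 a8 a9 a10 a11 a12 a13
      rw [h.pull_fn] at a8
      rw [h.pull_dx] at a9
      have hJ : (1 + ζ.dx y) ≠ 0 := (c0.trans_le a13).ne'
      rw [a3, Pi.sub_apply, a10, a5, a4, a7, Pi.sub_apply, a6, sourceFn, source]
      simp only [h.pull_fn, h.pull_dx]
      rw [truncate_of_abs_le a8, truncate_of_abs_le a9, a11, a12, a2, ← density, a1]
      field_simp
  rw [accel, potentialForce_fn (isPinched_density c0 c1 _) hpot, e]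
  refine Lp.ext ?_
  filter_upwards [hx.coeFn_compL2 Q, hx.coeFn_compL2 (-Q), hx.ae_comp (Lp.coeFn_neg Q),
    Lp.coeFn_neg (compL2 ξ Q)] with y a1 a2 a3 a4
  rw [a4, a2, a3, Pi.neg_apply, Pi.neg_apply, a1]

/-! ### From Lagrangian to Eulerian coordinates -/

theorem H1.tendsto_iff {ι : Type*} {l : Filter ι} {z : ι → H1} {w : H1} :
    Tendsto z l (𝓝 w) ↔ Tendsto (fun i => (z i).fn) l (𝓝 w.fn) ∧
      Tendsto (fun i => (z i).dx) l (𝓝 w.dx) := by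
  refine ⟨fun h => ⟨(H1.fnL.continuous.tendsto w).comp h, (H1.dxL.continuous.tendsto w).comp h⟩,
    fun ⟨h1, h2⟩ => ?_⟩
  rw [tendsto_iff_norm_sub_tendsto_zero] at h1 h2 ⊢
  have h3 := h1.add h2
  rw [add_zero] at h3
  exact squeeze_zero (fun _ => norm_nonneg _) (fun i => (z i - w).norm_le) h3

theorem H1.rep_zero : (0 : H1).rep = fun _ => 0 :=
  rep_eq_of_ae_eq continuous_const (Lp.coeFn_zero ℝ 2 volume)

theorem H1.ext_rep {f g : H1} (h : f.rep = g.rep) : f = g :=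
  H1.ext' (Lp.ext (f.fn_ae_eq_rep.trans (h ▸ g.fn_ae_eq_rep.symm)))

theorem H1.lipschitzWith_rep {f : H1} {M : ℝ} (hM : 0 ≤ M) (h : ∀ᵐ x, |f.dx x| ≤ M) :
    LipschitzWith M.toNNReal f.rep := by
  refine LipschitzWith.of_dist_le_mul fun x y => ?_
  rw [Real.coe_toNNReal _ hM, Real.dist_eq, Real.dist_eq, f.isPrimitive_rep.sub_eq y x]
  exact intervalIntegral.norm_integral_le_of_norm_le_const_ae (f := f.dx)
    (h.mono fun x hx _ => hx)

theorem contDiffOn_one_of_hasDerivAt {E : Type*} [NormedAddCommGroup E] [NormedSpace ℝ E]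
    {f f' : ℝ → E} {a b : ℝ} (h : ∀ t ∈ Ioo a b, HasDerivAt f (f' t) t)
    (hc : ContinuousOn f' (Ioo a b)) : ContDiffOn ℝ 1 f (Ioo a b) := by
  rw [show (1 : WithTop ℕ∞) = 0 + 1 by simp, contDiffOn_succ_iff_deriv_of_isOpen isOpen_Ioo]
  refine ⟨fun t ht => (h t ht).differentiableAt.differentiableWithinAt, by simp, ?_⟩
  rw [contDiffOn_zero]
  exact hc.congr fun t ht => (h t ht).deriv

/-- A solution `z = (ξ - id, U)` of the Camassa–Holm equation in Lagrangian coordinates, along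
which none of the truncations is active. -/
structure IsLagrangian (c M κ T : ℝ) (z : ℝ → H1 × H1) : Prop where
  pos : 0 < c
  le_one : c ≤ 1
  hasDerivAt : ∀ t ∈ Ioo (-T) T, HasDerivAt z (lagrangeField c M κ (z t)) t
  norm_le : ∀ t ∈ Ioo (-T) T, ‖z t‖ ≤ M
  lower : ∀ t ∈ Ioo (-T) T, ∀ᵐ y, c ≤ 1 + (z t).1.dx y
  upper : ∀ t ∈ Ioo (-T) T, ∀ᵐ y, 1 + (z t).1.dx y ≤ c⁻¹
  abs_fn_le : ∀ t ∈ Ioo (-T) T, ∀ᵐ y, |(z t).2.fn y| ≤ M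
  abs_dx_le : ∀ t ∈ Ioo (-T) T, ∀ᵐ y, |(z t).2.dx y| ≤ M

namespace IsLagrangian

variable {c M κ T t : ℝ} {z : ℝ → H1 × H1} {η : ℝ → ℝ}

theorem isChart (h : IsLagrangian c M κ T z) (ht : t ∈ Ioo (-T) T) :
    IsChart c (flowMap (z t).1) fun y => 1 + (z t).1.dx y :=
  isChart_flowMap h.pos h.le_one (h.lower t ht) (h.upper t ht)

theorem hasDerivAt_fst (h : IsLagrangian c M κ T z) (ht : t ∈ Ioo (-T) T) :
    HasDerivAt (fun t => (z t).1) (z t).2 t :=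
  (hasFDerivAt_fst (𝕜 := ℝ) (E := H1) (F := H1) (p := z t)).comp_hasDerivAt t (h.hasDerivAt t ht)

theorem hasDerivAt_snd (h : IsLagrangian c M κ T z) (ht : t ∈ Ioo (-T) T) :
    HasDerivAt (fun t => (z t).2) (accel c M κ (z t)) t :=
  (hasFDerivAt_snd (𝕜 := ℝ) (E := H1) (F := H1) (p := z t)).comp_hasDerivAt t (h.hasDerivAt t ht)

theorem nonneg (h : IsLagrangian c M κ T z) (ht : t ∈ Ioo (-T) T) : 0 ≤ M :=
  (norm_nonneg _).trans (h.norm_le t ht)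

theorem norm_fst_sub_le (h : IsLagrangian c M κ T z) {s : ℝ} (hs : s ∈ Ioo (-T) T)
    (ht : t ∈ Ioo (-T) T) : ‖(z s).1 - (z t).1‖ ≤ M * |s - t| := by
  have := (convex_Ioo (-T) T).norm_image_sub_le_of_norm_hasDerivWithin_le
    (fun τ hτ => (h.hasDerivAt_fst hτ).hasDerivWithinAt)
    (fun τ hτ => (norm_snd_le (z τ)).trans (h.norm_le τ hτ)) ht hs
  simpa [Real.norm_eq_abs] using this

end IsLagrangian

/-- The inverse of the change of variables `ξ`. -/
def invMap (ξ : ℝ → ℝ) : ℝ → ℝ := Function.invFun ξ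

theorem IsChart.apply_invMap {c : ℝ} {ξ J : ℝ → ℝ} (h : IsChart c ξ J) (x : ℝ) :
    ξ (invMap ξ x) = x := Function.rightInverse_invFun h.surjective x

theorem IsChart.invMap_apply {c : ℝ} {ξ J : ℝ → ℝ} (h : IsChart c ξ J) (y : ℝ) :
    invMap ξ (ξ y) = y := h.leftInverse h.apply_invMap y

theorem IsChart.isChart_invMap {c : ℝ} {ξ J : ℝ → ℝ} (h : IsChart c ξ J) :
    IsChart c (invMap ξ) fun x => (J (invMap ξ x))⁻¹ := h.inverse h.apply_invMap

/-- The velocity `u = U ∘ ξ⁻¹` in Eulerian coordinates (and `0` if `ξ` is not invertible). -/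
def eulerian (c : ℝ) (z : H1 × H1) : H1 :=
  open Classical in
  if h : IsChart c (flowMap z.1) fun y => 1 + z.1.dx y then h.isChart_invMap.pull z.2 else 0

theorem eulerian_eq {c : ℝ} {z : H1 × H1} (h : IsChart c (flowMap z.1) fun y => 1 + z.1.dx y) :
    eulerian c z = h.isChart_invMap.pull z.2 := dif_pos h

theorem pull_eulerian {c : ℝ} {z : H1 × H1} (h : IsChart c (flowMap z.1) fun y => 1 + z.1.dx y) :
    h.pull (eulerian c z) = z.2 := by
  refine H1.ext_rep ?_
  rw [h.pull_rep, eulerian_eq h, IsChart.pull_rep]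
  funext y
  exact congrArg _ (h.invMap_apply y)

/-- The `x`-derivative of the Eulerian velocity, in Lagrangian coordinates. -/
def lagrangianSlope (z : H1 × H1) : L2 := toL2 fun y => (1 + z.1.dx y)⁻¹ * z.2.dx y

theorem coeFn_lagrangianSlope {c : ℝ} {z : H1 × H1}
    (h : IsChart c (flowMap z.1) fun y => 1 + z.1.dx y) :
    lagrangianSlope z =ᵐ[volume] fun y => (1 + z.1.dx y)⁻¹ * z.2.dx y :=
  coeFn_toL2 (h.isPinched.inv.memLp_mul z.2.dx)

theorem eulerian_dx {c : ℝ} {z : H1 × H1} (h : IsChart c (flowMap z.1) fun y => 1 + z.1.dx y) :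
    (eulerian c z).dx = compL2 (invMap (flowMap z.1)) (lagrangianSlope z) := by
  rw [eulerian_eq h, IsChart.pull_dx]
  refine toL2_congr ?_
  filter_upwards [h.isChart_invMap.isExpanding.ae_comp (coeFn_lagrangianSlope h)] with x hx
  rw [hx, mul_comm]

theorem eulerian_fn {c : ℝ} {z : H1 × H1} (h : IsChart c (flowMap z.1) fun y => 1 + z.1.dx y) :
    (eulerian c z).fn = compL2 (invMap (flowMap z.1)) z.2.fn := by
  rw [eulerian_eq h, IsChart.pull_fn]

theorem abs_inv_sub_inv_le {c a b : ℝ} (hc : 0 < c) (ha : c ≤ a) (hb : c ≤ b) :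
    |a⁻¹ - b⁻¹| ≤ c⁻¹ ^ 2 * |a - b| := by
  have ha' := hc.trans_le ha
  have hb' := hc.trans_le hb
  rw [inv_sub_inv ha'.ne' hb'.ne', abs_div, abs_of_pos (mul_pos ha' hb'), abs_sub_comm,
    div_eq_inv_mul, inv_pow, sq]
  gcongr

theorem norm_lagrangianSlope_sub_le {c M : ℝ} {z w : H1 × H1}
    (hz : IsChart c (flowMap z.1) fun y => 1 + z.1.dx y)
    (hw : IsChart c (flowMap w.1) fun y => 1 + w.1.dx y) (hM : 0 ≤ M)
    (hb : ∀ᵐ y, |w.2.dx y| ≤ M) :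
    ‖lagrangianSlope z - lagrangianSlope w‖ ≤ c⁻¹ ^ 2 * (1 + M) * (2 * ‖z - w‖) := by
  have hc := hz.isPinched.pos
  have hc1 := (one_le_inv₀ hc).mpr hz.isPinched.le_one
  have e : ‖lagrangianSlope z - lagrangianSlope w‖
      ≤ c⁻¹ ^ 2 * (1 + M) * (‖(z.1 - w.1).dx‖ + ‖(z.2 - w.2).dx‖ + ‖(0 : L2)‖) := by
    refine norm_le_of_abs_le (by positivity) ?_
    filter_upwards [hb, hz.isPinched.lower, hw.isPinched.lower, coeFn_lagrangianSlope hz,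
      coeFn_lagrangianSlope hw, Lp.coeFn_sub (lagrangianSlope z) (lagrangianSlope w),
      Lp.coeFn_sub z.1.dx w.1.dx, Lp.coeFn_sub z.2.dx w.2.dx] with y a1 a2 a3 a4 a5 a6 a7 a8
    rw [a6, Pi.sub_apply, a4, a5, H1.dx_sub, H1.dx_sub, a7, a8, Pi.sub_apply, Pi.sub_apply]
    have e1 := abs_inv_sub_inv_le hc a2 a3
    rw [add_sub_add_left_eq_sub] at e1
    have e2 : |(1 + z.1.dx y)⁻¹| ≤ c⁻¹ ^ 2 := by
      rw [abs_of_pos (inv_pos.mpr (hc.trans_le a2))]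
      refine (inv_anti₀ hc a2).trans ?_
      nlinarith
    rw [show (1 + z.1.dx y)⁻¹ * z.2.dx y - (1 + w.1.dx y)⁻¹ * w.2.dx y
      = (1 + z.1.dx y)⁻¹ * (z.2.dx y - w.2.dx y)
        + ((1 + z.1.dx y)⁻¹ - (1 + w.1.dx y)⁻¹) * w.2.dx y by ring]
    refine (abs_add_le _ _).trans ?_
    rw [abs_mul, abs_mul]
    have e3 := mul_le_mul_of_nonneg_right e2 (abs_nonneg (z.2.dx y - w.2.dx y))
    have e4 := mul_le_mul e1 a1 (abs_nonneg _) (by positivity)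
    have e5 : 0 ≤ c⁻¹ ^ 2 * (1 + M) * |(0 : L2) y| := by positivity
    have e6 : 0 ≤ c⁻¹ ^ 2 * M * |z.2.dx y - w.2.dx y| := by positivity
    have e7 : 0 ≤ c⁻¹ ^ 2 * |z.1.dx y - w.1.dx y| := by positivity
    nlinarith
  refine e.trans (mul_le_mul_of_nonneg_left ?_ (by positivity))
  rw [norm_zero, add_zero]
  have := (z.1 - w.1).norm_dx_le
  have := (z.2 - w.2).norm_dx_le
  have := norm_fst_le (z - w)
  have := norm_snd_le (z - w)
  simp only [Prod.fst_sub, Prod.snd_sub] at *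
  linarith

theorem abs_invMap_flowMap_sub_le {c : ℝ} {z w : H1 × H1}
    (hz : IsChart c (flowMap z.1) fun y => 1 + z.1.dx y)
    (hw : IsChart c (flowMap w.1) fun y => 1 + w.1.dx y) (x : ℝ) :
    |invMap (flowMap z.1) x - invMap (flowMap w.1) x| ≤ c⁻¹ * (2 * ‖z.1 - w.1‖) :=
  hz.abs_inverse_sub_le hz.apply_invMap hw.apply_invMap (abs_flowMap_sub_le _ _) x

namespace IsLagrangian

variable {c M κ T t : ℝ} {z : ℝ → H1 × H1}

theorem continuousOn (h : IsLagrangian c M κ T z) : ContinuousOn z (Ioo (-T) T) :=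
  fun t ht => (h.hasDerivAt t ht).continuousAt.continuousWithinAt

theorem ae_abs_eulerian_fn_le (h : IsLagrangian c M κ T z) (ht : t ∈ Ioo (-T) T) :
    ∀ᵐ x, |(eulerian c (z t)).fn x| ≤ M := by
  have hi := (h.isChart ht).isChart_invMap.isExpanding
  rw [eulerian_fn (h.isChart ht)]
  filter_upwards [hi.coeFn_compL2 (z t).2.fn, hi.ae_comp (h.abs_fn_le t ht)] with x h1 h2
  rwa [h1]

theorem ae_abs_eulerian_dx_le (h : IsLagrangian c M κ T z) (ht : t ∈ Ioo (-T) T) :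
    ∀ᵐ x, |(eulerian c (z t)).dx x| ≤ c⁻¹ * M := by
  have hi := (h.isChart ht).isChart_invMap.isExpanding
  rw [eulerian_dx (h.isChart ht)]
  filter_upwards [hi.coeFn_compL2 (lagrangianSlope (z t)), hi.ae_comp (h.abs_dx_le t ht),
    hi.ae_comp (coeFn_lagrangianSlope (h.isChart ht)), hi.ae_comp (h.lower t ht)] with x h1 h2 h3 h4
  have hc := h.pos
  rw [h1, h3, abs_mul, abs_of_pos (inv_pos.mpr (h.pos.trans_le h4))]
  gcongr

theorem norm_eulerian_le (h : IsLagrangian c M κ T z) (ht : t ∈ Ioo (-T) T) :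
    ‖eulerian c (z t)‖ ≤ 2 * c⁻¹ ^ 2 * M := by
  rw [eulerian_eq (h.isChart ht)]
  refine (IsChart.norm_pull_le _ _).trans ?_
  have := (norm_snd_le (z t)).trans (h.norm_le t ht)
  gcongr

theorem continuousOn_eulerian (h : IsLagrangian c M κ T z) :
    ContinuousOn (fun t => eulerian c (z t)) (Ioo (-T) T) := by
  intro t ht
  have hz := h.continuousOn t ht
  have hch : ∀ᶠ s in 𝓝[Ioo (-T) T] t, IsChart c (flowMap (z s).1) fun y => 1 + (z s).1.dx y := by
    filter_upwards [self_mem_nhdsWithin] with s hs using h.isChart hs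
  have hexp : ∀ᶠ s in 𝓝[Ioo (-T) T] t, IsExpanding c (invMap (flowMap (z s).1)) :=
    hch.mono fun s hs => hs.isChart_invMap.isExpanding
  have hdist : ∀ᶠ s in 𝓝[Ioo (-T) T] t, ∀ x,
      |invMap (flowMap (z s).1) x - invMap (flowMap (z t).1) x| ≤ c⁻¹ * (2 * ‖(z s).1 - (z t).1‖) :=
    hch.mono fun s hs => abs_invMap_flowMap_sub_le hs (h.isChart ht)
  have hdist0 : Tendsto (fun s => c⁻¹ * (2 * ‖(z s).1 - (z t).1‖)) (𝓝[Ioo (-T) T] t) (𝓝 0) := by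
    have := ((tendsto_iff_norm_sub_tendsto_zero.mp ((continuous_fst.tendsto _).comp hz)).const_mul
      2).const_mul c⁻¹
    simpa using this
  have hcomp {a : ℝ → L2} (ha : Tendsto a (𝓝[Ioo (-T) T] t) (𝓝 (a t))) :
      Tendsto (fun s => compL2 (invMap (flowMap (z s).1)) (a s)) (𝓝[Ioo (-T) T] t)
        (𝓝 (compL2 (invMap (flowMap (z t).1)) (a t))) :=
    tendsto_compL2 hexp (h.isChart ht).isChart_invMap.isExpanding ha hdist hdist0
  refine H1.tendsto_iff.mpr ⟨?_, ?_⟩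
  · rw [eulerian_fn (h.isChart ht)]
    refine (hcomp (a := fun s => (z s).2.fn) ((H1.fnL.continuous.tendsto _).comp
      ((continuous_snd.tendsto _).comp hz))).congr' ?_
    exact hch.mono fun s hs => (eulerian_fn hs).symm
  · rw [eulerian_dx (h.isChart ht)]
    have hs : Tendsto (fun s => lagrangianSlope (z s)) (𝓝[Ioo (-T) T] t)
        (𝓝 (lagrangianSlope (z t))) := by
      refine tendsto_iff_norm_sub_tendsto_zero.mpr ?_
      have h3 := ((tendsto_iff_norm_sub_tendsto_zero.mp hz).const_mul 2).const_mul
        (c⁻¹ ^ 2 * (1 + M))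
      rw [mul_zero, mul_zero] at h3
      refine squeeze_zero' (Eventually.of_forall fun _ => norm_nonneg _) ?_ h3
      exact hch.mono fun s hs =>
        norm_lagrangianSlope_sub_le hs (h.isChart ht) (h.nonneg ht) (h.abs_dx_le t ht)
    refine (hcomp hs).congr' ?_
    exact hch.mono fun s hs => (eulerian_dx hs).symm

/-- Along a Lagrangian solution the inverse flow map satisfies `∂ₜ(ξ_{t₀} ∘ ξ_t⁻¹) = -u` at
`t = t₀`. -/
theorem hasDerivAt_flowMap_invMap (h : IsLagrangian c M κ T z) (ht : t ∈ Ioo (-T) T) (x : ℝ) :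
    HasDerivAt (fun s => flowMap (z t).1 (invMap (flowMap (z s).1) x))
      (-(eulerian c (z t)).rep x) t := by
  have hη : Tendsto (fun s => invMap (flowMap (z s).1) x) (𝓝 t)
      (𝓝 (invMap (flowMap (z t).1) x)) := by
    refine tendsto_iff_norm_sub_tendsto_zero.mpr ?_
    have hd0 : Tendsto (fun s => c⁻¹ * (2 * ‖(z s).1 - (z t).1‖)) (𝓝 t) (𝓝 0) := by
      have := ((tendsto_iff_norm_sub_tendsto_zero.mp
        (h.hasDerivAt_fst ht).continuousAt.tendsto).const_mul 2).const_mul c⁻¹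
      simpa using this
    refine squeeze_zero' (Eventually.of_forall fun _ => norm_nonneg _) ?_ hd0
    filter_upwards [isOpen_Ioo.mem_nhds ht] with s hs
    exact abs_invMap_flowMap_sub_le (h.isChart hs) (h.isChart ht) x
  have hslope := hasDerivAt_iff_tendsto_slope.mp (h.hasDerivAt_fst ht)
  rw [hasDerivAt_iff_tendsto_slope]
  -- `ξ_t (η_s x) = x - (ζ_s - ζ_t) (η_s x)`
  have e1 : Tendsto (fun s => (slope (fun s => (z s).1) t s).rep (invMap (flowMap (z s).1) x))
      (𝓝[≠] t) (𝓝 ((z t).2.rep (invMap (flowMap (z t).1) x))) := by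
    have a1 := ((z t).2.continuous_rep.tendsto _).comp
      (hη.mono_left (nhdsWithin_le_nhds (s := {t}ᶜ)))
    have a2 := ((tendsto_iff_norm_sub_tendsto_zero.mp hslope).const_mul 2)
    rw [mul_zero] at a2
    have a3 : Tendsto (fun s => (slope (fun s => (z s).1) t s - (z t).2).rep
        (invMap (flowMap (z s).1) x)) (𝓝[≠] t) (𝓝 0) :=
      squeeze_zero_norm (fun s => H1.abs_rep_le_norm _ _) a2
    have a4 := a3.add a1
    rw [zero_add] at a4
    refine a4.congr fun s => ?_
    rw [H1.rep_sub, Function.comp_apply, sub_add_cancel]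
  rw [eulerian_eq (h.isChart ht), IsChart.pull_rep]
  refine e1.neg.congr' ?_
  filter_upwards [mem_nhdsWithin_of_mem_nhds (isOpen_Ioo.mem_nhds ht)] with s hs
  have b1 := (h.isChart hs).apply_invMap x
  rw [slope_def_module, slope_def_module, smul_eq_mul, H1.rep_smul, H1.rep_sub,
    (h.isChart ht).apply_invMap]
  simp only [flowMap] at b1 ⊢
  rw [← mul_neg]
  congr 1
  linarith

/-- The Eulerian velocity of a Lagrangian solution satisfies the evolution equation in `L²`. -/
theorem hasDerivAt_eulerian_fn (h : IsLagrangian c M κ T z) (ht : t ∈ Ioo (-T) T) :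
    HasDerivAt (fun t => (eulerian c (z t)).fn)
      (eulerField (c⁻¹ * M) κ (eulerian c (z t))) t := by
  have hM := h.nonneg ht
  have hc := h.pos
  have hc1 := (one_le_inv₀ hc).mpr h.le_one
  have hM' : M ≤ c⁻¹ * M := le_mul_of_one_le_left hM hc1
  have hfn : ∀ t ∈ Ioo (-T) T, ∀ᵐ x, |(eulerian c (z t)).fn x| ≤ c⁻¹ * M := fun t ht =>
    (h.ae_abs_eulerian_fn_le ht).mono fun x hx => hx.trans hM'
  have hdx : ∀ t ∈ Ioo (-T) T, ∀ᵐ x, |(eulerian c (z t)).dx x| ≤ c⁻¹ * M := fun t ht =>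
    h.ae_abs_eulerian_dx_le ht
  refine L2.hasDerivAt_of_test (continuousOn_eulerField κ (by positivity) h.continuousOn_eulerian
    hfn hdx) (fun φ hφ t ht => ?_) ht
  have hch := h.isChart ht
  set u := eulerian c (z t) with hu
  have hpull : hch.pull u = (z t).2 := pull_eulerian hch
  have hrep : (z t).2.rep = fun y => u.rep (flowMap (z t).1 y) := by rw [← hpull, hch.pull_rep]
  have key := hasDerivAt_integral_compL2 (a := fun t => (z t).2.fn)
    (θ := fun s => invMap (flowMap (z s).1)) (f := (z t).2.rep) (d := fun x => u.dx x * -u.rep x)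
    (c := c) (C := c⁻¹ * (2 * M)) ht (H1.hasDerivAt_iff.mp (h.hasDerivAt_snd ht)).1
    (fun s hs => (h.isChart hs).isChart_invMap.isExpanding) ?_
    (H1.lipschitzWith_rep hM (h.abs_dx_le t ht)) (z t).2.fn_ae_eq_rep ?_ ?_ hφ
  · have e1 : ∫ y, ((accel c M κ (z t)).fn (invMap (flowMap (z t).1) y) + u.dx y * -u.rep y) * φ y
        = ∫ x, eulerField (c⁻¹ * M) κ u x * φ x := by
      refine integral_congr_ae ?_
      have e2 : (accel c M κ (z t)).fn
          = compL2 (flowMap (z t).1) (accel 1 (c⁻¹ * M) κ (0, u)).fn := by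
        have := accel_pull (κ := κ) hch hM (by positivity) (hfn t ht) (hdx t ht)
          (by rw [hpull]; exact h.abs_fn_le t ht) (by rw [hpull]; exact h.abs_dx_le t ht)
        rwa [hpull] at this
      filter_upwards [hch.isChart_invMap.isExpanding.ae_comp (hch.isExpanding.coeFn_compL2
        (accel 1 (c⁻¹ * M) κ (0, u)).fn), Lp.coeFn_sub (accel 1 (c⁻¹ * M) κ (0, u)).fn
        (toL2 fun x => u.fn x * u.dx x), coeFn_toL2 u.memLp_fn_mul_dx, u.fn_ae_eq_rep]
        with x a1 a2 a3 a4
      rw [e2, a1, hch.apply_invMap, eulerField, a2, Pi.sub_apply, a3, a4]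
      ring
    rw [e1] at key
    refine key.congr_of_eventuallyEq ?_
    filter_upwards [isOpen_Ioo.mem_nhds ht] with s hs
    rw [eulerian_fn (h.isChart hs)]
  · intro s hs s' hs' y
    refine (abs_invMap_flowMap_sub_le (h.isChart hs) (h.isChart hs') y).trans ?_
    rw [mul_assoc, mul_assoc]
    have := h.norm_fst_sub_le hs hs'
    gcongr
  · exact (Lp.aestronglyMeasurable _).mul u.continuous_rep.aestronglyMeasurable.neg
  · filter_upwards [u.isPrimitive_rep.ae_hasDerivAt] with x hx
    rw [hrep]
    have hx' : HasDerivAt u.rep (u.dx x) (flowMap (z t).1 (invMap (flowMap (z t).1) x)) := by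
      rwa [hch.apply_invMap]
    exact hx'.comp t (h.hasDerivAt_flowMap_invMap ht x)

end IsLagrangian

theorem eulerian_zero {c : ℝ} (h0 : 0 < c) (h1 : c ≤ 1) (u₀ : H1) : eulerian c (0, u₀) = u₀ := by
  have hz : ∀ᵐ y, (1 : ℝ) + (0 : H1).dx y = 1 := by
    filter_upwards [Lp.coeFn_zero ℝ 2 (volume : Measure ℝ)] with y hy
    rw [H1.dx_zero, hy, Pi.zero_apply, add_zero]
  have hch : IsChart c (flowMap (0, u₀).1) fun y => 1 + (0 : H1).dx y := by
    refine isChart_flowMap h0 h1 ?_ ?_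
    · filter_upwards [hz] with y hy
      rwa [hy]
    · filter_upwards [hz] with y hy
      rw [hy]
      exact (one_le_inv₀ h0).mpr h1
  refine H1.ext_rep ?_
  have e : (fun y => (eulerian c (0, u₀)).rep (flowMap 0 y)) = u₀.rep := by
    rw [← hch.pull_rep, pull_eulerian hch]
  rw [← e]
  funext y
  rw [flowMap, H1.rep_zero, add_zero]

/-! ### Bounds in `X`, and existence of solutions -/

theorem ae_abs_le_of_eLpNorm_top_le {f : ℝ → ℝ} {r : ℝ≥0} (h : eLpNorm f ⊤ volume ≤ r) :
    ∀ᵐ x, |f x| ≤ r := by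
  rw [eLpNorm_exponent_top] at h
  filter_upwards [ae_le_eLpNormEssSup (f := f) (μ := volume)] with x hx
  have := hx.trans h
  rw [← ofReal_norm, Real.norm_eq_abs] at this
  exact (ENNReal.ofReal_le_coe).mp this

theorem eLpNorm_top_le_of_ae_abs_le {f : ℝ → ℝ} {r : ℝ} (h : ∀ᵐ x, |f x| ≤ r) :
    eLpNorm f ⊤ volume ≤ ENNReal.ofReal r := by
  rw [eLpNorm_exponent_top]
  exact eLpNormEssSup_le_of_ae_bound h

theorem bounds_of_normX_le {u : H1} {r : ℝ≥0} (h : normX u ≤ r) :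
    ‖u‖ ≤ r ∧ (∀ᵐ x, |u.fn x| ≤ r) ∧ ∀ᵐ x, |u.dx x| ≤ r := by
  refine ⟨?_, ae_abs_le_of_eLpNorm_top_le ?_, ae_abs_le_of_eLpNorm_top_le ?_⟩
  · have h1 : ‖u‖ₑ ≤ r := le_self_add.trans h
    rw [← ofReal_norm] at h1
    exact ENNReal.ofReal_le_coe.mp h1
  · exact (le_self_add.trans (le_add_self (a := normW1inf u) (b := ‖u‖ₑ))).trans h
  · exact (le_add_self.trans (le_add_self (a := normW1inf u) (b := ‖u‖ₑ))).trans h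

theorem normX_le {u : H1} {A B D : ℝ} (h1 : ‖u‖ ≤ A) (h2 : ∀ᵐ x, |u.fn x| ≤ B)
    (h3 : ∀ᵐ x, |u.dx x| ≤ D) (hB : 0 ≤ B) (hD : 0 ≤ D) :
    normX u ≤ ENNReal.ofReal (A + (B + D)) := by
  rw [ENNReal.ofReal_add ((norm_nonneg _).trans h1) (add_nonneg hB hD), ENNReal.ofReal_add hB hD]
  refine add_le_add ?_
    (add_le_add (eLpNorm_top_le_of_ae_abs_le h2) (eLpNorm_top_le_of_ae_abs_le h3))
  rw [← ofReal_norm]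
  exact ENNReal.ofReal_le_ofReal h1

theorem normW1inf_le {u : H1} {B D : ℝ} (h2 : ∀ᵐ x, |u.fn x| ≤ B)
    (h3 : ∀ᵐ x, |u.dx x| ≤ D) : normW1inf u ≤ (B.toNNReal + D.toNNReal : ℝ≥0) := by
  rw [ENNReal.coe_add]
  exact add_le_add (eLpNorm_top_le_of_ae_abs_le h2) (eLpNorm_top_le_of_ae_abs_le h3)

theorem isClosed_ae_abs_le (C : ℝ) : IsClosed {f : L2 | ∀ᵐ x, |f x| ≤ C} := by
  have : {f : L2 | ∀ᵐ x, |f x| ≤ C} = ⋂ s : {s : Set ℝ // MeasurableSet s ∧ volume s < ∞},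
      {f : L2 | |∫ x in (s : Set ℝ), f x| ≤ C * volume.real (s : Set ℝ)} := by
    ext f
    simp only [mem_ofPred_eq, mem_iInter]
    exact ⟨fun h s => abs_setIntegral_le_of_ae_abs_le h s.2.2,
      fun h => ae_abs_le_of_setIntegral_le fun s hs hs' => h ⟨s, hs, hs'⟩⟩
  rw [this]
  refine isClosed_iInter fun s => isClosed_le ?_ continuous_const
  have h (f : L2) : ∫ x in (s : Set ℝ), f x
      = inner ℝ (indicatorConstLp 2 s.2.1 s.2.2.ne (1 : ℝ)) f :=
    (L2.inner_indicatorConstLp_one s.2.1 s.2.2.ne f).symm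
  simp only [h]
  fun_prop

/-- In the class `Z_T` the bound in `W^{1,∞}` holds at every time, because balls of `L^∞` are closed
in `L²`. -/
theorem MemZ.exists_bound {T : ℝ} {u : ℝ → H1} (h : MemZ T u) (hT : 0 < T) :
    ∃ M : ℝ, 0 ≤ M ∧ ∀ t ∈ Icc (-T) T,
      ‖u t‖ ≤ M ∧ (∀ᵐ x, |(u t).fn x| ≤ M) ∧ ∀ᵐ x, |(u t).dx x| ≤ M := by
  obtain ⟨N, hN⟩ := isCompact_Icc.exists_bound_of_continuousOn h.continuousOn_H1
  obtain ⟨C, hC⟩ := h.bounded_W1inf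
  set S := {t | t ∈ Icc (-T) T ∧ normW1inf (u t) ≤ C} with hS
  have hdense : Icc (-T) T ⊆ closure S := by
    intro t ht
    by_contra hcon
    have hopen : IsOpen ((closure S)ᶜ) := isClosed_closure.isOpen_compl
    have ht' : t ∈ closure (Ioo (-T) T) := by rwa [closure_Ioo (by linarith : -T ≠ T)]
    have hne : ((closure S)ᶜ ∩ Ioo (-T) T).Nonempty := mem_closure_iff.mp ht' _ hopen hcon
    have hpos := (hopen.inter isOpen_Ioo).measure_pos (volume : Measure ℝ) hne
    rw [ae_restrict_iff' measurableSet_Icc] at hC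
    refine hpos.ne' (measure_mono_null ?_ hC)
    intro s hs hs'
    exact hs.1 (subset_closure ⟨Ioo_subset_Icc_self hs.2, hs' (Ioo_subset_Icc_self hs.2)⟩)
  have hclosed : IsClosed ({v : H1 | ∀ᵐ x, |v.fn x| ≤ C} ∩ {v : H1 | ∀ᵐ x, |v.dx x| ≤ C}) :=
    ((isClosed_ae_abs_le C).preimage H1.fnL.continuous).inter
      ((isClosed_ae_abs_le C).preimage H1.dxL.continuous)
  refine ⟨max N C, le_max_of_le_right C.2, fun t ht => ?_⟩
  have h1 : u t ∈ closure ({v : H1 | ∀ᵐ x, |v.fn x| ≤ C} ∩ {v : H1 | ∀ᵐ x, |v.dx x| ≤ C}) := by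
    refine ((h.continuousOn_H1 t ht).mono fun s hs => hs.1).mem_closure (hdense ht) fun s hs => ?_
    exact ⟨ae_abs_le_of_eLpNorm_top_le (le_self_add.trans hs.2),
      ae_abs_le_of_eLpNorm_top_le (le_add_self.trans hs.2)⟩
  rw [hclosed.closure_eq] at h1
  have h2 : ∀ᵐ x, |(u t).fn x| ≤ C := h1.1
  have h3 : ∀ᵐ x, |(u t).dx x| ≤ C := h1.2
  exact ⟨(hN t ht).trans (le_max_left _ _), h2.mono fun x hx => hx.trans (le_max_right _ _),
    h3.mono fun x hx => hx.trans (le_max_right _ _)⟩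

theorem MemZ.mono {T T' : ℝ} {u : ℝ → H1} (h : MemZ T u) (hT : T' ≤ T) : MemZ T' u where
  continuousOn_H1 := h.continuousOn_H1.mono (Icc_subset_Icc (neg_le_neg hT) hT)
  bounded_W1inf := by
    obtain ⟨C, hC⟩ := h.bounded_W1inf
    exact ⟨C, ae_restrict_of_ae_restrict_of_subset (Icc_subset_Icc (neg_le_neg hT) hT) hC⟩
  contDiffOn_L2 := h.contDiffOn_L2.mono (Ioo_subset_Ioo (neg_le_neg hT) hT)

theorem IsSolution.mono {κ T T' : ℝ} {u₀ : H1} {u : ℝ → H1} (h : IsSolution κ T u₀ u)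
    (hT : T' ≤ T) : IsSolution κ T' u₀ u where
  memZ := h.memZ.mono hT
  initial := h.initial
  equation t ht := h.equation t (Ioo_subset_Ioo (neg_le_neg hT) hT ht)

/-- A curve along which `∂ₜu = -u uₓ - ∂ₓ(1 - ∂ₓ²)⁻¹(u² + uₓ²/2 + κ u)` is a solution. -/
theorem isSolution_of_hasDerivAt {κ T M : ℝ} (hM : 0 ≤ M) {u : ℝ → H1}
    (hu : ContinuousOn u (Icc (-T) T)) (h1 : ∀ t ∈ Icc (-T) T, ∀ᵐ x, |(u t).fn x| ≤ M)
    (h2 : ∀ t ∈ Icc (-T) T, ∀ᵐ x, |(u t).dx x| ≤ M)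
    (h : ∀ t ∈ Ioo (-T) T, HasDerivAt (fun t => (u t).fn) (eulerField M κ (u t)) t) :
    IsSolution κ T (u 0) u where
  memZ :=
    { continuousOn_H1 := hu
      bounded_W1inf := ⟨M.toNNReal + M.toNNReal, by
        filter_upwards [ae_restrict_mem measurableSet_Icc] with t ht
        exact normW1inf_le (h1 t ht) (h2 t ht)⟩
      contDiffOn_L2 := contDiffOn_one_of_hasDerivAt h
        ((continuousOn_eulerField κ hM hu h1 h2).mono Ioo_subset_Icc_self) }
  initial := rfl
  equation t ht := by
    have ht' := Ioo_subset_Icc_self ht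
    rw [dt, (h t ht).deriv]
    exact chEquation_eulerField hM (h1 t ht') (h2 t ht')

theorem IsSolution.dt_eq {κ T M t : ℝ} {u₀ : H1} {u : ℝ → H1} (h : IsSolution κ T u₀ u)
    (hM : 0 ≤ M) (ht : t ∈ Ioo (-T) T) (h1 : ∀ᵐ x, |(u t).fn x| ≤ M)
    (h2 : ∀ᵐ x, |(u t).dx x| ≤ M) : dt u t = eulerField M κ (u t) :=
  (chEquation_iff hM h1 h2).mp (h.equation t ht)

theorem IsSolution.hasDerivAt {κ T M t : ℝ} {u₀ : H1} {u : ℝ → H1} (h : IsSolution κ T u₀ u)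
    (hM : 0 ≤ M) (ht : t ∈ Ioo (-T) T) (h1 : ∀ᵐ x, |(u t).fn x| ≤ M)
    (h2 : ∀ᵐ x, |(u t).dx x| ≤ M) :
    HasDerivAt (fun t => (u t).fn) (eulerField M κ (u t)) t := by
  rw [← h.dt_eq hM ht h1 h2]
  exact ((h.memZ.contDiffOn_L2.differentiableOn (by norm_num)).differentiableAt
    (isOpen_Ioo.mem_nhds ht)).hasDerivAt

theorem IsLagrangian.isSolution {c M κ T T' : ℝ} {z : ℝ → H1 × H1} (h : IsLagrangian c M κ T z)
    (hM : 0 ≤ M) (hT : T' < T) :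
    IsSolution κ T' (eulerian c (z 0)) fun t => eulerian c (z t) := by
  have hsub : Icc (-T') T' ⊆ Ioo (-T) T := Icc_subset_Ioo (neg_lt_neg hT) hT
  have hc := h.pos
  have hM' : M ≤ c⁻¹ * M := le_mul_of_one_le_left hM ((one_le_inv₀ hc).mpr h.le_one)
  refine isSolution_of_hasDerivAt (M := c⁻¹ * M) (by positivity) (h.continuousOn_eulerian.mono hsub)
    (fun t ht => (h.ae_abs_eulerian_fn_le (hsub ht)).mono fun x hx => hx.trans hM')
    (fun t ht => h.ae_abs_eulerian_dx_le (hsub ht)) fun t ht =>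
    h.hasDerivAt_eulerian_fn (hsub (Ioo_subset_Icc_self ht))

theorem exists_solution (κ : ℝ) (R : ℝ≥0) : ∃ T > 0, ∀ u₀ : H1, normX u₀ ≤ R →
    ∃ u, IsSolution κ T u₀ u ∧ ∀ t ∈ Icc (-T) T, normX (u t) ≤ 22 * normX u₀ := by
  obtain ⟨T, hT, h⟩ := exists_lagrangian κ (R := R) R.2
  refine ⟨T / 2, by positivity, fun u₀ hu₀ => ?_⟩
  obtain ⟨r, hr⟩ : ∃ r : ℝ≥0, normX u₀ = r :=
    ⟨_, (ENNReal.coe_toNNReal (hu₀.trans_lt ENNReal.coe_lt_top).ne).symm⟩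
  have hrR : (r : ℝ) ≤ R := by
    rw [hr] at hu₀
    exact_mod_cast hu₀
  obtain ⟨b1, b2, b3⟩ := bounds_of_normX_le hr.le
  obtain ⟨z, hz0, hz⟩ := h r r.2 hrR u₀ b1 b2 b3
  have hL : IsLagrangian (1 / 2) (2 * r) κ T z :=
    { pos := by norm_num
      le_one := by norm_num
      hasDerivAt := fun t ht => (hz t ht).1
      norm_le := fun t ht => (hz t ht).2.1
      lower := fun t ht => (hz t ht).2.2.1.mono fun y hy => by linarith [(abs_le.mp hy).1]
      upper := fun t ht => (hz t ht).2.2.1.mono fun y hy => by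
        norm_num
        linarith [(abs_le.mp hy).2]
      abs_fn_le := fun t ht => (hz t ht).2.2.2.1
      abs_dx_le := fun t ht => (hz t ht).2.2.2.2 }
  have hsol := hL.isSolution (T' := T / 2) (by positivity) (by linarith)
  rw [hz0, eulerian_zero (by norm_num) (by norm_num)] at hsol
  refine ⟨_, hsol, fun t ht => ?_⟩
  have ht' : t ∈ Ioo (-T) T := ⟨by linarith [ht.1], by linarith [ht.2]⟩
  refine (normX_le (hL.norm_eulerian_le ht') (hL.ae_abs_eulerian_fn_le ht')
    (hL.ae_abs_eulerian_dx_le ht') (by positivity) (by positivity)).trans_eq ?_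
  -- the norms of `u` in `H¹`, of `u` in `L^∞` and of `∂ₓu` in `L^∞` are `≤ 16 r, 2 r, 4 r`
  rw [hr, show 2 * (1 / 2 : ℝ)⁻¹ ^ 2 * (2 * r) + (2 * r + (1 / 2 : ℝ)⁻¹ * (2 * r))
      = (22 * r : ℝ≥0) by
    push_cast
    ring, ENNReal.ofReal_coe_nnreal, ENNReal.coe_mul]
  rfl

/-! ### From Eulerian to Lagrangian coordinates -/

/-- `v` solves the equation on `[-T, T]` and `‖v‖_{1,2}, |v|, |vₓ| ≤ M` there. -/
structure IsEulerian (M κ T : ℝ) (v : ℝ → H1) : Prop where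
  time_pos : 0 < T
  nonneg : 0 ≤ M
  continuousOn : ContinuousOn v (Icc (-T) T)
  hasDerivAt : ∀ t ∈ Ioo (-T) T, HasDerivAt (fun t => (v t).fn) (eulerField M κ (v t)) t
  norm_le : ∀ t ∈ Icc (-T) T, ‖v t‖ ≤ M
  abs_fn_le : ∀ t ∈ Icc (-T) T, ∀ᵐ x, |(v t).fn x| ≤ M
  abs_dx_le : ∀ t ∈ Icc (-T) T, ∀ᵐ x, |(v t).dx x| ≤ M

theorem IsSolution.isEulerian {M κ T : ℝ} {u₀ : H1} {v : ℝ → H1} (h : IsSolution κ T u₀ v)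
    (hT : 0 < T) (hM : 0 ≤ M) (hb : ∀ t ∈ Icc (-T) T,
      ‖v t‖ ≤ M ∧ (∀ᵐ x, |(v t).fn x| ≤ M) ∧ ∀ᵐ x, |(v t).dx x| ≤ M) : IsEulerian M κ T v where
  time_pos := hT
  nonneg := hM
  continuousOn := h.memZ.continuousOn_H1
  hasDerivAt t ht := h.hasDerivAt hM ht (hb t (Ioo_subset_Icc_self ht)).2.1
    (hb t (Ioo_subset_Icc_self ht)).2.2
  norm_le t ht := (hb t ht).1
  abs_fn_le t ht := (hb t ht).2.1
  abs_dx_le t ht := (hb t ht).2.2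

theorem H1.abs_rep_le_of_ae {f : H1} {M : ℝ} (h : ∀ᵐ x, |f.fn x| ≤ M) (x : ℝ) :
    |f.rep x| ≤ M := by
  have h1 : ∀ᵐ x, |f.rep x| ≤ M := by
    filter_upwards [h, f.fn_ae_eq_rep] with x h1 h2
    rwa [← h2]
  have h2 : IsClosed {x | |f.rep x| ≤ M} := isClosed_le f.continuous_rep.abs continuous_const
  have h3 := (Measure.dense_of_ae h1).closure_eq
  rw [h2.closure_eq] at h3
  have h4 : x ∈ {x | |f.rep x| ≤ M} := h3 ▸ mem_univ x
  exact h4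

/-- The difference quotients of `ξ` control its density. -/
theorem IsPrimitive.isChart {c : ℝ} {ξ J : ℝ → ℝ} (h : IsPrimitive ξ J) (hc : 0 < c) (hc1 : c ≤ 1)
    (h1 : ∀ a b, a ≤ b → c * (b - a) ≤ ξ b - ξ a)
    (h2 : ∀ a b, a ≤ b → ξ b - ξ a ≤ c⁻¹ * (b - a)) : IsChart c ξ J := by
  have key : ∀ x y, y ≠ x → c ≤ slope ξ x y ∧ slope ξ x y ≤ c⁻¹ := by
    intro x y hxy
    rcases lt_or_gt_of_ne hxy with hlt | hgt
    · have hp : 0 < x - y := sub_pos.mpr hlt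
      rw [slope_comm, slope_def_field, le_div_iff₀ hp, div_le_iff₀ hp]
      exact ⟨h1 _ _ hlt.le, h2 _ _ hlt.le⟩
    · have hp : 0 < y - x := sub_pos.mpr hgt
      rw [slope_def_field, le_div_iff₀ hp, div_le_iff₀ hp]
      exact ⟨h1 _ _ hgt.le, h2 _ _ hgt.le⟩
  refine ⟨⟨hc, hc1, h.locallyIntegrable.aestronglyMeasurable, ?_, ?_⟩, h⟩
  · filter_upwards [h.ae_hasDerivAt] with x hx
    refine ge_of_tendsto (hasDerivAt_iff_tendsto_slope.mp hx) ?_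
    filter_upwards [self_mem_nhdsWithin] with y hy using (key x y hy).1
  · filter_upwards [h.ae_hasDerivAt] with x hx
    refine le_of_tendsto (hasDerivAt_iff_tendsto_slope.mp hx) ?_
    filter_upwards [self_mem_nhdsWithin] with y hy using (key x y hy).2

theorem IsChart.pull_injective {c : ℝ} {ξ J : ℝ → ℝ} (h : IsChart c ξ J) {f g : H1}
    (hfg : h.pull f = h.pull g) : f = g := by
  refine H1.ext_rep (funext fun x => ?_)
  obtain ⟨y, rfl⟩ := h.surjective x
  have := congrArg H1.rep hfg
  rw [h.pull_rep, h.pull_rep] at this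
  exact congrFun this y

/-- `ξ` is the flow of the time-dependent velocity field `v` on `(-T, T)`. -/
structure IsFlow (T : ℝ) (v : ℝ → H1) (ξ : ℝ → ℝ → ℝ) : Prop where
  zero : ∀ y, ξ 0 y = y
  hasDerivAt : ∀ t ∈ Ioo (-T) T, ∀ y, HasDerivAt (fun t => ξ t y) ((v t).rep (ξ t y)) t

namespace IsEulerian

variable {M κ T t : ℝ} {v : ℝ → H1} {ξ : ℝ → ℝ → ℝ}

theorem lipschitzWith_rep (h : IsEulerian M κ T v) (ht : t ∈ Icc (-T) T) :
    LipschitzWith M.toNNReal (v t).rep := H1.lipschitzWith_rep h.nonneg (h.abs_dx_le t ht)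

theorem abs_rep_le (h : IsEulerian M κ T v) (ht : t ∈ Icc (-T) T) (x : ℝ) : |(v t).rep x| ≤ M :=
  H1.abs_rep_le_of_ae (h.abs_fn_le t ht) x

theorem exists_isFlow (h : IsEulerian M κ T v) : ∃ ξ, IsFlow T v ξ := by
  have h0 : (0 : ℝ) ∈ Icc (-T) T := ⟨by linarith [h.time_pos], h.time_pos.le⟩
  have key : ∀ y : ℝ, ∃ α : ℝ → ℝ, α 0 = y ∧ ∀ t ∈ Icc (-T) T,
      HasDerivWithinAt α ((v t).rep (α t)) (Icc (-T) T) t := by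
    intro y
    have hPL : IsPicardLindelof (fun t => (v t).rep) (tmin := -T) (tmax := T) ⟨0, h0⟩ y
        (M * T).toNNReal 0 M.toNNReal M.toNNReal := by
      refine ⟨fun t ht => (h.lipschitzWith_rep ht).lipschitzOnWith, fun x _ t ht => ?_,
        fun t ht x _ => ?_, ?_⟩
      · refine tendsto_iff_norm_sub_tendsto_zero.mpr ?_
        have h3 := (tendsto_iff_norm_sub_tendsto_zero.mp (h.continuousOn t ht)).const_mul 2
        rw [mul_zero] at h3
        refine squeeze_zero (fun _ => norm_nonneg _) (fun s => ?_) h3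
        rw [← H1.rep_sub]
        exact H1.abs_rep_le_norm _ _
      · rw [Real.coe_toNNReal _ h.nonneg]
        exact h.abs_rep_le ht x
      · rw [Real.coe_toNNReal _ h.nonneg, Real.coe_toNNReal _ (mul_nonneg h.nonneg h.time_pos.le)]
        simp
    exact hPL.exists_eq_forall_mem_Icc_hasDerivWithinAt₀
  choose α hα0 hα using key
  exact ⟨fun t y => α y t, hα0, fun t ht y =>
    (hα y t (Ioo_subset_Icc_self ht)).hasDerivAt (Icc_mem_nhds ht.1 ht.2)⟩

theorem zero_mem (h : IsEulerian M κ T v) : (0 : ℝ) ∈ Ioo (-T) T :=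
  ⟨by linarith [h.time_pos], h.time_pos⟩

theorem abs_flow_sub_le (h : IsEulerian M κ T v) (hξ : IsFlow T v ξ) {s t : ℝ}
    (hs : s ∈ Ioo (-T) T) (ht : t ∈ Ioo (-T) T) (y : ℝ) : |ξ s y - ξ t y| ≤ M * |s - t| := by
  have := (convex_Ioo (-T) T).norm_image_sub_le_of_norm_hasDerivWithin_le
    (f := fun t => ξ t y) (fun τ hτ => (hξ.hasDerivAt τ hτ y).hasDerivWithinAt)
    (fun τ hτ => h.abs_rep_le (Ioo_subset_Icc_self hτ) _) ht hs
  simpa [Real.norm_eq_abs] using this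

theorem abs_flow_sub_flow_le (h : IsEulerian M κ T v) (hξ : IsFlow T v ξ) {s t : ℝ}
    (hs : s ∈ Ioo (-T) T) (ht : t ∈ Ioo (-T) T) (a b : ℝ) :
    |ξ t a - ξ t b| ≤ |ξ s a - ξ s b| * Real.exp (M * |t - s|) := by
  refine norm_le_exp_of_norm_deriv_le (f := fun t => ξ t a - ξ t b)
    (fun τ hτ => (hξ.hasDerivAt τ hτ a).sub (hξ.hasDerivAt τ hτ b)) (fun τ hτ => ?_) hs ht
  have := (h.lipschitzWith_rep (Ioo_subset_Icc_self hτ)).dist_le_mul (ξ τ a) (ξ τ b)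
  rwa [Real.coe_toNNReal _ h.nonneg] at this

theorem exp_mul_abs_le (h : IsEulerian M κ T v) (ht : t ∈ Ioo (-T) T) :
    Real.exp (M * |t|) ≤ (Real.exp (-(M * T)))⁻¹ := by
  rw [Real.exp_neg, inv_inv]
  exact Real.exp_le_exp.mpr (mul_le_mul_of_nonneg_left (abs_lt.mpr ht).le h.nonneg)

/-- Particles do not cross: two that meet have always been together, by Grönwall's inequality. -/
theorem flow_sub_nonneg (h : IsEulerian M κ T v) (hξ : IsFlow T v ξ) (ht : t ∈ Ioo (-T) T)
    {a b : ℝ} (hab : a ≤ b) : 0 ≤ ξ t b - ξ t a := by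
  rcases hab.eq_or_lt with rfl | hab
  · rw [sub_self]
  by_contra! hneg
  have hcont : ContinuousOn (fun t => ξ t b - ξ t a) (Ioo (-T) T) := fun τ hτ =>
    ((hξ.hasDerivAt τ hτ b).sub (hξ.hasDerivAt τ hτ a)).continuousAt.continuousWithinAt
  obtain ⟨τ, hτ, h0⟩ := isPreconnected_Ioo.intermediate_value ht h.zero_mem hcont
    (show (0 : ℝ) ∈ Icc _ _ from ⟨hneg.le, by simp only [hξ.zero]; linarith⟩)
  have := h.abs_flow_sub_flow_le hξ hτ h.zero_mem b a
  rw [show ξ τ b - ξ τ a = 0 from h0, hξ.zero, hξ.zero, abs_zero, zero_mul] at this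
  linarith [abs_nonpos_iff.mp this]

theorem le_flow_sub (h : IsEulerian M κ T v) (hξ : IsFlow T v ξ) (ht : t ∈ Ioo (-T) T)
    (a b : ℝ) (hab : a ≤ b) : Real.exp (-(M * T)) * (b - a) ≤ ξ t b - ξ t a := by
  have h1 := h.abs_flow_sub_flow_le hξ ht h.zero_mem b a
  rw [hξ.zero, hξ.zero, abs_of_nonneg (sub_nonneg.mpr hab),
    abs_of_nonneg (h.flow_sub_nonneg hξ ht hab), zero_sub, abs_neg] at h1
  have h2 := h1.trans (mul_le_mul_of_nonneg_left (h.exp_mul_abs_le ht)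
    (h.flow_sub_nonneg hξ ht hab))
  rwa [← div_eq_mul_inv, le_div_iff₀ (Real.exp_pos _), mul_comm] at h2

theorem flow_sub_le (h : IsEulerian M κ T v) (hξ : IsFlow T v ξ) (ht : t ∈ Ioo (-T) T)
    (a b : ℝ) (hab : a ≤ b) : ξ t b - ξ t a ≤ (Real.exp (-(M * T)))⁻¹ * (b - a) := by
  have h1 := h.abs_flow_sub_flow_le hξ h.zero_mem ht b a
  rw [hξ.zero, hξ.zero, abs_of_nonneg (sub_nonneg.mpr hab),
    abs_of_nonneg (h.flow_sub_nonneg hξ ht hab), sub_zero] at h1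
  rw [mul_comm]
  exact h1.trans (mul_le_mul_of_nonneg_left (h.exp_mul_abs_le ht) (sub_nonneg.mpr hab))

theorem exp_le_one (h : IsEulerian M κ T v) : Real.exp (-(M * T)) ≤ 1 :=
  Real.exp_le_one_iff.mpr (neg_nonpos.mpr (mul_nonneg h.nonneg h.time_pos.le))

theorem isChart_flow (h : IsEulerian M κ T v) (hξ : IsFlow T v ξ) (ht : t ∈ Ioo (-T) T) :
    IsChart (Real.exp (-(M * T))) (ξ t) (deriv (ξ t)) := by
  have hlip : LipschitzWith (Real.exp (-(M * T)))⁻¹.toNNReal (ξ t) := by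
    refine LipschitzWith.of_dist_le_mul fun a b => ?_
    rw [Real.coe_toNNReal _ (by positivity), Real.dist_eq, Real.dist_eq, mul_comm]
    have := h.abs_flow_sub_flow_le hξ h.zero_mem ht a b
    rw [hξ.zero, hξ.zero, sub_zero] at this
    exact this.trans (mul_le_mul_of_nonneg_left (h.exp_mul_abs_le ht) (abs_nonneg _))
  exact (IsPrimitive.of_lipschitz hlip).isChart (Real.exp_pos _) h.exp_le_one
    (h.le_flow_sub hξ ht) (h.flow_sub_le hξ ht)

theorem hasDerivAt_integral_flow (h : IsEulerian M κ T v) (hξ : IsFlow T v ξ) {φ : ℝ → ℝ}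
    (hφ : IsTestFunction φ) (ht : t ∈ Ioo (-T) T) :
    HasDerivAt (fun t => ∫ y, (ξ t y - y) * φ y) (∫ y, compL2 (ξ t) (v t).fn y * φ y) t := by
  have hch := h.isChart_flow hξ ht
  have e : ∫ y, compL2 (ξ t) (v t).fn y * φ y = ∫ y, (v t).rep (ξ t y) * φ y := by
    refine integral_congr_ae ?_
    filter_upwards [hch.isExpanding.coeFn_compL2 (v t).fn,
      hch.isExpanding.ae_comp (v t).fn_ae_eq_rep] with y h1 h2
    rw [h1, h2]
  rw [e]
  have hcont : ∀ s ∈ Ioo (-T) T, Continuous fun y => ξ s y - y := fun s hs =>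
    (h.isChart_flow hξ hs).continuous.sub continuous_id
  refine (hasDerivAt_integral_of_dominated_loc_of_lip (s := Ioo (-T) T)
      (bound := fun y => M * |φ y|) (isOpen_Ioo.mem_nhds ht) ?_
      (hφ.integrable_mul (hcont t ht).locallyIntegrable) ?_ ?_
      (hφ.integrable.abs.const_mul _) ?_).2
  · filter_upwards [isOpen_Ioo.mem_nhds ht] with s hs
    exact ((hcont s hs).mul hφ.continuous).aestronglyMeasurable
  · exact (((v t).continuous_rep.comp hch.continuous).mul hφ.continuous).aestronglyMeasurable
  · refine Eventually.of_forall fun y => LipschitzOnWith.of_dist_le_mul fun s hs r hr => ?_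
    rw [Real.coe_nnabs, Real.dist_eq, Real.dist_eq, ← sub_mul, abs_mul,
      abs_of_nonneg (mul_nonneg h.nonneg (abs_nonneg (φ y))), sub_sub_sub_cancel_right,
      mul_right_comm]
    exact mul_le_mul_of_nonneg_right (h.abs_flow_sub_le hξ hs hr y) (abs_nonneg _)
  · exact Eventually.of_forall fun y => ((hξ.hasDerivAt t ht y).sub_const y).mul_const _

end IsEulerian

/-- A family of functions `g t` that vanishes at `t = 0` and has a time derivative bounded in `L²`,
in the sense of pairings with test functions, consists of `L²` functions. -/
theorem memLp_of_hasDerivAt_integral {g : ℝ → ℝ → ℝ} {r : ℝ → L2} {T C t : ℝ} (hT : 0 < T)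
    (hg : ∀ y, g 0 y = 0) (hgt : LocallyIntegrable (g t) volume)
    (hr : ∀ t ∈ Ioo (-T) T, ‖r t‖ ≤ C)
    (h : ∀ φ, IsTestFunction φ → ∀ t ∈ Ioo (-T) T,
      HasDerivAt (fun t => ∫ y, g t y * φ y) (∫ y, r t y * φ y) t) (ht : t ∈ Ioo (-T) T) :
    MemLp (g t) 2 volume := by
  have hC : 0 ≤ C := (norm_nonneg _).trans (hr t ht)
  refine (memLp_of_test_bound hgt (C := C * T) (by positivity) fun φ hφ => ?_).1
  have h0 : (0 : ℝ) ∈ Ioo (-T) T := ⟨by linarith, hT⟩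
  have := (convex_Ioo (-T) T).norm_image_sub_le_of_norm_hasDerivWithin_le
    (f := fun t => ∫ y, g t y * φ y) (C := C * ‖toL2 φ‖)
    (fun τ hτ => (h φ hφ τ hτ).hasDerivWithinAt) (fun τ hτ => ?_) h0 ht
  · simp only [hg, zero_mul, integral_zero, sub_zero, Real.norm_eq_abs] at this
    refine this.trans ?_
    rw [mul_right_comm]
    have := (abs_lt.mpr ht).le
    gcongr
  · exact (abs_integral_mul_test_le _ hφ).trans
      (mul_le_mul_of_nonneg_right (hr τ hτ) (norm_nonneg _))

namespace IsEulerian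

variable {M κ T t : ℝ} {v : ℝ → H1} {ξ : ℝ → ℝ → ℝ}

/-- The displacement `ξ_t - id` of the flow belongs to `H¹`: its time derivative `v(t) ∘ ξ_t` and
the `x`-derivative of that are bounded in `L²`. -/
theorem exists_flowMap_eq (h : IsEulerian M κ T v) (hξ : IsFlow T v ξ) (ht : t ∈ Ioo (-T) T) :
    ∃ ζ : H1, flowMap ζ = ξ t := by
  set c := Real.exp (-(M * T)) with hc
  have c0 : 0 < c := Real.exp_pos _
  have hcont : ∀ s ∈ Ioo (-T) T, Continuous fun y => ξ s y - y := fun s hs =>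
    (h.isChart_flow hξ hs).continuous.sub continuous_id
  have hprim : ∀ s ∈ Ioo (-T) T, IsPrimitive (fun y => ξ s y - y) fun y => deriv (ξ s) y - 1 := by
    intro s hs
    have hp := (h.isChart_flow hξ hs).isPrimitive
    refine ⟨hp.locallyIntegrable.sub (locallyIntegrable_const 1), fun a b => ?_⟩
    rw [intervalIntegral.integral_sub (hp.intervalIntegrable a b) (by simp), ← hp.sub_eq]
    simp only [intervalIntegral.integral_const, smul_eq_mul, mul_one]
    ring
  have m1 : MemLp (fun y => ξ t y - y) 2 volume :=
    memLp_of_hasDerivAt_integral (g := fun t y => ξ t y - y) (r := fun t => compL2 (ξ t) (v t).fn)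
      (C := c⁻¹ * M) h.time_pos (fun y => by rw [hξ.zero, sub_self])
      (hcont t ht).locallyIntegrable (fun s hs => by
        refine ((h.isChart_flow hξ hs).isExpanding.norm_compL2_le _).trans ?_
        have := (v s).norm_fn_le.trans (h.norm_le s (Ioo_subset_Icc_self hs))
        gcongr) (fun φ hφ s hs => h.hasDerivAt_integral_flow hξ hφ hs) ht
  have m2 : MemLp (fun y => deriv (ξ t) y - 1) 2 volume := by
    refine memLp_of_hasDerivAt_integral (g := fun t y => deriv (ξ t) y - 1)
      (r := fun t => toL2 fun y => (v t).dx (ξ t y) * deriv (ξ t) y) (C := c⁻¹ ^ 2 * M)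
      h.time_pos (fun y => ?_) (hprim t ht).locallyIntegrable (fun s hs => ?_)
      (fun φ hφ s hs => ?_) ht
    · rw [show ξ 0 = id from funext hξ.zero, deriv_id, sub_self]
    · refine ((h.isChart_flow hξ hs).norm_toL2_mul_comp_le _).trans ?_
      have := (v s).norm_dx_le.trans (h.norm_le s (Ioo_subset_Icc_self hs))
      gcongr
    · have e1 := (h.hasDerivAt_integral_flow hξ hφ.deriv hs).neg
      have e2 := (h.isChart_flow hξ hs).hasWeakDeriv_comp (v s).hasWeakDeriv φ hφ
      rw [e2, neg_neg] at e1
      refine e1.congr_of_eventuallyEq ?_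
      filter_upwards [isOpen_Ioo.mem_nhds hs] with τ hτ
      rw [Pi.neg_apply, (hprim τ hτ).integral_mul_deriv hφ, neg_neg]
  set ζ := H1.mk ((hprim t ht).hasWeakDeriv (coeFn_toL2 m1) (coeFn_toL2 m2))
  refine ⟨ζ, funext fun y => ?_⟩
  rw [flowMap, H1.rep_eq_of_ae_eq (f := ζ) (hcont t ht) (coeFn_toL2 m1)]
  ring

end IsEulerian

theorem continuous_accel {c M : ℝ} (κ : ℝ) (h0 : 0 < c) (h1 : c ≤ 1) (hM : 0 ≤ M) :
    Continuous (accel c M κ) := by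
  refine continuous_iff_continuousAt.mpr fun w => tendsto_iff_norm_sub_tendsto_zero.mpr ?_
  have h := ((tendsto_iff_norm_sub_tendsto_zero.mp (tendsto_id (x := 𝓝 w))).const_mul
    (accelConst c M κ ‖w‖))
  rw [mul_zero] at h
  exact squeeze_zero (fun _ => norm_nonneg _) (fun z => norm_accel_sub_le κ h0 h1 hM z le_rfl) h

theorem IsChart.ae_abs_pull_fn_le {c C : ℝ} {ξ J : ℝ → ℝ} (h : IsChart c ξ J) {f : H1}
    (hf : ∀ᵐ x, |f.fn x| ≤ C) : ∀ᵐ y, |(h.pull f).fn y| ≤ C := by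
  filter_upwards [h.isExpanding.coeFn_compL2 f.fn, h.isExpanding.ae_comp hf] with y h1 h2
  rwa [h.pull_fn, h1]

theorem IsChart.ae_abs_pull_dx_le {c C : ℝ} {ξ J : ℝ → ℝ} (h : IsChart c ξ J) {f : H1}
    (hf : ∀ᵐ x, |f.dx x| ≤ C) : ∀ᵐ y, |(h.pull f).dx y| ≤ c⁻¹ * C := by
  filter_upwards [coeFn_toL2 (h.memLp_mul_comp f.dx), h.isExpanding.ae_comp hf,
    h.isPinched.abs_le] with y h1 h2 h3
  rw [h.pull_dx, h1, abs_mul, mul_comm]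
  exact mul_le_mul h3 h2 (abs_nonneg _) (inv_nonneg.mpr h.isPinched.pos.le)

/-- The estimate of `f ∘ ξ · J - f' ∘ ξ' · J'` in `L²` by the differences of the factors. -/
theorem norm_toL2_mul_comp_sub_le {c M : ℝ} {ξ ξ' : ℝ → ℝ} {ζ ζ' : H1}
    (h : IsChart c ξ fun y => 1 + ζ.dx y) (h' : IsChart c ξ' fun y => 1 + ζ'.dx y) (hM : 0 ≤ M)
    {f f' : L2} (hf : ∀ᵐ x, |f' x| ≤ M) :
    ‖(toL2 fun y => f (ξ y) * (1 + ζ.dx y)) - toL2 fun y => f' (ξ' y) * (1 + ζ'.dx y)‖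
      ≤ (c⁻¹ + M) * (‖compL2 ξ f - compL2 ξ' f'‖ + ‖ζ - ζ'‖) := by
  have hc := h.isPinched.pos
  have e : ‖(toL2 fun y => f (ξ y) * (1 + ζ.dx y)) - toL2 fun y => f' (ξ' y) * (1 + ζ'.dx y)‖
      ≤ (c⁻¹ + M) * (‖compL2 ξ f - compL2 ξ' f'‖ + ‖(ζ - ζ').dx‖ + ‖(0 : L2)‖) := by
    refine norm_le_of_abs_le (by positivity) ?_
    filter_upwards [coeFn_toL2 (h.memLp_mul_comp f), coeFn_toL2 (h'.memLp_mul_comp f'),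
      Lp.coeFn_sub (toL2 fun y => f (ξ y) * (1 + ζ.dx y))
        (toL2 fun y => f' (ξ' y) * (1 + ζ'.dx y)),
      Lp.coeFn_sub (compL2 ξ f) (compL2 ξ' f'), h.isExpanding.coeFn_compL2 f,
      h'.isExpanding.coeFn_compL2 f', Lp.coeFn_sub ζ.dx ζ'.dx, h'.isExpanding.ae_comp hf,
      h.isPinched.abs_le] with y a1 a2 a3 a4 a5 a6 a7 a8 a9
    rw [a3, Pi.sub_apply, a1, a2, a4, Pi.sub_apply, a5, a6, H1.dx_sub, a7, Pi.sub_apply,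
      show f (ξ y) * (1 + ζ.dx y) - f' (ξ' y) * (1 + ζ'.dx y)
        = (1 + ζ.dx y) * (f (ξ y) - f' (ξ' y)) + f' (ξ' y) * (ζ.dx y - ζ'.dx y) by ring]
    refine (abs_add_le _ _).trans ?_
    rw [abs_mul, abs_mul]
    have e1 := mul_le_mul_of_nonneg_right a9 (abs_nonneg (f (ξ y) - f' (ξ' y)))
    have e2 := mul_le_mul_of_nonneg_right a8 (abs_nonneg (ζ.dx y - ζ'.dx y))
    have e3 : 0 ≤ (c⁻¹ + M) * |(0 : L2) y| := by positivity
    have e4 : 0 ≤ M * |f (ξ y) - f' (ξ' y)| := by positivity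
    have e5 : 0 ≤ c⁻¹ * |ζ.dx y - ζ'.dx y| := by positivity
    nlinarith
  refine e.trans (mul_le_mul_of_nonneg_left ?_ (by positivity))
  rw [norm_zero, add_zero]
  linarith [(ζ - ζ').norm_dx_le]

/-- A solution in Eulerian coordinates comes from a solution in Lagrangian coordinates. The
constants `c` and `M'` depend only on `M` and `T`, so that solutions with a common bound give
integral curves of the same vector field. -/
theorem IsEulerian.exists_isLagrangian {M κ T c M' : ℝ} {v : ℝ → H1} (h : IsEulerian M κ T v)
    (hc : c = Real.exp (-(M * T))) (hM' : M' = 4 * c⁻¹ ^ 2 * M * (1 + T)) :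
    ∃ z, IsLagrangian c M' κ T z ∧ z 0 = (0, v 0) ∧ ∀ t ∈ Ioo (-T) T, eulerian c (z t) = v t := by
  obtain ⟨ξ, hξ⟩ := h.exists_isFlow
  have c0 : 0 < c := hc ▸ Real.exp_pos _
  have c1 : c ≤ 1 := hc ▸ h.exp_le_one
  have ci := (one_le_inv₀ c0).mpr c1
  have hM := h.nonneg
  have hT := h.time_pos
  have hM'0 : 0 ≤ M' := by rw [hM']; positivity
  have hZex : ∀ t, ∃ ζ : H1, t ∈ Ioo (-T) T → flowMap ζ = ξ t := fun t => by
    by_cases ht : t ∈ Ioo (-T) T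
    · obtain ⟨ζ, hζ⟩ := h.exists_flowMap_eq hξ ht
      exact ⟨ζ, fun _ => hζ⟩
    · exact ⟨0, fun h => absurd h ht⟩
  choose Z hZ using hZex
  have hch : ∀ t ∈ Ioo (-T) T, IsChart c (flowMap (Z t)) fun y => 1 + (Z t).dx y := by
    intro t ht
    refine (isPrimitive_flowMap (Z t)).isChart c0 c1 ?_ ?_
    · rw [hZ t ht, hc]
      exact h.le_flow_sub hξ ht
    · rw [hZ t ht, hc]
      exact h.flow_sub_le hξ ht
  obtain ⟨U, hU⟩ : ∃ U : ℝ → H1, ∀ t (ht : t ∈ Ioo (-T) T), U t = (hch t ht).pull (v t) := by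
    classical
    exact ⟨fun t => if ht : t ∈ Ioo (-T) T then (hch t ht).pull (v t) else 0,
      fun t ht => dif_pos ht⟩
  have hsub := @Ioo_subset_Icc_self ℝ _ (-T) T
  have hUn : ∀ t ∈ Ioo (-T) T, ‖U t‖ ≤ 2 * c⁻¹ ^ 2 * M := by
    intro t ht
    rw [hU t ht]
    refine (IsChart.norm_pull_le _ _).trans ?_
    have := h.norm_le t (hsub ht)
    gcongr
  have hZU : ∀ φ, IsTestFunction φ → ∀ t ∈ Ioo (-T) T,
      HasDerivAt (fun t => ∫ x, (Z t).fn x * φ x) (∫ x, (U t).fn x * φ x) t := by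
    intro φ hφ t ht
    rw [hU t ht, IsChart.pull_fn, hZ t ht]
    refine (h.hasDerivAt_integral_flow hξ hφ ht).congr_of_eventuallyEq ?_
    filter_upwards [isOpen_Ioo.mem_nhds ht] with s hs
    refine integral_congr_ae ?_
    filter_upwards [(Z s).fn_ae_eq_rep] with y hy
    rw [hy, ← hZ s hs, flowMap, add_sub_cancel_left]
  have hlip : ∀ s ∈ Ioo (-T) T, ∀ t ∈ Ioo (-T) T, ‖Z t - Z s‖ ≤ 2 * (2 * c⁻¹ ^ 2 * M) * |t - s| :=
    fun s hs t ht => H1.norm_sub_le_of_test hUn hZU hs ht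
  have hξd : ∀ s ∈ Ioo (-T) T, ∀ t ∈ Ioo (-T) T, ∀ y,
      |flowMap (Z s) y - flowMap (Z t) y| ≤ M * |s - t| := by
    intro s hs t ht y
    rw [hZ s hs, hZ t ht]
    exact h.abs_flow_sub_le hξ hs ht y
  have hvat : ∀ t ∈ Ioo (-T) T, Tendsto v (𝓝 t) (𝓝 (v t)) := fun t ht =>
    (h.continuousOn t (hsub ht)).continuousAt (Icc_mem_nhds ht.1 ht.2)
  have habs : ∀ t C : ℝ, Tendsto (fun s => C * |s - t|) (𝓝 t) (𝓝 0) := fun t C => by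
    have : Continuous fun s => C * |s - t| := by fun_prop
    simpa using this.tendsto t
  have hUc : ∀ t ∈ Ioo (-T) T, ContinuousAt U t := by
    intro t ht
    have hnh := isOpen_Ioo.mem_nhds ht
    have hcomp {a : ℝ → L2} (ha : Tendsto a (𝓝 t) (𝓝 (a t))) :
        Tendsto (fun s => compL2 (flowMap (Z s)) (a s)) (𝓝 t)
          (𝓝 (compL2 (flowMap (Z t)) (a t))) := by
      refine tendsto_compL2 (c := c) ?_ (hch t ht).isExpanding ha (d := fun s => M * |s - t|) ?_
        (habs t M)
      · filter_upwards [hnh] with s hs using (hch s hs).isExpanding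
      · filter_upwards [hnh] with s hs using hξd s hs t ht
    refine H1.tendsto_iff.mpr ⟨?_, ?_⟩
    · rw [hU t ht, IsChart.pull_fn]
      refine (hcomp ((H1.fnL.continuous.tendsto _).comp (hvat t ht))).congr' ?_
      filter_upwards [hnh] with s hs
      rw [hU s hs, IsChart.pull_fn]
      rfl
    · have h1 := tendsto_iff_norm_sub_tendsto_zero.mp
        (hcomp ((H1.dxL.continuous.tendsto _).comp (hvat t ht)))
      have h2 := ((h1.add (habs t (2 * (2 * c⁻¹ ^ 2 * M)))).const_mul (c⁻¹ + M))
      rw [add_zero, mul_zero] at h2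
      refine tendsto_iff_norm_sub_tendsto_zero.mpr
        (squeeze_zero' (Eventually.of_forall fun _ => norm_nonneg _) ?_ h2)
      filter_upwards [hnh] with s hs
      rw [hU t ht, hU s hs, IsChart.pull_dx, IsChart.pull_dx]
      refine (norm_toL2_mul_comp_sub_le (hch s hs) (hch t ht) hM
        (h.abs_dx_le t (hsub ht))).trans ?_
      have := hlip t ht s hs
      exact mul_le_mul_of_nonneg_left (add_le_add le_rfl this) (by positivity)
  -- The weak derivative `U` of `Z` is continuous in `H¹`, so it is a derivative in `H¹`; and
  -- likewise for `U` and the acceleration below.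
  have hUcOn : ContinuousOn U (Ioo (-T) T) := fun t ht => (hUc t ht).continuousWithinAt
  have hZd : ∀ t ∈ Ioo (-T) T, HasDerivAt Z (U t) t := fun t ht =>
    H1.hasDerivAt_of_test hUcOn hZU ht
  have hUfn : ∀ t ∈ Ioo (-T) T, ∀ᵐ y, |(U t).fn y| ≤ M' := by
    intro t ht
    rw [hU t ht]
    refine ((hch t ht).ae_abs_pull_fn_le (h.abs_fn_le t (hsub ht))).mono fun y hy => hy.trans ?_
    have h1 : 1 ≤ c⁻¹ ^ 2 := one_le_pow₀ ci
    rw [hM']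
    nlinarith [mul_nonneg hM hT.le, mul_le_mul_of_nonneg_right h1 hM,
      mul_nonneg (mul_nonneg (zero_le_one.trans h1) hM) hT.le]
  have hUdx : ∀ t ∈ Ioo (-T) T, ∀ᵐ y, |(U t).dx y| ≤ M' := by
    intro t ht
    rw [hU t ht]
    refine ((hch t ht).ae_abs_pull_dx_le (h.abs_dx_le t (hsub ht))).mono fun y hy => hy.trans ?_
    have h1 : c⁻¹ ≤ c⁻¹ ^ 2 := by nlinarith
    have h2 : 0 ≤ c⁻¹ ^ 2 * M := by positivity
    rw [hM']
    nlinarith [mul_le_mul_of_nonneg_right h1 hM, mul_nonneg h2 hT.le]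
  have hZc : ∀ t ∈ Ioo (-T) T, ContinuousAt Z t := fun t ht => (hZd t ht).continuousAt
  have hAc : ContinuousOn (fun t => accel c M' κ (Z t, U t)) (Ioo (-T) T) := fun t ht =>
    ((continuous_accel κ c0 c1 hM'0).continuousAt.comp
      ((hZc t ht).prodMk (hUc t ht))).continuousWithinAt
  have hUd : ∀ t ∈ Ioo (-T) T, HasDerivAt U (accel c M' κ (Z t, U t)) t := by
    refine fun t ht => H1.hasDerivAt_of_test hAc (fun φ hφ t ht => ?_) ht
    have hcht := hch t ht
    have key := hasDerivAt_integral_compL2 (a := fun t => (v t).fn) (θ := fun s => flowMap (Z s))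
      (f := (v t).rep) (d := fun y => (v t).dx (flowMap (Z t) y) * (v t).rep (flowMap (Z t) y))
      (c := c) ht (h.hasDerivAt t ht) (fun s hs => (hch s hs).isExpanding) hξd
      (h.lipschitzWith_rep (hsub ht)) (v t).fn_ae_eq_rep ?_ ?_ hφ
    · have e1 : ∫ y, (eulerField M κ (v t) (flowMap (Z t) y)
          + (v t).dx (flowMap (Z t) y) * (v t).rep (flowMap (Z t) y)) * φ y
          = ∫ y, (accel c M' κ (Z t, U t)).fn y * φ y := by
        refine integral_congr_ae ?_
        have e2 : (accel c M' κ (Z t, U t)).fn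
            = compL2 (flowMap (Z t)) (accel 1 M κ (0, v t)).fn := by
          rw [hU t ht]
          exact accel_pull hcht hM'0 hM (h.abs_fn_le t (hsub ht)) (h.abs_dx_le t (hsub ht))
            (hU t ht ▸ hUfn t ht) (hU t ht ▸ hUdx t ht)
        filter_upwards [hcht.isExpanding.coeFn_compL2 (accel 1 M κ (0, v t)).fn,
          hcht.isExpanding.ae_comp (Lp.coeFn_sub (accel 1 M κ (0, v t)).fn
            (toL2 fun x => (v t).fn x * (v t).dx x)),
          hcht.isExpanding.ae_comp (coeFn_toL2 (v t).memLp_fn_mul_dx),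
          hcht.isExpanding.ae_comp (v t).fn_ae_eq_rep] with y a1 a2 a3 a4
        rw [e2, a1, eulerField, a2, Pi.sub_apply, a3, a4]
        ring
      rw [e1] at key
      refine key.congr_of_eventuallyEq ?_
      filter_upwards [isOpen_Ioo.mem_nhds ht] with s hs
      rw [hU s hs, IsChart.pull_fn]
    · exact (hcht.isExpanding.aestronglyMeasurable_comp (Lp.aestronglyMeasurable _)).mul
        ((v t).continuous_rep.comp hcht.continuous).aestronglyMeasurable
    · filter_upwards [hcht.isExpanding.ae_comp (v t).isPrimitive_rep.ae_hasDerivAt] with y hy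
      have h1 := hξ.hasDerivAt t ht y
      rw [hZ t ht] at hy ⊢
      refine (hy.comp t h1).congr_of_eventuallyEq ?_
      filter_upwards [isOpen_Ioo.mem_nhds ht] with s hs
      rw [hZ s hs]
      rfl
  have h0 := h.zero_mem
  have hZ0 : Z 0 = 0 := by
    refine H1.ext_rep (funext fun y => ?_)
    have := congrFun (hZ 0 h0) y
    rw [flowMap, hξ.zero] at this
    rw [H1.rep_zero]
    linarith
  refine ⟨fun t => (Z t, U t), ⟨c0, c1, fun t ht => (hZd t ht).prodMk (hUd t ht), fun t ht => ?_,
    fun t ht => (hch t ht).isPinched.lower, fun t ht => (hch t ht).isPinched.upper, hUfn, hUdx⟩,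
    ?_, fun t ht => ?_⟩
  · have e1 := hlip 0 h0 t ht
    rw [hZ0, sub_zero, sub_zero] at e1
    have e2 := (abs_lt.mpr ht).le
    have e3 : 0 ≤ c⁻¹ ^ 2 * M := by positivity
    refine (max_le (e1.trans ?_) ((hUn t ht).trans ?_) : ‖(Z t, U t)‖ ≤ M')
    · rw [hM']
      nlinarith [mul_le_mul_of_nonneg_left e2 e3]
    · rw [hM']
      nlinarith [mul_nonneg e3 hT.le]
  · refine Prod.ext hZ0 (H1.ext_rep (funext fun y => ?_))
    simp only [hU 0 h0]
    rw [IsChart.pull_rep]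
    exact congrArg _ ((congrFun (hZ 0 h0) y).trans (hξ.zero y))
  · refine (hch t ht).pull_injective ?_
    rw [pull_eulerian (z := (Z t, U t)) (hch t ht), ← hU t ht]

/-! ### Uniqueness and continuous dependence -/

/-- Lagrangian solutions depend on their data in a Lipschitz way. -/
theorem IsLagrangian.norm_sub_le {c M κ T t : ℝ} {z w : ℝ → H1 × H1} (hz : IsLagrangian c M κ T z)
    (hw : IsLagrangian c M κ T w) (ht : t ∈ Ioo (-T) T) :
    ‖z t - w t‖ ≤ ‖z 0 - w 0‖ * Real.exp (fieldConst c M κ M * T) := by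
  have hT : 0 < T := by linarith [ht.1, ht.2]
  have h0 : (0 : ℝ) ∈ Ioo (-T) T := ⟨by linarith, hT⟩
  have hM := hz.nonneg ht
  have h1 := norm_le_exp_of_norm_deriv_le (f := fun t => z t - w t) (K := fieldConst c M κ M)
    (fun s hs => (hz.hasDerivAt s hs).sub (hw.hasDerivAt s hs))
    (fun s hs => norm_lagrangeField_sub_le κ hz.pos hz.le_one hM (z s) (hw.norm_le s hs)) h0 ht
  refine h1.trans ?_
  have h2 : 0 ≤ fieldConst c M κ M := by
    have := accelConst_nonneg c M κ hM
    unfold fieldConst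
    positivity
  rw [sub_zero]
  have := (abs_lt.mpr ht).le
  gcongr

theorem IsChart.compL2_invMap_compL2 {c : ℝ} {ξ J : ℝ → ℝ} (h : IsChart c ξ J) (f : L2) :
    compL2 (invMap ξ) (compL2 ξ f) = f := by
  refine Lp.ext ?_
  have hi := h.isChart_invMap.isExpanding
  filter_upwards [hi.coeFn_compL2 (compL2 ξ f), hi.ae_comp (h.isExpanding.coeFn_compL2 f)]
    with x h1 h2
  rw [h1, h2, h.apply_invMap]

theorem IsChart.compL2_compL2_invMap {c : ℝ} {ξ J : ℝ → ℝ} (h : IsChart c ξ J) (f : L2) :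
    compL2 ξ (compL2 (invMap ξ) f) = f := by
  refine Lp.ext ?_
  filter_upwards [h.isExpanding.coeFn_compL2 (compL2 (invMap ξ) f),
    h.isExpanding.ae_comp (h.isChart_invMap.isExpanding.coeFn_compL2 f)] with x h1 h2
  rw [h1, h2, h.invMap_apply]

theorem IsChart.norm_le_norm_compL2 {c : ℝ} {ξ J : ℝ → ℝ} (h : IsChart c ξ J) (f : L2) :
    ‖f‖ ≤ c⁻¹ * ‖compL2 ξ f‖ := by
  have := h.isChart_invMap.isExpanding.norm_compL2_le (compL2 ξ f)
  rwa [h.compL2_invMap_compL2] at this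

/-- Comparison of two Eulerian velocities through their Lagrangian counterparts. -/
theorem norm_eulerian_sub_le {c M ε : ℝ} {z w : H1 × H1}
    (hz : IsChart c (flowMap z.1) fun y => 1 + z.1.dx y)
    (hw : IsChart c (flowMap w.1) fun y => 1 + w.1.dx y) (hM : 0 ≤ M)
    (hb : ∀ᵐ y, |w.2.dx y| ≤ M)
    (h1 : ‖compL2 (flowMap w.1) (eulerian c z).fn - compL2 (flowMap z.1) (eulerian c z).fn‖ ≤ ε)
    (h2 : ‖compL2 (flowMap w.1) (eulerian c z).dx - compL2 (flowMap z.1) (eulerian c z).dx‖ ≤ ε) :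
    ‖eulerian c z - eulerian c w‖
      ≤ c⁻¹ * (2 * ε + (1 + 2 * (c⁻¹ ^ 2 * (1 + M))) * ‖z - w‖) := by
  have hc := hz.isPinched.pos
  have e1 : ‖((eulerian c z).fn - (eulerian c w).fn : L2)‖ ≤ c⁻¹ * (ε + ‖z - w‖) := by
    refine (hw.norm_le_norm_compL2 _).trans (mul_le_mul_of_nonneg_left ?_ (by positivity))
    rw [hw.isExpanding.compL2_sub]
    have a1 : compL2 (flowMap z.1) (eulerian c z).fn = z.2.fn := by
      rw [eulerian_fn hz, hz.compL2_compL2_invMap]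
    have a2 : compL2 (flowMap w.1) (eulerian c w).fn = w.2.fn := by
      rw [eulerian_fn hw, hw.compL2_compL2_invMap]
    rw [a1] at h1
    rw [a2, ← sub_add_sub_cancel _ z.2.fn]
    refine (norm_add_le _ _).trans (add_le_add h1 ?_)
    exact (z.2 - w.2).norm_fn_le.trans (norm_snd_le (z - w))
  have e2 : ‖((eulerian c z).dx - (eulerian c w).dx : L2)‖
      ≤ c⁻¹ * (ε + c⁻¹ ^ 2 * (1 + M) * (2 * ‖z - w‖)) := by
    refine (hw.norm_le_norm_compL2 _).trans (mul_le_mul_of_nonneg_left ?_ (by positivity))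
    rw [hw.isExpanding.compL2_sub]
    have a1 : compL2 (flowMap z.1) (eulerian c z).dx = lagrangianSlope z := by
      rw [eulerian_dx hz, hz.compL2_compL2_invMap]
    have a2 : compL2 (flowMap w.1) (eulerian c w).dx = lagrangianSlope w := by
      rw [eulerian_dx hw, hw.compL2_compL2_invMap]
    rw [a1] at h2
    rw [a2, ← sub_add_sub_cancel _ (lagrangianSlope z)]
    exact (norm_add_le _ _).trans (add_le_add h2 (norm_lagrangianSlope_sub_le hz hw hM hb))
  refine (H1.norm_le _).trans ?_
  rw [H1.fn_sub, H1.dx_sub]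
  linarith

/-- Continuous dependence on the data in `H¹`, among solutions with a common bound. The compactness
of the orbit of `u` makes the composition with nearby flow maps uniformly continuous. -/
theorem IsEulerian.exists_norm_sub_lt {M κ T ε : ℝ} {u : ℝ → H1} (hu : IsEulerian M κ T u)
    (hε : 0 < ε) : ∃ δ > 0, ∀ v, IsEulerian M κ T v → ‖v 0 - u 0‖ < δ →
      ∀ t ∈ Icc (-T) T, ‖v t - u t‖ < ε := by
  obtain ⟨c, hc⟩ : ∃ c, c = Real.exp (-(M * T)) := ⟨_, rfl⟩
  obtain ⟨M', hM'⟩ : ∃ M', M' = 4 * c⁻¹ ^ 2 * M * (1 + T) := ⟨_, rfl⟩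
  have c0 : 0 < c := hc ▸ Real.exp_pos _
  have hM := hu.nonneg
  have hT := hu.time_pos
  have hM'0 : 0 ≤ M' := by rw [hM']; positivity
  set A := 1 + 2 * (c⁻¹ ^ 2 * (1 + M')) with hA
  have hA0 : 0 < A := by positivity
  set E := Real.exp (fieldConst c M' κ M' * T) with hE
  have hE0 : 0 < E := Real.exp_pos _
  -- `norm_eulerian_sub_le` turns `2 · (c ε / 8)` and `A d ≤ c ε / 4` into `ε / 2`
  obtain ⟨d₁, hd₁, H₁⟩ := exists_norm_compL2_sub_le_of_isCompact
    (isCompact_Icc.image_of_continuousOn (H1.fnL.continuous.comp_continuousOn hu.continuousOn))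
    c0 (show 0 < c * ε / 8 by positivity)
  obtain ⟨d₂, hd₂, H₂⟩ := exists_norm_compL2_sub_le_of_isCompact
    (isCompact_Icc.image_of_continuousOn (H1.dxL.continuous.comp_continuousOn hu.continuousOn))
    c0 (show 0 < c * ε / 8 by positivity)
  obtain ⟨z, hz, hz0, hzu⟩ := hu.exists_isLagrangian hc hM'
  set d := min (min (d₁ / 2) (d₂ / 2)) (c * ε / (4 * A)) with hd
  have hd0 : 0 < d := by positivity
  refine ⟨d / E, by positivity, fun v hv h0 => ?_⟩
  obtain ⟨w, hw, hw0, hwv⟩ := hv.exists_isLagrangian hc hM'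
  have key : ∀ t ∈ Ioo (-T) T, ‖v t - u t‖ ≤ ε / 2 := by
    intro t ht
    have hD : ‖z t - w t‖ ≤ d := by
      refine (hz.norm_sub_le hw ht).trans ?_
      have e : ‖z 0 - w 0‖ = ‖v 0 - u 0‖ := by
        rw [hz0, hw0, norm_sub_rev]
        simp [Prod.norm_def]
      rw [e, ← le_div_iff₀ hE0]
      exact h0.le
    have hξ : ∀ y, |flowMap (w t).1 y - flowMap (z t).1 y| ≤ 2 * d := fun y => by
      refine (abs_flowMap_sub_le _ _ y).trans ?_
      rw [norm_sub_rev]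
      have := norm_fst_le (z t - w t)
      rw [Prod.fst_sub] at this
      linarith
    have hdd₁ : 2 * d ≤ d₁ := by
      have := (min_le_left _ _).trans (min_le_left _ _) |> (hd.le.trans ·)
      linarith
    have hdd₂ : 2 * d ≤ d₂ := by
      have := (min_le_left _ _).trans (min_le_right _ _) |> (hd.le.trans ·)
      linarith
    have hdA : A * d ≤ c * ε / 4 := by
      have := hd.le.trans (min_le_right _ _)
      rw [le_div_iff₀ (by positivity)] at this
      linarith
    have ht' := Ioo_subset_Icc_self ht
    have h3 := norm_eulerian_sub_le (ε := c * ε / 8) (hz.isChart ht) (hw.isChart ht) hM'0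
      (hw.abs_dx_le t ht)
      (H₁ _ (by rw [hzu t ht]; exact mem_image_of_mem _ ht') _ _ (hw.isChart ht).isExpanding
        (hz.isChart ht).isExpanding fun y => (hξ y).trans hdd₁)
      (H₂ _ (by rw [hzu t ht]; exact mem_image_of_mem _ ht') _ _ (hw.isChart ht).isExpanding
        (hz.isChart ht).isExpanding fun y => (hξ y).trans hdd₂)
    rw [hzu t ht, hwv t ht, ← hA, norm_sub_rev] at h3
    refine h3.trans ?_
    rw [inv_mul_le_iff₀ c0]
    linarith [mul_le_mul_of_nonneg_left hD hA0.le]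
  -- the endpoints, by continuity
  intro t ht
  have hcl : t ∈ closure (Ioo (-T) T) := by rwa [closure_Ioo (by linarith : -T ≠ T)]
  have h4 : ContinuousWithinAt (fun t => ‖v t - u t‖) (Ioo (-T) T) t :=
    ((hv.continuousOn t ht).sub (hu.continuousOn t ht)).norm.mono Ioo_subset_Icc_self
  have h5 := h4.mem_closure hcl (t := Iic (ε / 2)) key
  rw [isClosed_Iic.closure_eq] at h5
  exact (mem_Iic.mp h5).trans_lt (by linarith)

/-- Solutions with the same datum agree. -/
theorem IsEulerian.eqOn {M κ T : ℝ} {u v : ℝ → H1} (hu : IsEulerian M κ T u)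
    (hv : IsEulerian M κ T v) (h0 : v 0 = u 0) : EqOn v u (Icc (-T) T) := by
  intro t ht
  refine sub_eq_zero.mp (norm_le_zero_iff.mp (le_of_forall_pos_le_add fun ε hε => ?_))
  obtain ⟨δ, hδ, h⟩ := hu.exists_norm_sub_lt hε
  rw [zero_add]
  exact (h v hv (by rwa [h0, sub_self, norm_zero]) t ht).le

theorem IsSolution.eqOn {κ T : ℝ} {u₀ : H1} {u v : ℝ → H1} (hu : IsSolution κ T u₀ u)
    (hv : IsSolution κ T u₀ v) (hT : 0 < T) : EqOn v u (Icc (-T) T) := by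
  obtain ⟨M, hM, h1⟩ := hu.memZ.exists_bound hT
  obtain ⟨N, hN, h2⟩ := hv.memZ.exists_bound hT
  have mono {w : H1} {a b : ℝ} (hab : a ≤ b)
      (h : ‖w‖ ≤ a ∧ (∀ᵐ x, |w.fn x| ≤ a) ∧ ∀ᵐ x, |w.dx x| ≤ a) :
      ‖w‖ ≤ b ∧ (∀ᵐ x, |w.fn x| ≤ b) ∧ ∀ᵐ x, |w.dx x| ≤ b :=
    ⟨h.1.trans hab, h.2.1.mono fun x hx => hx.trans hab, h.2.2.mono fun x hx => hx.trans hab⟩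
  exact (hu.isEulerian hT (le_max_of_le_left hM)
    fun t ht => mono (le_max_left M N) (h1 t ht)).eqOn
    (hv.isEulerian hT (le_max_of_le_left hM) fun t ht => mono (le_max_right M N) (h2 t ht))
    (hv.initial.trans hu.initial.symm)

/-- The time derivatives of solutions with a common bound are close if the solutions are. -/
theorem norm_dt_sub_le {M κ T t : ℝ} {u₀ v₀ : H1} {u v : ℝ → H1} (hu : IsSolution κ T u₀ u)
    (hv : IsSolution κ T v₀ v) (hu' : IsEulerian M κ T u) (hv' : IsEulerian M κ T v)
    (ht : t ∈ Ioo (-T) T) :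
    ‖dt v t - dt u t‖ ≤ (accelConst 1 M κ M + 2 * M) * ‖v t - u t‖ := by
  have ht' := Ioo_subset_Icc_self ht
  have hM := hu'.nonneg
  rw [hu.dt_eq hM ht (hu'.abs_fn_le t ht') (hu'.abs_dx_le t ht'),
    hv.dt_eq hM ht (hv'.abs_fn_le t ht') (hv'.abs_dx_le t ht')]
  refine (norm_eulerField_sub_le κ hM (hv'.abs_fn_le t ht') (hu'.abs_dx_le t ht')).trans ?_
  have h1 := hu'.norm_le t ht'
  have h2 := sourceConst_nonneg 1 (M := M) κ
  unfold accelConst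
  gcongr

/-! ### Peakons -/

theorem IsPrimitive.of_hasDerivAt_of_ne {F g : ℝ → ℝ} {b : ℝ} (hF : Continuous F)
    (hg : LocallyIntegrable g volume) (h : ∀ x, x ≠ b → HasDerivAt F (g x) x) :
    IsPrimitive F g where
  locallyIntegrable := hg
  sub_eq _ _ := (integral_eq_of_hasDerivAt_off_countable F g (countable_singleton b)
    hF.continuousOn (fun z hz => h z hz.2) (intervalIntegrable_iff.mpr
      ((hg.integrableOn_isCompact isCompact_uIcc).mono_set uIoc_subset_uIcc))).symm

/-- The peakon profile `a e^{-|x - b|}`. -/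
def peak (a b x : ℝ) : ℝ := a * Real.exp (-|x - b|)

/-- The sign of `b - x`, with the value `1` at `x = b`. -/
def peakSign (b x : ℝ) : ℝ := if x ≤ b then 1 else -1

theorem continuous_peak (a b : ℝ) : Continuous (peak a b) := by
  unfold peak
  fun_prop

theorem measurable_peakSign (b : ℝ) : Measurable (peakSign b) :=
  Measurable.ite measurableSet_Iic measurable_const measurable_const

theorem peakSign_sq (b x : ℝ) : peakSign b x ^ 2 = 1 := by
  unfold peakSign
  split_ifs <;> norm_num

theorem abs_peakSign (b x : ℝ) : |peakSign b x| = 1 := by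
  unfold peakSign
  split_ifs <;> norm_num

theorem peakSign_eventuallyEq {b x : ℝ} (h : x ≠ b) :
    peakSign b =ᶠ[𝓝 x] fun _ => peakSign b x := by
  rcases lt_or_gt_of_ne h with h | h
  · filter_upwards [Iio_mem_nhds h] with y hy
    rw [peakSign, peakSign, if_pos (le_of_lt hy), if_pos h.le]
  · filter_upwards [Ioi_mem_nhds h] with y hy
    rw [peakSign, peakSign, if_neg (not_le.mpr hy), if_neg (not_le.mpr h)]

theorem hasDerivAt_peak (a : ℝ) {b x : ℝ} (h : x ≠ b) :
    HasDerivAt (peak a b) (peakSign b x * peak a b x) x := by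
  have h1 : HasDerivAt (fun x => -|x - b|) (peakSign b x) x := by
    rcases lt_or_gt_of_ne h with h | h
    · have := ((hasDerivAt_abs_neg (sub_neg.mpr h)).comp_sub_const x b).neg
      rwa [neg_neg, show (1 : ℝ) = peakSign b x by rw [peakSign, if_pos h.le]] at this
    · have := ((hasDerivAt_abs_pos (sub_pos.mpr h)).comp_sub_const x b).neg
      rwa [show (-1 : ℝ) = peakSign b x by rw [peakSign, if_neg (not_le.mpr h)]] at this
  refine (h1.exp.const_mul a).congr_deriv ?_
  rw [peak]
  ring

theorem peak_nonneg {a : ℝ} (ha : 0 ≤ a) (b x : ℝ) : 0 ≤ peak a b x := by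
  unfold peak
  positivity

theorem peak_le {a : ℝ} (ha : 0 ≤ a) (b x : ℝ) : peak a b x ≤ a :=
  mul_le_of_le_one_right ha (Real.exp_le_one_iff.mpr (neg_nonpos.mpr (abs_nonneg _)))

theorem abs_peak_le {a : ℝ} (ha : 0 ≤ a) (b x : ℝ) : |peak a b x| ≤ a := by
  rw [abs_of_nonneg (peak_nonneg ha b x)]
  exact peak_le ha b x

theorem memLp_peak (a b : ℝ) : MemLp (peak a b) 2 volume := by
  rw [memLp_two_iff_integrable_sq (continuous_peak a b).aestronglyMeasurable]
  refine Integrable.mono' ((integrable_inv_one_add_sq.comp_sub_right b).const_mul (a ^ 2))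
    ((continuous_peak a b).pow 2).aestronglyMeasurable (Eventually.of_forall fun x => ?_)
  rw [Real.norm_of_nonneg (sq_nonneg _), peak, mul_pow]
  refine mul_le_mul_of_nonneg_left ?_ (sq_nonneg a)
  rw [Real.exp_neg, inv_pow]
  refine inv_anti₀ (by positivity) ?_
  have h1 := Real.add_one_le_exp |x - b|
  have h2 := abs_nonneg (x - b)
  rw [← sq_abs (x - b)]
  nlinarith

theorem memLp_peakSign_mul (a b : ℝ) : MemLp (fun x => peakSign b x * peak a b x) 2 volume := by
  have := memLp_mul_of_bound (measurable_peakSign b).aestronglyMeasurable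
    (Eventually.of_forall fun x => (abs_peakSign b x).le) (toL2 (peak a b))
  refine this.ae_eq ?_
  filter_upwards [coeFn_toL2 (memLp_peak a b)] with x hx
  rw [hx]

theorem isPrimitive_peak (a b : ℝ) :
    IsPrimitive (peak a b) fun x => peakSign b x * peak a b x :=
  .of_hasDerivAt_of_ne (continuous_peak a b)
    ((memLp_peakSign_mul a b).locallyIntegrable (by norm_num)) fun _ hx => hasDerivAt_peak a hx

/-- The peakon as an element of `H¹`. -/
def peakH1 (a b : ℝ) : H1 :=
  H1.mk ((isPrimitive_peak a b).hasWeakDeriv (coeFn_toL2 (memLp_peak a b))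
    (coeFn_toL2 (memLp_peakSign_mul a b)))

theorem peakH1_fn (a b : ℝ) : (peakH1 a b).fn =ᵐ[volume] peak a b := coeFn_toL2 (memLp_peak a b)

theorem peakH1_dx (a b : ℝ) : (peakH1 a b).dx =ᵐ[volume] fun x => peakSign b x * peak a b x :=
  coeFn_toL2 (memLp_peakSign_mul a b)

theorem ae_abs_peakH1_fn_le {a : ℝ} (ha : 0 ≤ a) (b : ℝ) : ∀ᵐ x, |(peakH1 a b).fn x| ≤ a := by
  filter_upwards [peakH1_fn a b] with x hx
  rw [hx]
  exact abs_peak_le ha b x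

theorem ae_abs_peakH1_dx_le {a : ℝ} (ha : 0 ≤ a) (b : ℝ) : ∀ᵐ x, |(peakH1 a b).dx x| ≤ a := by
  filter_upwards [peakH1_dx a b] with x hx
  rw [hx, abs_mul, abs_peakSign, one_mul]
  exact abs_peak_le ha b x

/-- `(a - v) vₓ` is the derivative of `a v - v² / 2`, and it is itself weakly differentiable because
`a - v` vanishes at the peak. -/
theorem isPrimitive_peak_force (a b : ℝ) :
    IsPrimitive (fun x => peakSign b x * ((a - peak a b x) * peak a b x))
      fun x => a * peak a b x - 2 * peak a b x ^ 2 := by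
  have hc := continuous_peak a b
  refine .of_hasDerivAt_of_ne (b := b) ?_ (by fun_prop : Continuous _).locallyIntegrable
    fun x hx => ?_
  · have : (fun x => peakSign b x * ((a - peak a b x) * peak a b x))
        = fun x => if x ≤ b then (a - peak a b x) * peak a b x
          else -((a - peak a b x) * peak a b x) := by
      funext x
      unfold peakSign
      split_ifs <;> ring
    rw [this]
    refine Continuous.if_le (by fun_prop) (by fun_prop) continuous_id continuous_const ?_
    intro x hx
    simp [peak, show x = b from hx]
  · have h1 := hasDerivAt_peak a hx
    have h2 := (((hasDerivAt_const x a).sub h1).mul h1).const_mul (peakSign b x)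
    refine HasDerivAt.congr_of_eventuallyEq ?_ ?_ (f := fun y =>
      peakSign b x * ((a - peak a b y) * peak a b y))
    · refine h2.congr_deriv ?_
      rw [Pi.sub_apply]
      linear_combination (a * peak a b x - 2 * peak a b x ^ 2) * peakSign_sq b x
    · filter_upwards [peakSign_eventuallyEq hx] with y hy
      rw [hy]

theorem chEquation_peakH1 {a : ℝ} (ha : 0 ≤ a) (b : ℝ) :
    CHEquation 0 (peakH1 a b) (-(a • (peakH1 a b).dx)) := by
  set v := peakH1 a b with hv
  have hc := continuous_peak a b
  have hp := peak_le ha b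
  have hp0 := peak_nonneg ha b
  have hmem {f : ℝ → ℝ} (hf : AEStronglyMeasurable f volume) (C : ℝ)
      (h : ∀ x, |f x| ≤ C * peak a b x) : MemLp f 2 volume := by
    refine (memLp_peak a b).of_le_mul (c := C) hf (Eventually.of_forall fun x => ?_)
    rw [Real.norm_of_nonneg (hp0 x)]
    exact h x
  have mP : MemLp (fun x => a * peak a b x - peak a b x * peak a b x / 2) 2 volume := by
    refine hmem (by fun_prop : Continuous _).aestronglyMeasurable (2 * a) fun x => ?_
    rw [abs_le]
    constructor <;> nlinarith [hp x, hp0 x, mul_nonneg ha (hp0 x)]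
  have mQ : MemLp (fun x => peakSign b x * ((a - peak a b x) * peak a b x)) 2 volume := by
    refine hmem ((measurable_peakSign b).aestronglyMeasurable.mul
      (by fun_prop : Continuous _).aestronglyMeasurable) a fun x => ?_
    rw [abs_mul, abs_peakSign, one_mul, abs_of_nonneg (mul_nonneg (sub_nonneg.mpr (hp x)) (hp0 x))]
    nlinarith [hp x, hp0 x]
  have mh : MemLp (fun x => 3 / 2 * peak a b x ^ 2) 2 volume := by
    refine hmem (by fun_prop : Continuous _).aestronglyMeasurable (2 * a) fun x => ?_
    rw [abs_of_nonneg (by positivity)]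
    nlinarith [hp x, hp0 x, mul_nonneg ha (hp0 x)]
  set P := toL2 fun x => a * peak a b x - peak a b x * peak a b x / 2
  set Q := toL2 fun x => peakSign b x * ((a - peak a b x) * peak a b x)
  set h := toL2 fun x => 3 / 2 * peak a b x ^ 2
  have hPQ : HasWeakDeriv P Q := by
    refine IsPrimitive.hasWeakDeriv (.of_hasDerivAt_of_ne (b := b) (by fun_prop)
      (mQ.locallyIntegrable (by norm_num)) fun x hx => ?_) (coeFn_toL2 mP) (coeFn_toL2 mQ)
    have h1 := hasDerivAt_peak a hx
    refine ((h1.const_mul a).sub ((h1.mul h1).div_const 2)).congr_deriv ?_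
    ring
  have hQh : HasWeakDeriv Q (P - h) := by
    refine (isPrimitive_peak_force a b).hasWeakDeriv (coeFn_toL2 mQ) ?_
    filter_upwards [Lp.coeFn_sub P h, coeFn_toL2 mP, coeFn_toL2 mh] with x e1 e2 e3
    rw [e1, Pi.sub_apply, e2, e3]
    ring
  -- `vₓ² = v²`, so that `v² + vₓ²/2 = 3 v²/2`
  have key := chEquation_of_potential (κ := 0) (ae_abs_peakH1_dx_le ha b) hPQ hQh (by
    filter_upwards [coeFn_toL2 mh, peakH1_fn a b, peakH1_dx a b] with x e1 e2 e3
    rw [e1, e2, e3]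
    linear_combination (-(peak a b x ^ 2) / 2) * peakSign_sq b x)
  convert key using 1
  refine Lp.ext ?_
  filter_upwards [Lp.coeFn_neg (a • v.dx), Lp.coeFn_smul a v.dx,
    Lp.coeFn_sub (-Q) (toL2 fun x => v.fn x * v.dx x), Lp.coeFn_neg Q, coeFn_toL2 mQ,
    coeFn_toL2 v.memLp_fn_mul_dx, peakH1_fn a b, peakH1_dx a b] with x e1 e2 e3 e4 e5 e6 e7 e8
  rw [e1, Pi.neg_apply, e2, Pi.smul_apply, e3, Pi.sub_apply, e4, Pi.neg_apply, e5, e6, e7, e8,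
    smul_eq_mul]
  ring

theorem isExpanding_sub_const (b : ℝ) : IsExpanding 1 fun x => x - b :=
  ⟨one_pos, le_rfl, measurable_id.sub_const b, fun x y => by rw [one_mul, sub_sub_sub_cancel_right]⟩

theorem compL2_peakH1_fn (a b : ℝ) :
    compL2 (fun x => x - b) (peakH1 a 0).fn = (peakH1 a b).fn := by
  refine Lp.ext ?_
  filter_upwards [(isExpanding_sub_const b).coeFn_compL2 (peakH1 a 0).fn,
    (isExpanding_sub_const b).ae_comp (peakH1_fn a 0), peakH1_fn a b] with x h1 h2 h3
  rw [h1, h2, h3, peak, peak, sub_zero]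

theorem compL2_peakH1_dx (a b : ℝ) :
    compL2 (fun x => x - b) (peakH1 a 0).dx = (peakH1 a b).dx := by
  refine Lp.ext ?_
  filter_upwards [(isExpanding_sub_const b).coeFn_compL2 (peakH1 a 0).dx,
    (isExpanding_sub_const b).ae_comp (peakH1_dx a 0), peakH1_dx a b] with x h1 h2 h3
  rw [h1, h2, h3, peak, peak, sub_zero, peakSign, peakSign]
  simp only [sub_nonpos]

theorem continuous_peakH1 (a : ℝ) : Continuous (peakH1 a) := by
  refine continuous_iff_continuousAt.mpr fun b => ?_
  have h (f : L2) : Tendsto (fun s => compL2 (fun x => x - s) f) (𝓝 b)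
      (𝓝 (compL2 (fun x => x - b) f)) := by
    refine tendsto_compL2 (c := 1) (d := fun s => |s - b|) (Eventually.of_forall
      isExpanding_sub_const) (isExpanding_sub_const b) tendsto_const_nhds
      (Eventually.of_forall fun s x => ?_) ?_
    · rw [sub_sub_sub_cancel_left, abs_sub_comm]
    · have : Continuous fun s => |s - b| := by fun_prop
      simpa using this.tendsto b
  refine H1.tendsto_iff.mpr ⟨?_, ?_⟩
  · simpa only [compL2_peakH1_fn] using h (peakH1 a 0).fn
  · simpa only [compL2_peakH1_dx] using h (peakH1 a 0).dx

theorem hasDerivAt_peakH1_fn {a : ℝ} (ha : 0 ≤ a) (t : ℝ) :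
    HasDerivAt (fun t => (peakH1 a (a * t)).fn) (-(a • (peakH1 a (a * t)).dx)) t := by
  have hcont : Continuous fun t => -(a • (peakH1 a (a * t)).dx) :=
    ((H1.dxL.continuous.comp
      ((continuous_peakH1 a).comp (continuous_const.mul continuous_id))).const_smul a).neg
  refine L2.hasDerivAt_of_test (a := t - 1) (b := t + 1)
    (p := fun t => (peakH1 a (a * t)).fn) (r := fun t => -(a • (peakH1 a (a * t)).dx))
    hcont.continuousOn (fun φ hφ s hs => ?_) ⟨by linarith, by linarith⟩
  have key := hasDerivAt_integral_compL2 (a := fun _ => (peakH1 a 0).fn) (a' := 0)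
    (θ := fun t x => x - a * t) (f := peak a 0) (K := a.toNNReal) (c := 1) (C := a)
    (d := fun y => -(a * (peakSign (a * s) y * peak a (a * s) y))) hs (hasDerivAt_const _ _)
    (fun τ _ => isExpanding_sub_const (a * τ)) (fun τ _ σ _ y => ?_) ?_ (peakH1_fn a 0) ?_ ?_ hφ
  · simp only [compL2_peakH1_fn] at key
    convert key using 1
    refine integral_congr_ae ?_
    have h0 := (isExpanding_sub_const (a * s)).ae_comp (Lp.coeFn_zero ℝ 2 (volume : Measure ℝ))
    filter_upwards [h0, Lp.coeFn_neg (a • (peakH1 a (a * s)).dx),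
      Lp.coeFn_smul a (peakH1 a (a * s)).dx, peakH1_dx a (a * s)] with x e1 e2 e3 e4
    rw [e1, e2, Pi.neg_apply, e3, Pi.smul_apply, e4, Pi.zero_apply, zero_add, smul_eq_mul]
  · rw [sub_sub_sub_cancel_left, ← mul_sub, abs_mul, abs_of_nonneg ha, abs_sub_comm]
  · have := H1.lipschitzWith_rep ha (ae_abs_peakH1_dx_le ha 0)
    rwa [H1.rep_eq_of_ae_eq (continuous_peak a 0) (peakH1_fn a 0)] at this
  · exact (((measurable_peakSign _).mul (continuous_peak _ _).measurable).const_mul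
      a).neg.aestronglyMeasurable
  · have hne : ∀ᵐ y : ℝ, y ≠ a * s := by
      rw [ae_iff]
      simp
    filter_upwards [hne] with y hy
    have h1 : HasDerivAt (fun t => y - a * t) (-a) s := by
      have := ((hasDerivAt_id s).const_mul a).const_sub y
      rwa [mul_one] at this
    refine ((hasDerivAt_peak a (b := 0) (sub_ne_zero.mpr hy)).comp s h1).congr_deriv ?_
    rw [peak, peak, sub_zero, peakSign, peakSign]
    simp only [sub_nonpos]
    ring

theorem isSolution_peakH1 {a : ℝ} (ha : 0 ≤ a) (T : ℝ) :
    IsSolution 0 T (peakH1 a (a * 0)) fun t => peakH1 a (a * t) where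
  memZ :=
    { continuousOn_H1 :=
        ((continuous_peakH1 a).comp (continuous_const.mul continuous_id)).continuousOn
      bounded_W1inf := ⟨a.toNNReal + a.toNNReal, Eventually.of_forall fun t =>
        normW1inf_le (ae_abs_peakH1_fn_le ha _) (ae_abs_peakH1_dx_le ha _)⟩
      contDiffOn_L2 := contDiffOn_one_of_hasDerivAt (fun t _ => hasDerivAt_peakH1_fn ha t)
        ((H1.dxL.continuous.comp ((continuous_peakH1 a).comp
          (continuous_const.mul continuous_id))).const_smul a).neg.continuousOn }
  initial := rfl
  equation t _ := by
    rw [dt, (hasDerivAt_peakH1_fn ha t).deriv]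
    exact chEquation_peakH1 ha _

/-! ### A nonincreasing time of existence -/

/-- A nonincreasing time of existence for data in the ball of radius `r` of `X`. No monotonicity of
the time in `exists_solution` is needed: take the minimum of its values at the integers
`n ≤ ⌈r⌉`. -/
theorem exists_antitone_time (κ : ℝ) : ∃ T : ℝ≥0 → ℝ, Antitone T ∧ (∀ r, 0 < T r) ∧
    ∀ (r : ℝ≥0) (u₀ : H1), normX u₀ ≤ r → ∃ u, IsSolution κ (T r) u₀ u ∧
      ∀ t ∈ Icc (-T r) (T r), normX (u t) ≤ 22 * normX u₀ := by
  choose τ hτ h using fun n : ℕ => exists_solution κ n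
  have hne : ∀ r : ℝ≥0, (Finset.range (⌈r⌉₊ + 1)).Nonempty := fun r => by simp
  refine ⟨fun r => (Finset.range (⌈r⌉₊ + 1)).inf' (hne r) τ, fun r s hrs => ?_, fun r => ?_,
    fun r u₀ hu₀ => ?_⟩
  · exact Finset.inf'_mono _ (Finset.range_mono (Nat.add_le_add_right (Nat.ceil_mono hrs) 1)) _
  · exact (Finset.lt_inf'_iff _).mpr fun n _ => hτ n
  · have hle : (Finset.range (⌈r⌉₊ + 1)).inf' (hne r) τ ≤ τ ⌈r⌉₊ :=
      Finset.inf'_le _ (by simp)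
    obtain ⟨u, hu, hb⟩ := h ⌈r⌉₊ u₀ (hu₀.trans (by exact_mod_cast Nat.le_ceil r))
    exact ⟨u, hu.mono hle, fun t ht => hb t (Icc_subset_Icc (neg_le_neg hle) hle ht)⟩

end CamassaHolm

end

theorem theorem1p1 :
    (∃ C : ℝ≥0, 0 < C ∧
      ∀ κ : ℝ, ∃ T : ℝ≥0 → ℝ, Antitone T ∧ (∀ r, 0 < T r) ∧
        -- existence, bound and uniqueness
        (∀ u₀ : CamassaHolm.H1, CamassaHolm.normX u₀ < ⊤ →
          ∃ u : ℝ → CamassaHolm.H1,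
            CamassaHolm.IsSolution κ (T (CamassaHolm.normX u₀).toNNReal) u₀ u ∧
            (∀ t ∈ Set.Icc (-T (CamassaHolm.normX u₀).toNNReal)
                (T (CamassaHolm.normX u₀).toNNReal),
              CamassaHolm.normX (u t) ≤ C * CamassaHolm.normX u₀) ∧
            ∀ v : ℝ → CamassaHolm.H1,
              CamassaHolm.IsSolution κ (T (CamassaHolm.normX u₀).toNNReal) u₀ v →
              ∀ t ∈ Set.Icc (-T (CamassaHolm.normX u₀).toNNReal)
                (T (CamassaHolm.normX u₀).toNNReal), v t = u t) ∧
        -- continuous dependence on balls of `X`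
        (∀ B : ℝ≥0, 0 < B →
          ∀ u₀ : CamassaHolm.H1, CamassaHolm.normX u₀ ≤ B →
          ∀ ε : ℝ, 0 < ε → ∃ δ : ℝ≥0, 0 < δ ∧
            ∀ v₀ : CamassaHolm.H1, CamassaHolm.normX v₀ ≤ B →
              CamassaHolm.normX (v₀ - u₀) < δ →
              ∀ u v : ℝ → CamassaHolm.H1,
                CamassaHolm.IsSolution κ (T B) u₀ u →
                CamassaHolm.IsSolution κ (T B) v₀ v →
                (∀ t ∈ Set.Icc (-T B) (T B), ‖v t - u t‖ < ε) ∧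
                (∀ t ∈ Set.Ioo (-T B) (T B),
                  ‖CamassaHolm.dt v t - CamassaHolm.dt u t‖ < ε))) ∧
    -- the peakons
    (∀ c T : ℝ, 0 < c → 0 < T →
      ∃ u : ℝ → CamassaHolm.H1,
        (∀ t, ∀ᵐ x, (u t).fn x = c * Real.exp (-|x - c * t|)) ∧
        CamassaHolm.normX (u 0) < ⊤ ∧
        CamassaHolm.IsSolution 0 T (u 0) u) := by
  open CamassaHolm in
  refine ⟨⟨22, by norm_num, fun κ => ?_⟩, fun a T ha _ => ?_⟩
  · obtain ⟨T, hTa, hT0, hT⟩ := exists_antitone_time κ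
    refine ⟨T, hTa, hT0, fun u₀ hu₀ => ?_, fun B hB u₀ hu₀ ε hε => ?_⟩
    · obtain ⟨u, hu, hb⟩ := hT (normX u₀).toNNReal u₀ (ENNReal.coe_toNNReal hu₀.ne).ge
      exact ⟨u, hu, hb, fun v hv => hu.eqOn hv (hT0 _)⟩
    · -- every solution with datum in the ball is the one constructed, hence bounded by `22 B`
      have hbd : ∀ w₀ : H1, normX w₀ ≤ B → ∀ w, IsSolution κ (T B) w₀ w →
          IsEulerian (22 * B : ℝ≥0) κ (T B) w := by
        intro w₀ hw₀ w hw
        obtain ⟨w', hw', hb⟩ := hT B w₀ hw₀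
        refine hw.isEulerian (hT0 B) NNReal.zero_le_coe fun t ht => ?_
        rw [hw'.eqOn hw (hT0 B) ht]
        refine bounds_of_normX_le ((hb t ht).trans ?_)
        rw [ENNReal.coe_mul]
        exact mul_le_mul_right hw₀ _
      set L := accelConst 1 (22 * B : ℝ≥0) κ (22 * B : ℝ≥0) + 2 * (22 * B : ℝ≥0) with hL
      have hL0 : 0 ≤ L := add_nonneg (accelConst_nonneg _ _ _ NNReal.zero_le_coe) (by positivity)
      obtain ⟨u, hu, -⟩ := hT B u₀ hu₀
      have hε' : 0 < ε / (1 + L) := by positivity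
      obtain ⟨δ, hδ, H⟩ := (hbd u₀ hu₀ u hu).exists_norm_sub_lt hε'
      refine ⟨δ.toNNReal, by simpa using hδ, fun v₀ hv₀ hvu u' v hu' hv => ?_⟩
      have hu'E := hbd u₀ hu₀ u' hu'
      have hvE := hbd v₀ hv₀ v hv
      have h0 : ‖v 0 - u 0‖ < δ := by
        have h1 : ‖v₀ - u₀‖ₑ < δ.toNNReal := lt_of_le_of_lt le_self_add hvu
        rw [← ofReal_norm] at h1
        rw [hv.initial, hu.initial]
        exact (ENNReal.ofReal_lt_ofReal_iff hδ).mp h1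
      have key : ∀ t ∈ Set.Icc (-T B) (T B), ‖v t - u' t‖ < ε / (1 + L) := fun t ht => by
        rw [hu.eqOn hu' (hT0 B) ht]
        exact H v hvE h0 t ht
      refine ⟨fun t ht => (key t ht).trans_le (div_le_self hε.le (by linarith)), fun t ht => ?_⟩
      have h2 := key t (Set.Ioo_subset_Icc_self ht)
      rw [lt_div_iff₀ (by positivity)] at h2
      have h3 := norm_dt_sub_le hu' hv hu'E hvE ht
      have h4 := norm_nonneg (v t - u' t)
      rw [← hL] at h3
      rcases h4.eq_or_lt with h5 | h5
      · rw [← h5, mul_zero] at h3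
        exact h3.trans_lt hε
      · nlinarith
  · refine ⟨fun t => peakH1 a (a * t), fun t => peakH1_fn a (a * t), ?_,
      isSolution_peakH1 ha.le T⟩
    exact (normX_le le_rfl (ae_abs_peakH1_fn_le ha.le _) (ae_abs_peakH1_dx_le ha.le _) ha.le
      ha.le).trans_lt ENNReal.ofReal_lt_top
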